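/- **Corollary 3.3.** Write $\langle x\rangle=(1+|x|^2)^{1/2}$. Let $V:\mathbb R^2\to\mathbb R$ be measurable, $v=|V|^{1/2}$, and suppose that for some constants $C$ and $\epsilon>0$ we have $v(x)\le C\langle x\rangle^{-3-\epsilon}$ for all $x\in\mathbb R^2$. Let $U(x)=1$ if $V(x)\ge 0$ and $U(x)=-1$ if $V(x)<0$, let $G_0f(x)=-\frac1{2\pi}\int_{\mathbb R^2}\log|x-y|\,f(y)\,dy$, let $P$ be the orthogonal projection of $L^2(\mathbb R^2)$ onto the span of $v$, and let $Q=1-P$. Then $T=U+vG_0v$ is a bounded operator on $L^2(\mathbb R^2)$. Let $S_1$ be the orthogonal projection of $QL^2(\mathbb R^2)$ onto the kernel of $QTQ$ (so $S_1=0$ if that kernel is trivial). Then $QTQ+S_1$ is invertible on $QL^2(\mathbb R^2)$; put $D_0=(QTQ+S_1)^{-1}$. For $\lambda>0$ let $R_0^\pm(\lambda^2)$ be the integral operators with kernels $\pm\frac i4H_0^\pm(\lambda|x-y|)$, where $H_0^\pm=J_0\pm iY_0$. Let $\lambda_1>0$ and let $\chi:\mathbb R\to\mathbb R$ be smooth with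 $\chi(\lambda)=1$ for $0<\lambda<\lambda_1$ and $\chi(\lambda)=0$ for $\lambda>2\lambda_1$. Then for $u\in L^1(\mathbb R^2)$ the integrals (over $\mathbb R^2$ and in $\lambda$) in $$Au=\frac1{\pi i}\int_0^\infty R_0^-(\lambda^2)\,v\,QD_0Q\,v\,\big[R_0^+(\lambda^2)-R_0^-(\lambda^2)\big]u\;\lambda\,\chi(\lambda)\,d\lambda$$ converge absolutely at every point, with $v[R_0^+(\lambda^2)-R_0^-(\lambda^2)]u\in L^2(\mathbb R^2)$ for every $\lambda>0$; and for every $1\le p\le\infty$ the operator $A$, initially defined on $L^1(\mathbb R^2)\cap L^p(\mathbb R^2)$, extends to a bounded operator on $L^p(\mathbb R^2)$. -/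

import Mathlib

open MeasureTheory
open scoped ENNReal ContDiff

noncomputable section

namespace WaveOp2D

/-- The Euclidean plane `ℝ²`. -/
abbrev Plane : Type := EuclideanSpace ℝ (Fin 2)

/-- The complex Hilbert space `L²(ℝ²)`. -/
abbrev L2 : Type := Lp ℂ 2 (volume : Measure Plane)

/-- The Japanese bracket `⟨x⟩ = (1 + |x|²)^(1/2)`. -/
def bracket (x : Plane) : ℝ := Real.sqrt (1 + ‖x‖ ^ 2)

/-! ### Bessel functions of order zero and the free resolvent -/

/-- The Bessel function `J₀(t) = ∑ₖ (-1)ᵏ (t²/4)ᵏ / (k!)²`. -/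
def besselJ0 (t : ℝ) : ℝ :=
  ∑' k : ℕ, (-1 : ℝ) ^ k * (t ^ 2 / 4) ^ k / (k.factorial : ℝ) ^ 2

/-- The Bessel function of the second kind, for `t > 0`,
`Y₀(t) = (2/π) ((log (t/2) + γ) J₀(t) - ∑ₖ (-1)ᵏ Hₖ (t²/4)ᵏ / (k!)²)`,
with `γ` Euler's constant and `Hₖ` the harmonic numbers (`H₀ = 0`). -/
def besselY0 (t : ℝ) : ℝ :=
  2 / Real.pi * ((Real.log (t / 2) + Real.eulerMascheroniConstant) * besselJ0 t
    - ∑' k : ℕ, (-1 : ℝ) ^ k * ((harmonic k : ℚ) : ℝ) * (t ^ 2 / 4) ^ k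
        / (k.factorial : ℝ) ^ 2)

/-- `H₀⁺ = J₀ + i Y₀`. -/
def hankelPlus (t : ℝ) : ℂ := (besselJ0 t : ℂ) + Complex.I * (besselY0 t : ℂ)

/-- `H₀⁻ = J₀ - i Y₀`. -/
def hankelMinus (t : ℝ) : ℂ := (besselJ0 t : ℂ) - Complex.I * (besselY0 t : ℂ)

/-- Integral kernel of the limiting free resolvent `R₀⁺(l²)`, `l > 0`:
`(i/4) H₀⁺(l|x-y|)`. -/
def freeResPlus (l : ℝ) (x y : Plane) : ℂ := Complex.I / 4 * hankelPlus (l * ‖x - y‖)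

/-- Integral kernel of the limiting free resolvent `R₀⁻(l²)`, `l > 0`:
`-(i/4) H₀⁻(l|x-y|)`. -/
def freeResMinus (l : ℝ) (x y : Plane) : ℂ := -(Complex.I / 4) * hankelMinus (l * ‖x - y‖)

/-! ### The potential and the operators built from it -/

/-- `v = |V|^(1/2)`. -/
def vfun (V : Plane → ℝ) (x : Plane) : ℝ := Real.sqrt |V x|

/-- `U = 1` where `V ≥ 0`, and `U = -1` where `V < 0`. -/
def Ufun (V : Plane → ℝ) (x : Plane) : ℝ := if 0 ≤ V x then 1 else -1

/-- `G₀ f(x) = -(1/2π) ∫ log|x-y| f(y) dy`. -/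
def G0 (f : Plane → ℂ) (x : Plane) : ℂ :=
  -(1 / (2 * (Real.pi : ℂ))) * ∫ y : Plane, (Real.log ‖x - y‖ : ℂ) * f y

/-- `T` is the bounded operator `U + v G₀ v` on `L²(ℝ²)`.  This determines `T`. -/
def IsUvGv (V : Plane → ℝ) (T : L2 →L[ℂ] L2) : Prop :=
  ∀ f : L2, (T f : Plane → ℂ) =ᵐ[volume]
    fun x => (Ufun V x : ℂ) * f x + (vfun V x : ℂ) * G0 (fun y => (vfun V y : ℂ) * f y) x

/-- The subspace `Q L²(ℝ²)`, the orthogonal complement of the span of `v`.  (The set on the right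
contains exactly one element, the class of `v`, when `v` is square integrable.) -/
def QL2 (V : Plane → ℝ) : Submodule ℂ L2 :=
  (Submodule.span ℂ {f : L2 | (f : Plane → ℂ) =ᵐ[volume] fun x => (vfun V x : ℂ)})ᗮ

instance (V : Plane → ℝ) : CompleteSpace (QL2 V) := by
  unfold QL2; infer_instance

/-- `Q T Q` as an operator on `Q L²(ℝ²)`. -/
def QTQ (V : Plane → ℝ) (T : L2 →L[ℂ] L2) : QL2 V →L[ℂ] QL2 V :=
  (QL2 V).orthogonalProjectionOnto ∘L T ∘L (QL2 V).subtypeL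

/-- `S₁`, the projection in `Q L²(ℝ²)` onto the kernel of the self-adjoint operator `Q T Q`. -/
def S1 (V : Plane → ℝ) (T : L2 →L[ℂ] L2) : QL2 V →L[ℂ] QL2 V :=
  (QTQ V T).ker.starProjection

/-- `D₀ = (Q T Q + S₁)⁻¹` on `Q L²(ℝ²)` (`Ring.inverse` is the inverse of a unit). -/
def D0 (V : Plane → ℝ) (T : L2 →L[ℂ] L2) : QL2 V →L[ℂ] QL2 V :=
  Ring.inverse (QTQ V T + S1 V T)

/-- `Q D₀ Q` as an operator on `L²(ℝ²)`. -/
def QD0Q (V : Plane → ℝ) (T : L2 →L[ℂ] L2) : L2 →L[ℂ] L2 :=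
  (QL2 V).subtypeL ∘L D0 V T ∘L (QL2 V).orthogonalProjectionOnto

/-- The class in `L²(ℝ²)` of a square integrable function (and `0` for other functions). -/
def toL2 (f : Plane → ℂ) : L2 := by
  classical exact if h : MemLp f 2 (volume : Measure Plane) then h.toLp f else 0

/-- `[R₀⁺(l²) - R₀⁻(l²)] u`. -/
def resDiff (l : ℝ) (u : Plane → ℂ) (w : Plane) : ℂ :=
  ∫ y : Plane, (freeResPlus l w y - freeResMinus l w y) * u y

/-- `R₀⁻(l²) v B v [R₀⁺(l²) - R₀⁻(l²)] u` for a bounded operator `B` on `L²(ℝ²)`. -/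
def sandwich (V : Plane → ℝ) (B : L2 →L[ℂ] L2) (l : ℝ) (u : Plane → ℂ) (x : Plane) : ℂ :=
  ∫ z : Plane, freeResMinus l x z *
    ((vfun V z : ℂ) * B (toL2 fun w => (vfun V w : ℂ) * resDiff l u w) z)

/-- The low energy operator
`A u = (1/(π i)) ∫₀^∞ R₀⁻(l²) v B v [R₀⁺(l²) - R₀⁻(l²)] u  l χ(l) dl`.
See `OpConverges` for the convergence of the integrals. -/
def lowEnergyOp (V : Plane → ℝ) (B : L2 →L[ℂ] L2) (χ : ℝ → ℝ) (u : Plane → ℂ) (x : Plane) : ℂ :=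
  1 / ((Real.pi : ℂ) * Complex.I) *
    ∫ l in Set.Ioi (0 : ℝ), sandwich V B l u x * (l : ℂ) * (χ l : ℂ)

/-- All the integrals in the definition of `lowEnergyOp V B χ u x` converge absolutely, for every
`x`, and `v [R₀⁺(l²) - R₀⁻(l²)] u`, to which `B` is applied, is in `L²(ℝ²)`. -/
def OpConverges (V : Plane → ℝ) (B : L2 →L[ℂ] L2) (χ : ℝ → ℝ) (u : Plane → ℂ) : Prop :=
  (∀ l : ℝ, 0 < l →
    (∀ w : Plane, Integrable (fun y => (freeResPlus l w y - freeResMinus l w y) * u y) volume) ∧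
    MemLp (fun w => (vfun V w : ℂ) * resDiff l u w) 2 volume ∧
    ∀ x : Plane, Integrable (fun z => freeResMinus l x z *
      ((vfun V z : ℂ) * B (toL2 fun w => (vfun V w : ℂ) * resDiff l u w) z)) volume) ∧
  ∀ x : Plane,
    IntegrableOn (fun l : ℝ => sandwich V B l u x * (l : ℂ) * (χ l : ℂ)) (Set.Ioi 0) volume

end WaveOp2D

end

open WaveOp2D

namespace WaveOp2D
open Filter Topology

/-! The operator `A` has the kernel `K(x,y) = (1/πi) ∫ ⟪v p(l|x-·|), B v q(l|y-·|)⟫ l χ(l) dl`,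
where `B = Q D₀ Q`, `q` is the profile of `R₀⁺ - R₀⁻` (a multiple of `J₀`) and `p` is the conjugate
profile of `R₀⁻`. It is bounded on every `L^p` by Schur's test once `|K(x,y)| ≤ C (1+|x|)^(-1/2)
(1+|y|)^(-1/2) (1+||x|-|y||)^(-2)`, because the planar area element turns this bound into a
one-dimensional convolution (`exists_integral_radialKernel`).

The bound rests on a cancellation. `B` kills `v` and its range is orthogonal to `v`, so `h(l|x-z|)`
may be replaced by `h(l|x-z|) - h(lX)` with `X = 1+|x|`. A solution `h` of Bessel's equation is
`e^{it} b₊ + e^{-it} b₋` with amplitudes of size `t^(-1/2)` whose Euler derivatives `(t d/dt)^k b`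
are again of this size (`isSymbol_amplitude`). With `e^{±ilX}` pulled out, there remains
`e^{±il(|x-z|-X)} b(l|x-z|) - b(lX)`. Since `||x-z|-X| ≤ 1+|z|`, its `L²` norm against `v`, and that
of two Euler derivatives, is `O((κ+√l) X^(-1/2))`; two powers of `1+|z|` are lost, which is why `v`
must decay like `⟨z⟩^(-3-ε)` (`norm_subAmp_le`, `exists_isL2Symbol_ampL2`). Here `κ = 1` for `p`, on
account of the logarithm in `Y₀`, and `κ = 0` for `q`. The pairing is thus a symbol of size `√l`,
and after multiplication by `l` its second derivative is `O(l^(-1/2))`, hence integrable. Two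
integrations by parts against the phases `±X±Y`, none smaller in modulus than `||x|-|y||`, give the
bound (`norm_integral_exp_mul_le`, `exists_norm_lowEnergyKernel_le`).

Invertibility of `QTQ + S₁` is Fredholm theory: `v G₀ v` is Hilbert–Schmidt and `U² = 1`, so `QUQ`
inverts `QTQ` modulo compact operators, and a self-adjoint operator with a parametrix becomes
invertible when the projection onto its kernel is added (`isUnit_add_ker_starProjection`). -/

/-! ### Entire power series with factorially decaying coefficients -/

/-- The sum of the power series with coefficients `a`. -/
noncomputable def powerSum (a : ℕ → ℝ) (q : ℝ) : ℝ := ∑' k : ℕ, a k * q ^ k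

/-- The coefficients of the derived power series. -/
def shiftCoeff (a : ℕ → ℝ) (k : ℕ) : ℝ := (k + 1) * a (k + 1)

/-- Coefficients bounded by those of a multiple of the exponential series. -/
def ExpBounded (a : ℕ → ℝ) : Prop := ∃ M : ℝ, ∀ k, |a k| ≤ M / (k.factorial : ℝ)

theorem ExpBounded.derivCoeff {a : ℕ → ℝ} (ha : ExpBounded a) : ExpBounded (shiftCoeff a) := by
  obtain ⟨M, hM⟩ := ha
  refine ⟨M, fun k => ?_⟩
  have h := hM (k + 1)
  have hk : (0 : ℝ) < k + 1 := by positivity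
  have hf : (0 : ℝ) < k.factorial := by positivity
  rw [shiftCoeff, abs_mul, abs_of_pos hk]
  rw [Nat.factorial_succ] at h
  push_cast at h
  calc (k + 1 : ℝ) * |a (k + 1)| ≤ (k + 1) * (M / ((k + 1) * k.factorial)) := by gcongr
    _ = M / k.factorial := by field_simp

theorem ExpBounded.summable {a : ℕ → ℝ} (ha : ExpBounded a) (q : ℝ) :
    Summable fun k => a k * q ^ k := by
  obtain ⟨M, hM⟩ := ha
  refine Summable.of_norm_bounded (g := fun k => M * (|q| ^ k / k.factorial))
    ((Real.summable_pow_div_factorial |q|).mul_left M) fun k => ?_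
  rw [Real.norm_eq_abs, abs_mul, abs_pow]
  calc |a k| * |q| ^ k ≤ M / k.factorial * |q| ^ k := by gcongr; exact hM k
    _ = _ := by ring

/-- Termwise differentiation on the ball of radius `|q| + 1`, where the derived series has a
summable majorant. -/
theorem ExpBounded.hasDerivAt_powerSum {a : ℕ → ℝ} (ha : ExpBounded a) (q : ℝ) :
    HasDerivAt (powerSum a) (powerSum (shiftCoeff a) q) q := by
  set R := |q| + 1 with hR
  have hR0 : 0 < R := by positivity
  have hsum : Summable fun k : ℕ => |a k| * (k * R ^ (k - 1)) := by
    rw [← summable_nat_add_iff 1]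
    have h := (ha.derivCoeff.summable R).abs
    refine h.congr fun k => ?_
    rw [shiftCoeff, abs_mul, abs_mul, abs_of_pos (by positivity : (0 : ℝ) < k + 1),
      abs_of_pos (by positivity : (0 : ℝ) < R ^ k)]
    push_cast
    ring
  have hmain := hasDerivAt_tsum_of_isPreconnected (g := fun k y => a k * y ^ k)
    (g' := fun k y => a k * (k * y ^ (k - 1))) (t := Metric.ball 0 R) (y₀ := 0) (y := q) hsum
    Metric.isOpen_ball (convex_ball (0 : ℝ) R).isPreconnected
    (fun k y _ => (hasDerivAt_pow k y).const_mul (a k))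
    (fun k y hy => by
      rw [Metric.mem_ball, dist_zero_right, Real.norm_eq_abs] at hy
      rw [Real.norm_eq_abs, abs_mul, abs_mul, abs_pow, Nat.abs_cast]
      gcongr)
    (Metric.mem_ball_self hR0) (ha.summable 0)
    (by rw [Metric.mem_ball, dist_zero_right, Real.norm_eq_abs]; linarith)
  have heq : ∑' k : ℕ, a k * (k * q ^ (k - 1)) = powerSum (shiftCoeff a) q := by
    have hs : Summable fun k : ℕ => a k * (k * q ^ (k - 1)) := by
      refine Summable.of_norm_bounded hsum fun k => ?_
      rw [Real.norm_eq_abs, abs_mul, abs_mul, abs_pow, Nat.abs_cast]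
      gcongr
      linarith
    rw [hs.tsum_eq_zero_add, powerSum]
    simp only [Nat.cast_zero, zero_mul, mul_zero, zero_add, shiftCoeff, Nat.add_sub_cancel]
    refine tsum_congr fun k => ?_
    push_cast
    ring
  rw [← heq]
  exact hmain

/-- The operator `q d/dq` acts on coefficients as multiplication by `k`; this turns differential
equations into recurrences. -/
theorem ExpBounded.mul_powerSum_shiftCoeff {a : ℕ → ℝ} (ha : ExpBounded a) (q : ℝ) :
    q * powerSum (shiftCoeff a) q = powerSum (fun k => k * a k) q := by
  have hs : Summable fun k : ℕ => (k * a k : ℝ) * q ^ k := by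
    rw [← summable_nat_add_iff 1]
    refine ((ha.derivCoeff.summable q).mul_left q).congr fun k => ?_
    rw [shiftCoeff]; push_cast; ring
  rw [powerSum, powerSum, hs.tsum_eq_zero_add, ← tsum_mul_left]
  simp only [Nat.cast_zero, zero_mul, zero_add, shiftCoeff]
  refine tsum_congr fun k => ?_
  push_cast; ring

theorem powerSum_add {a b : ℕ → ℝ} (ha : ExpBounded a) (hb : ExpBounded b) (q : ℝ) :
    powerSum a q + powerSum b q = powerSum (fun k => a k + b k) q := by
  rw [powerSum, powerSum, powerSum, ← (ha.summable q).tsum_add (hb.summable q)]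
  exact tsum_congr fun k => by ring

/-! ### The two Bessel series and their coefficient recurrences -/

/-- The coefficients of `J₀` as a power series in `t² / 4`. -/
noncomputable def j0Coeff (k : ℕ) : ℝ := (-1 : ℝ) ^ k / (k.factorial : ℝ) ^ 2

/-- The coefficients of the regular part of `Y₀` as a power series in `t² / 4`. -/
noncomputable def y0Coeff (k : ℕ) : ℝ :=
  (-1 : ℝ) ^ k * ((harmonic k : ℚ) : ℝ) / (k.factorial : ℝ) ^ 2

theorem expBounded_j0Coeff : ExpBounded j0Coeff := by
  refine ⟨1, fun k => ?_⟩
  have hf : (1 : ℝ) ≤ k.factorial := by exact_mod_cast Nat.one_le_iff_ne_zero.2 k.factorial_ne_zero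
  rw [j0Coeff, abs_div, abs_pow, abs_neg, abs_one, one_pow, abs_of_pos (by positivity)]
  gcongr
  nlinarith

theorem harmonic_nonneg_le (k : ℕ) : (0 : ℝ) ≤ (harmonic k : ℚ) ∧ ((harmonic k : ℚ) : ℝ) ≤ k := by
  induction k with
  | zero => simp
  | succ k ih =>
    rw [harmonic_succ]
    push_cast
    have h1 : (0 : ℝ) < (k + 1 : ℝ)⁻¹ := by positivity
    have h2 : (k + 1 : ℝ)⁻¹ ≤ 1 := inv_le_one_of_one_le₀ (by simp)
    constructor <;> linarith [ih.1, ih.2]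

theorem expBounded_y0Coeff : ExpBounded y0Coeff := by
  refine ⟨1, fun k => ?_⟩
  have hf : (k : ℝ) ≤ k.factorial := by exact_mod_cast Nat.self_le_factorial k
  have hf0 : (0 : ℝ) < k.factorial := by positivity
  obtain ⟨h0, h1⟩ := harmonic_nonneg_le k
  rw [y0Coeff, abs_div, abs_mul, abs_pow, abs_neg, abs_one, one_pow, abs_of_nonneg h0, one_mul,
    abs_of_pos (by positivity), div_le_div_iff₀ (by positivity) hf0]
  nlinarith

/-- Bessel's equation in the variable `q = t²/4`; on coefficients it is `(k+1)² a_{k+1} = -a_k`. -/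
theorem powerSum_j0_ode (q : ℝ) :
    q * powerSum (shiftCoeff (shiftCoeff j0Coeff)) q + powerSum (shiftCoeff j0Coeff) q
      + powerSum j0Coeff q = 0 := by
  have hb := expBounded_j0Coeff
  have hb1 : ExpBounded fun k : ℕ => k * shiftCoeff j0Coeff k := by
    refine ⟨1, fun k => ?_⟩
    simp only [shiftCoeff, j0Coeff, Nat.factorial_succ]
    have hf : (k : ℝ) ≤ k.factorial := by exact_mod_cast Nat.self_le_factorial k
    have hf0 : (0 : ℝ) < k.factorial := by positivity
    have hk : (0 : ℝ) < (k : ℝ) + 1 := by positivity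
    push_cast
    rw [abs_mul, abs_mul, abs_div, abs_pow, abs_neg, abs_one, one_pow, abs_of_pos hk,
      Nat.abs_cast, abs_of_pos (by positivity : (0 : ℝ) < (((k : ℝ) + 1) * k.factorial) ^ 2)]
    rw [show (k : ℝ) * ((k + 1) * (1 / ((k + 1) * k.factorial : ℝ) ^ 2))
      = k / ((k + 1) * (k.factorial : ℝ) ^ 2) by field_simp,
      div_le_div_iff₀ (by positivity) hf0]
    nlinarith [mul_nonneg (Nat.cast_nonneg (α := ℝ) k) (sq_nonneg (k.factorial : ℝ)), sq_nonneg (k.factorial : ℝ)]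
  rw [hb.derivCoeff.mul_powerSum_shiftCoeff, powerSum_add hb1 hb.derivCoeff]
  have h : ∀ k : ℕ, (k : ℝ) * shiftCoeff j0Coeff k + shiftCoeff j0Coeff k = -j0Coeff k := by
    intro k
    have hf0 : (0 : ℝ) < k.factorial := by positivity
    rw [shiftCoeff, j0Coeff, j0Coeff, Nat.factorial_succ]
    push_cast
    field_simp
    ring
  simp only [h, powerSum]
  rw [← (show ∑' k : ℕ, -(j0Coeff k * q ^ k) = ∑' k : ℕ, -j0Coeff k * q ^ k from
    tsum_congr fun k => by ring), tsum_neg]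
  ring

/-- The right-hand side balances the cross term produced by the logarithm in `Y₀`. On coefficients
the equation is `H_{k+1} = H_k + 1/(k+1)`. -/
theorem powerSum_y0_ode (q : ℝ) :
    q * powerSum (shiftCoeff (shiftCoeff y0Coeff)) q + powerSum (shiftCoeff y0Coeff) q
      + powerSum y0Coeff q = powerSum (shiftCoeff j0Coeff) q := by
  have hb := expBounded_y0Coeff
  have h : ∀ k : ℕ, (k : ℝ) * shiftCoeff y0Coeff k
      = shiftCoeff j0Coeff k + (-y0Coeff k + -shiftCoeff y0Coeff k) := by
    intro k
    have hf0 : (0 : ℝ) < k.factorial := by positivity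
    rw [shiftCoeff, shiftCoeff, y0Coeff, y0Coeff, j0Coeff, Nat.factorial_succ, harmonic_succ]
    push_cast
    field_simp
    ring
  have hn : ∀ {a : ℕ → ℝ}, ExpBounded a → ExpBounded fun k => -a k := by
    rintro a ⟨M, hM⟩
    exact ⟨M, fun k => by rw [abs_neg]; exact hM k⟩
  have hneg : ∀ a : ℕ → ℝ, powerSum (fun k => -a k) q = -powerSum a q := by
    intro a
    rw [powerSum, powerSum, ← tsum_neg]
    exact tsum_congr fun k => by ring
  have ha : ExpBounded fun k => -y0Coeff k + -shiftCoeff y0Coeff k := by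
    obtain ⟨M, hM⟩ := hb
    obtain ⟨N, hN⟩ := expBounded_y0Coeff.derivCoeff
    refine ⟨M + N, fun k => ?_⟩
    rw [add_div, ← abs_neg, neg_add, neg_neg, neg_neg]
    exact (abs_add_le _ _).trans (add_le_add (hM k) (hN k))
  rw [hb.derivCoeff.mul_powerSum_shiftCoeff]
  simp only [h]
  rw [← powerSum_add expBounded_j0Coeff.derivCoeff ha, ← powerSum_add (hn hb) (hn hb.derivCoeff),
    hneg, hneg]
  ring

/-! ### The Bessel equation -/

theorem besselJ0_eq (t : ℝ) : besselJ0 t = powerSum j0Coeff (t ^ 2 / 4) :=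
  tsum_congr fun k => by rw [j0Coeff]; ring

theorem besselY0_eq (t : ℝ) : besselY0 t = 2 / Real.pi *
    ((Real.log (t / 2) + Real.eulerMascheroniConstant) * besselJ0 t
      - powerSum y0Coeff (t ^ 2 / 4)) := by
  rw [besselY0, powerSum]
  congr 2
  exact tsum_congr fun k => by rw [y0Coeff]; ring

/-- The derivative of `J₀`. -/
noncomputable def besselJ0' (t : ℝ) : ℝ := powerSum (shiftCoeff j0Coeff) (t ^ 2 / 4) * (t / 2)

/-- The derivative of `Y₀`. -/
noncomputable def besselY0' (t : ℝ) : ℝ := 2 / Real.pi *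
  (besselJ0 t / t + (Real.log (t / 2) + Real.eulerMascheroniConstant) * besselJ0' t
    - powerSum (shiftCoeff y0Coeff) (t ^ 2 / 4) * (t / 2))

theorem ExpBounded.hasDerivAt_comp {a : ℕ → ℝ} (ha : ExpBounded a) (t : ℝ) :
    HasDerivAt (fun t => powerSum a (t ^ 2 / 4)) (powerSum (shiftCoeff a) (t ^ 2 / 4) * (t / 2)) t := by
  have h1 : HasDerivAt (fun t : ℝ => t ^ 2 / 4) (t / 2) t := by
    refine ((hasDerivAt_pow 2 t).div_const 4).congr_deriv ?_
    push_cast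
    ring
  exact (ha.hasDerivAt_powerSum (t ^ 2 / 4)).comp t h1

theorem hasDerivAt_besselJ0 (t : ℝ) : HasDerivAt besselJ0 (besselJ0' t) t := by
  rw [funext besselJ0_eq]
  exact expBounded_j0Coeff.hasDerivAt_comp t

theorem hasDerivAt_besselJ0' {t : ℝ} (ht : 0 < t) :
    HasDerivAt besselJ0' (-besselJ0 t - besselJ0' t / t) t := by
  have h1 := (expBounded_j0Coeff.derivCoeff.hasDerivAt_comp t).mul ((hasDerivAt_id t).div_const 2)
  refine h1.congr_deriv ?_
  have h := powerSum_j0_ode (t ^ 2 / 4)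
  rw [besselJ0_eq, besselJ0']
  field_simp
  simp only [id]
  linarith

theorem hasDerivAt_log_half {t : ℝ} (ht : 0 < t) :
    HasDerivAt (fun t : ℝ => Real.log (t / 2) + Real.eulerMascheroniConstant) (1 / t) t := by
  have h := (((hasDerivAt_id t).div_const 2).log (by simp only [id]; positivity)).add_const Real.eulerMascheroniConstant
  refine h.congr_deriv ?_
  simp only [id]
  field_simp

theorem hasDerivAt_besselY0 {t : ℝ} (ht : 0 < t) : HasDerivAt besselY0 (besselY0' t) t := by
  rw [funext besselY0_eq]
  have h := (((hasDerivAt_log_half ht).mul (hasDerivAt_besselJ0 t)).sub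
    (expBounded_y0Coeff.hasDerivAt_comp t)).const_mul (2 / Real.pi)
  refine h.congr_deriv ?_
  rw [besselY0']
  ring

theorem hasDerivAt_besselY0' {t : ℝ} (ht : 0 < t) :
    HasDerivAt besselY0' (-besselY0 t - besselY0' t / t) t := by
  have h := ((((hasDerivAt_besselJ0 t).div (hasDerivAt_id t) ht.ne').add
    ((hasDerivAt_log_half ht).mul (hasDerivAt_besselJ0' ht))).sub
    ((expBounded_y0Coeff.derivCoeff.hasDerivAt_comp t).mul ((hasDerivAt_id t).div_const 2))).const_mul
      (2 / Real.pi)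
  refine h.congr_deriv ?_
  have h1 := powerSum_y0_ode (t ^ 2 / 4)
  have h2 : powerSum (shiftCoeff (shiftCoeff y0Coeff)) (t ^ 2 / 4) =
    (powerSum (shiftCoeff j0Coeff) (t ^ 2 / 4) - powerSum (shiftCoeff y0Coeff) (t ^ 2 / 4)
      - powerSum y0Coeff (t ^ 2 / 4)) / (t ^ 2 / 4) := by
    rw [eq_div_iff (by positivity)]; linarith
  rw [besselY0_eq, besselY0', h2, besselJ0']
  simp only [id]
  field_simp
  ring

/-! ### Decay of solutions of the Bessel equation -/

/-- The function `g = √t h` solves `g'' + (1 + 1/(4t²)) g = 0`, and the bounded quantity is its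
energy `g² + g'²`. The derivative of the energy is `-g g'/(2t²)`, at most the energy times the
integrable factor `1/(4t²)`. -/
theorem bessel_energy_bound {h h' : ℝ → ℝ} (hh : ∀ t, 0 < t → HasDerivAt h (h' t) t)
    (hh' : ∀ t, 0 < t → HasDerivAt h' (-h t - h' t / t) t) :
    ∃ E : ℝ, 0 ≤ E ∧ ∀ t, 1 ≤ t → t * h t ^ 2 + t * (h' t + h t / (2 * t)) ^ 2 ≤ E := by
  set e : ℝ → ℝ := fun t => t * h t ^ 2 + t * h' t ^ 2 + h t * h' t + h t ^ 2 / (4 * t) with he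
  have he2 : ∀ t, 0 < t → e t = t * h t ^ 2 + t * (h' t + h t / (2 * t)) ^ 2 := by
    intro t ht
    simp only [he]
    field_simp
    ring
  have hde : ∀ t, 0 < t → HasDerivAt e (-(h t * h' t + h t ^ 2 / (2 * t)) / (2 * t)) t := by
    intro t ht
    have h1 := hh t ht
    have h2 := hh' t ht
    have h3 := ((((hasDerivAt_id t).mul (h1.pow 2)).add ((hasDerivAt_id t).mul (h2.pow 2))).add
      (h1.mul h2)).add ((h1.pow 2).div ((hasDerivAt_id t).const_mul 4) (by simp only [id]; positivity))
    refine h3.congr_deriv ?_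
    simp only [id, Pi.pow_apply]
    field_simp
    ring
  -- The exponential is the integrating factor of Gronwall's inequality; the derivative becomes
  -- minus a square, `-(g+g')²/(4t²)`, times the exponential.
  have hmono : AntitoneOn (fun t => e t * Real.exp (1 / (4 * t))) (Set.Ici 1) := by
    have hd : ∀ t, 0 < t → HasDerivAt (fun t => e t * Real.exp (1 / (4 * t)))
        ((-(h t * h' t + h t ^ 2 / (2 * t)) / (2 * t) - e t / (4 * t ^ 2)) *
          Real.exp (1 / (4 * t))) t := by
      intro t ht
      have h4 : HasDerivAt (fun t : ℝ => 1 / (4 * t)) (-(1 / (4 * t ^ 2))) t := by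
        have := (hasDerivAt_const t (1 : ℝ)).div ((hasDerivAt_id t).const_mul 4)
          (by simp only [id]; positivity)
        refine this.congr_deriv ?_
        simp only [id]; field_simp; ring
      refine ((hde t ht).mul h4.exp).congr_deriv ?_
      ring
    refine antitoneOn_of_deriv_nonpos (convex_Ici 1)
      (fun t ht => (hd t (lt_of_lt_of_le one_pos ht)).continuousAt.continuousWithinAt)
      (fun t ht => ?_) (fun t ht => ?_)
    · rw [interior_Ici] at ht
      exact (hd t (one_pos.trans ht)).differentiableAt.differentiableWithinAt
    · rw [interior_Ici] at ht
      have ht0 : 0 < t := one_pos.trans ht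
      rw [(hd t ht0).deriv]
      refine mul_nonpos_of_nonpos_of_nonneg ?_ (Real.exp_nonneg _)
      rw [he2 t ht0]
      have : -(h t * h' t + h t ^ 2 / (2 * t)) / (2 * t)
          - (t * h t ^ 2 + t * (h' t + h t / (2 * t)) ^ 2) / (4 * t ^ 2)
          = -(h t + (h' t + h t / (2 * t))) ^ 2 / (4 * t) := by
        field_simp
        ring
      rw [this]
      exact div_nonpos_of_nonpos_of_nonneg (by nlinarith [sq_nonneg (h t + (h' t + h t / (2 * t)))]) (by positivity)
  have he0 : ∀ t, 0 < t → 0 ≤ e t := fun t ht => by rw [he2 t ht]; positivity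
  refine ⟨e 1 * Real.exp (1 / (4 * 1)), mul_nonneg (he0 1 one_pos) (Real.exp_nonneg _), fun t ht => ?_⟩
  have ht0 : 0 < t := lt_of_lt_of_le one_pos ht
  rw [← he2 t ht0]
  refine le_trans ?_ (hmono (Set.self_mem_Ici) ht ht)
  exact le_mul_of_one_le_right (he0 t ht0) (Real.one_le_exp (by positivity))

theorem bessel_decay {h h' : ℝ → ℝ} (hh : ∀ t, 0 < t → HasDerivAt h (h' t) t)
    (hh' : ∀ t, 0 < t → HasDerivAt h' (-h t - h' t / t) t) :
    ∃ M : ℝ, 0 ≤ M ∧ ∀ t, 1 ≤ t → |h t| ≤ M * (√t)⁻¹ ∧ |h' t| ≤ M * (√t)⁻¹ := by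
  obtain ⟨E, hE, hb⟩ := bessel_energy_bound hh hh'
  refine ⟨2 * √E, by positivity, fun t ht => ?_⟩
  have ht0 : 0 < t := lt_of_lt_of_le one_pos ht
  have hs : 0 < √t := Real.sqrt_pos.2 ht0
  have key : ∀ x : ℝ, t * x ^ 2 ≤ E → |x| ≤ √E * (√t)⁻¹ := by
    intro x hx
    rw [← div_eq_mul_inv, le_div_iff₀ hs]
    refine Real.le_sqrt_of_sq_le ?_
    rw [mul_pow, sq_abs, Real.sq_sqrt ht0.le]; linarith
  have h1 := key (h t) (by nlinarith [hb t ht, mul_nonneg ht0.le (sq_nonneg (h' t + h t / (2 * t)))])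
  have h2 := key (h' t + h t / (2 * t)) (by nlinarith [hb t ht, mul_nonneg ht0.le (sq_nonneg (h t))])
  have hnn : 0 ≤ √E * (√t)⁻¹ := by positivity
  refine ⟨by linarith, ?_⟩
  have h3 : |h t / (2 * t)| ≤ √E * (√t)⁻¹ := by
    rw [abs_div, abs_of_pos (by positivity : 0 < 2 * t)]
    exact (div_le_self (abs_nonneg _) (by linarith)).trans h1
  have h4 := abs_sub (h' t + h t / (2 * t)) (h t / (2 * t))
  rw [add_sub_cancel_right] at h4
  linarith

theorem exists_bound_Icc {f : ℝ → ℝ} (hf : Continuous f) :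
    ∃ M : ℝ, 0 ≤ M ∧ ∀ t, 0 ≤ t → t ≤ 1 → |f t| ≤ M := by
  obtain ⟨M, hM⟩ := isCompact_Icc.exists_bound_of_continuousOn (s := Set.Icc (0 : ℝ) 1) hf.continuousOn
  exact ⟨M, (norm_nonneg _).trans (hM 0 (by simp)), fun t h0 h1 => hM t ⟨h0, h1⟩⟩

theorem ExpBounded.continuous_comp {a : ℕ → ℝ} (ha : ExpBounded a) :
    Continuous fun t : ℝ => powerSum a (t ^ 2 / 4) :=
  continuous_iff_continuousAt.2 fun t => (ha.hasDerivAt_comp t).continuousAt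

theorem continuous_besselJ0 : Continuous besselJ0 :=
  continuous_iff_continuousAt.2 fun t => (hasDerivAt_besselJ0 t).continuousAt

theorem one_le_inv_sqrt {t : ℝ} (ht : 0 < t) (h1 : t ≤ 1) : 1 ≤ (√t)⁻¹ :=
  (one_le_inv₀ (Real.sqrt_pos.2 ht)).2 (Real.sqrt_le_one.2 h1)

theorem besselJ0_bounds : ∃ M : ℝ, 0 ≤ M ∧ (∀ t, 0 ≤ t → |besselJ0 t| ≤ M) ∧
    ∀ t, 0 < t → |besselJ0 t| ≤ M * (√t)⁻¹ ∧ |besselJ0' t| ≤ M * (√t)⁻¹ := by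
  obtain ⟨M1, h1, hM1⟩ := exists_bound_Icc continuous_besselJ0
  obtain ⟨M2, h2, hM2⟩ := exists_bound_Icc (f := besselJ0') (by
    exact (expBounded_j0Coeff.derivCoeff.continuous_comp).mul (by fun_prop))
  obtain ⟨M3, h3, hM3⟩ := bessel_decay (fun t _ => hasDerivAt_besselJ0 t) (fun t => hasDerivAt_besselJ0')
  refine ⟨M1 + M2 + M3, by positivity, fun t ht => ?_, fun t ht => ?_⟩
  · rcases le_total t 1 with h | h
    · linarith [hM1 t ht h]
    · have := (hM3 t h).1
      have h4 : (√t)⁻¹ ≤ 1 := inv_le_one_of_one_le₀ (Real.one_le_sqrt.2 h)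
      nlinarith
  · have hs : 0 ≤ (√t)⁻¹ := by positivity
    rcases le_total t 1 with h | h
    · have h4 := one_le_inv_sqrt ht h
      have := hM1 t ht.le h
      have := hM2 t ht.le h
      constructor <;> nlinarith
    · have := hM3 t h
      constructor <;> nlinarith [this.1, this.2]

theorem abs_log_le_inv_sqrt {t : ℝ} (ht : 0 < t) (h1 : t ≤ 1) : |Real.log t| ≤ 2 * (√t)⁻¹ := by
  have hs : 0 < √t := Real.sqrt_pos.2 ht
  have h := Real.log_le_sub_one_of_pos (inv_pos.2 hs)
  rw [Real.log_inv, Real.log_sqrt ht.le] at h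
  rw [abs_of_nonpos (Real.log_nonpos ht.le h1)]
  linarith

/-- For `t ≤ 1` the logarithm is absorbed in `t^(-1/2)`, and its derivative is the source of the
term `t⁻¹`. For `t ≥ 1` the energy bound applies. -/
theorem besselY0_bounds : ∃ M : ℝ, 0 ≤ M ∧
    ∀ t, 0 < t → |besselY0 t| ≤ M * (√t)⁻¹ ∧ |besselY0' t| ≤ M * ((√t)⁻¹ + t⁻¹) := by
  obtain ⟨M1, h1, -, hM1⟩ := besselJ0_bounds
  obtain ⟨MJ, hJ, hMJ⟩ := exists_bound_Icc continuous_besselJ0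
  obtain ⟨MJ', hJ', hMJ'⟩ := exists_bound_Icc (expBounded_j0Coeff.derivCoeff.continuous_comp)
  obtain ⟨M2, h2, hM2⟩ := exists_bound_Icc (expBounded_y0Coeff.continuous_comp)
  obtain ⟨M4, h4, hM4⟩ := exists_bound_Icc (expBounded_y0Coeff.derivCoeff.continuous_comp)
  obtain ⟨M3, h3, hM3⟩ := bessel_decay (fun t => hasDerivAt_besselY0) (fun t => hasDerivAt_besselY0')
  set G : ℝ := |Real.log 2| + |Real.eulerMascheroniConstant| with hG
  have hG0 : 0 ≤ G := by positivity
  have hpi : 2 / Real.pi ≤ 1 := by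
    rw [div_le_one Real.pi_pos]; linarith [Real.pi_gt_three]
  have hpi0 : 0 < 2 / Real.pi := by positivity
  have hlog : ∀ t : ℝ, 0 < t → t ≤ 1 →
      |Real.log (t / 2) + Real.eulerMascheroniConstant| ≤ (2 + G) * (√t)⁻¹ := by
    intro t ht h
    rw [Real.log_div ht.ne' two_ne_zero]
    have h5 := abs_add_le (Real.log t - Real.log 2) Real.eulerMascheroniConstant
    have h6 := abs_sub (Real.log t) (Real.log 2)
    have h7 := abs_log_le_inv_sqrt ht h
    have h8 := one_le_inv_sqrt ht h
    have : G ≤ G * (√t)⁻¹ := le_mul_of_one_le_right hG0 h8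
    linarith
  refine ⟨M3 + ((2 + G) * MJ + M2) + (MJ + (2 + G) * MJ' + M4), by positivity, fun t ht => ?_⟩
  have hs : 0 < (√t)⁻¹ := by positivity
  have ht' : 0 < t⁻¹ := by positivity
  rcases le_total t 1 with h | h
  · have h8 := one_le_inv_sqrt ht h
    have h9 : (√t)⁻¹ ≤ t⁻¹ := by
      gcongr
      exact Real.le_sqrt_of_sq_le (by nlinarith)
    have hl := hlog t ht h
    have hj := hMJ t ht.le h
    have hj' := hMJ' t ht.le h
    have hy := hM2 t ht.le h
    have hy' := hM4 t ht.le h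
    constructor
    · rw [besselY0_eq, abs_mul, abs_of_pos hpi0]
      have : |(Real.log (t / 2) + Real.eulerMascheroniConstant) * besselJ0 t
          - powerSum y0Coeff (t ^ 2 / 4)| ≤ (2 + G) * (√t)⁻¹ * MJ + M2 := by
        refine (abs_sub _ _).trans ?_
        rw [abs_mul]
        gcongr
      have h10 : M2 ≤ M2 * (√t)⁻¹ := le_mul_of_one_le_right h2 h8
      have h11 := mul_le_of_le_one_left (abs_nonneg ((Real.log (t / 2) + Real.eulerMascheroniConstant) * besselJ0 t
          - powerSum y0Coeff (t ^ 2 / 4))) hpi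
      have h12 : 0 ≤ (M3 + (MJ + (2 + G) * MJ' + M4)) * (√t)⁻¹ := by positivity
      nlinarith
    · rw [besselY0', abs_mul, abs_of_pos hpi0]
      set A := besselJ0 t / t + (Real.log (t / 2) + Real.eulerMascheroniConstant) * besselJ0' t
        - powerSum (shiftCoeff y0Coeff) (t ^ 2 / 4) * (t / 2) with hA
      have ht2 : |t / 2| ≤ 1 := by rw [abs_of_pos (by positivity)]; linarith
      have : |A| ≤ MJ * t⁻¹ + (2 + G) * (√t)⁻¹ * (MJ' * 1) + M4 * 1 := by
        refine (abs_sub _ _).trans (add_le_add ((abs_add_le _ _).trans (add_le_add ?_ ?_)) ?_)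
        · rw [abs_div, abs_of_pos ht, div_eq_mul_inv]; gcongr
        · rw [abs_mul, besselJ0', abs_mul]; gcongr
        · rw [abs_mul]; gcongr
      have h10 : M4 ≤ M4 * t⁻¹ := le_mul_of_one_le_right h4 (h8.trans h9)
      have h11 := mul_le_of_le_one_left (abs_nonneg A) hpi
      have h12 : 0 ≤ (M3 + ((2 + G) * MJ + M2)) * ((√t)⁻¹ + t⁻¹) := by positivity
      have h13 : 0 ≤ (MJ + M4) * (√t)⁻¹ + (2 + G) * MJ' * t⁻¹ := by positivity
      nlinarith
  · have := hM3 t h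
    have h12 : 0 ≤ (((2 + G) * MJ + M2) + (MJ + (2 + G) * MJ' + M4)) * (√t)⁻¹ := by positivity
    have h13 : 0 ≤ (M3 + ((2 + G) * MJ + M2) + (MJ + (2 + G) * MJ' + M4)) * t⁻¹ := by positivity
    constructor <;> nlinarith [this.1, this.2]

/-! ### Splitting solutions of the Bessel equation into two phases -/

/-- Three Euler derivatives `b (k + 1) = t (b k)'` of an amplitude `b 0` with symbol-type bounds. -/
structure IsSymbol (b : ℕ → ℝ → ℂ) (M κ : ℝ) : Prop where
  hasDerivAt : ∀ k, k < 3 → ∀ t, 0 < t → HasDerivAt (b k) (b (k + 1) t / t) t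
  bound : ∀ k, k < 3 → ∀ t, 0 < t → ‖b k t‖ ≤ M * (√t)⁻¹
  -- This is the gain near the origin: a regular amplitude has Euler derivatives `O(√t)` (`κ = 0`),
  -- while a logarithmic one leaves a constant (`κ = 1`).
  bound_succ : ∀ k, k < 3 → ∀ t, 0 < t → ‖b (k + 1) t‖ ≤ M * (√t + κ)

theorem IsSymbol.mono {b : ℕ → ℝ → ℂ} {M M' κ : ℝ} (hb : IsSymbol b M κ) (hM : M ≤ M')
    (hκ : 0 ≤ κ) : IsSymbol b M' κ where
  hasDerivAt := hb.hasDerivAt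
  bound k hk t ht := (hb.bound k hk t ht).trans (by gcongr)
  bound_succ k hk t ht := (hb.bound_succ k hk t ht).trans (by gcongr)

/-! ### Algebra of the phase amplitudes -/

/-- `1 / (1 + t²)`. -/
noncomputable def invOneSq (t : ℝ) : ℝ := 1 / (1 + t ^ 2)

/-- `t / (1 + t²)`. -/
noncomputable def mulInvOneSq (t : ℝ) : ℝ := t / (1 + t ^ 2)

/-- The functions `e = 1/(1+t²)` and `r = t/(1+t²)` have derivatives polynomial in `e` and `r`, so
the amplitude coefficients and their derivatives stay polynomials on the unit bidisc. -/
theorem hasDerivAt_invOneSq (t : ℝ) :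
    HasDerivAt invOneSq (-2 * invOneSq t * mulInvOneSq t) t := by
  have hD : (1 + t ^ 2) ≠ 0 := by positivity
  refine ((hasDerivAt_const t (1 : ℝ)).div ((hasDerivAt_pow 2 t).const_add 1) hD).congr_deriv ?_
  rw [invOneSq, mulInvOneSq]; push_cast; field_simp; ring

theorem hasDerivAt_mulInvOneSq (t : ℝ) :
    HasDerivAt mulInvOneSq (invOneSq t * (2 * invOneSq t - 1)) t := by
  have hD : (1 + t ^ 2) ≠ 0 := by positivity
  refine ((hasDerivAt_id t).div ((hasDerivAt_pow 2 t).const_add 1) hD).congr_deriv ?_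
  simp only [id]
  rw [invOneSq]; push_cast; field_simp; ring

theorem invOneSq_mem (t : ℝ) : 0 ≤ invOneSq t ∧ invOneSq t ≤ 1 :=
  ⟨by rw [invOneSq]; positivity, by
    rw [invOneSq, div_le_one (by positivity)]; nlinarith [sq_nonneg t]⟩

theorem mulInvOneSq_mem {t : ℝ} (ht : 0 < t) : 0 ≤ mulInvOneSq t ∧ mulInvOneSq t ≤ 1 :=
  ⟨by rw [mulInvOneSq]; positivity, by
    rw [mulInvOneSq, div_le_one (by positivity)]; nlinarith [sq_nonneg (t - 1)]⟩

theorem mulInvOneSq_eq (t : ℝ) : mulInvOneSq t = t * invOneSq t := by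
  rw [mulInvOneSq, invOneSq]; ring

theorem mul_mulInvOneSq (t : ℝ) : t * mulInvOneSq t = 1 - invOneSq t := by
  have hD : (1 + t ^ 2) ≠ 0 := by positivity
  rw [mulInvOneSq, invOneSq]; field_simp; ring

/-- Coefficients of `h` in the Euler derivatives of the amplitude with phase `j = ± i`,
in terms of `e = 1 / (1 + t²)` and `r = t / (1 + t²)`. -/
noncomputable def ampA (j e r : ℂ) : ℕ → ℂ
  | 0 => 1 - j * r / 2
  | 1 => -j * r * (e + 1 / 2) - (1 - e) / 2
  | _ + 2 => -(1 - e) * (2 * e + 3 / 2)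
      + j * r * (2 * (1 - e) - (2 * e - 1) * (e + 1 / 2) + 2 * e * (1 - e))

/-- Coefficients of `t h'` in the Euler derivatives of the amplitude with phase `j = ± i`. -/
noncomputable def ampC (j e r : ℂ) : ℕ → ℂ
  | 0 => -j * r
  | 1 => e - j * r * (2 * e - 1 / 2)
  | _ + 2 => -4 * e * (1 - e)
      + j * r * (-(2 * e - 1) * (2 * e - 1 / 2) + 4 * e * (1 - e) - 1 - (e + 1 / 2))

/-- The derivative in `t` of `ampA`. -/
noncomputable def ampA' (j e r : ℂ) : ℕ → ℂ
  | 0 => -j * (e * (2 * e - 1)) / 2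
  | 1 => -j * (e * (2 * e - 1)) * (e + 1 / 2) + -j * r * (-2 * e * r) - e * r
  | _ + 2 => (-2 * e * r) * (2 * e + 3 / 2) + -(1 - e) * (-4 * e * r)
      + j * (e * (2 * e - 1)) * (2 * (1 - e) - (2 * e - 1) * (e + 1 / 2) + 2 * e * (1 - e))
      + j * r * ((-2 * e * r) * (-8 * e))

/-- The derivative in `t` of `ampC`. -/
noncomputable def ampC' (j e r : ℂ) : ℕ → ℂ
  | 0 => -j * (e * (2 * e - 1))
  | 1 => -2 * e * r - j * (e * (2 * e - 1)) * (2 * e - 1 / 2) - j * r * (2 * (-2 * e * r))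
  | _ + 2 => -4 * (-2 * e * r) * (1 - 2 * e)
      + j * (e * (2 * e - 1)) * (-(2 * e - 1) * (2 * e - 1 / 2) + 4 * e * (1 - e) - 1 - (e + 1 / 2))
      + j * r * ((-2 * e * r) * (6 - 16 * e))

theorem hasDerivAt_ampA {E R : ℝ → ℂ} {t : ℝ} (hE : HasDerivAt E (-2 * E t * R t) t)
    (hR : HasDerivAt R (E t * (2 * E t - 1)) t) (j : ℂ) (k : ℕ) :
    HasDerivAt (fun t => ampA j (E t) (R t) k) (ampA' j (E t) (R t) k) t := by
  match k with
  | 0 => exact (((hR.const_mul j).div_const 2).const_sub 1).congr_deriv (by rw [ampA']; ring)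
  | 1 =>
    exact (((hR.const_mul (-j)).mul (hE.add_const (1 / 2))).sub ((hE.const_sub 1).div_const 2)).congr_deriv
      (by rw [ampA']; ring)
  | (k + 2) =>
    have h := (((hE.const_sub 1).neg.mul ((hE.const_mul 2).add_const (3 / 2)))).add
      ((hR.const_mul j).mul ((((hE.const_sub 1).const_mul 2).sub
        (((hE.const_mul 2).sub_const 1).mul (hE.add_const (1 / 2)))).add
        ((hE.const_mul 2).mul (hE.const_sub 1))))
    exact h.congr_deriv (by rw [ampA']; simp only [Pi.neg_apply, Pi.mul_apply, Pi.sub_apply, Pi.add_apply]; ring)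

theorem hasDerivAt_ampC {E R : ℝ → ℂ} {t : ℝ} (hE : HasDerivAt E (-2 * E t * R t) t)
    (hR : HasDerivAt R (E t * (2 * E t - 1)) t) (j : ℂ) (k : ℕ) :
    HasDerivAt (fun t => ampC j (E t) (R t) k) (ampC' j (E t) (R t) k) t := by
  match k with
  | 0 => exact (hR.const_mul (-j)).congr_deriv (by rw [ampC'])
  | 1 =>
    exact (hE.sub ((hR.const_mul j).mul ((hE.const_mul 2).sub_const (1 / 2)))).congr_deriv
      (by rw [ampC']; ring)
  | (k + 2) =>
    have h := ((hE.const_mul (-4)).mul (hE.const_sub 1)).add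
      ((hR.const_mul j).mul ((((((hE.const_mul 2).sub_const 1).neg.mul
        ((hE.const_mul 2).sub_const (1 / 2))).add ((hE.const_mul 4).mul (hE.const_sub 1))).sub_const 1).sub
        (hE.add_const (1 / 2))))
    exact h.congr_deriv (by rw [ampC']; simp only [Pi.neg_apply, Pi.mul_apply, Pi.sub_apply, Pi.add_apply]; ring)

/-- This and `ampC_succ` express `t d/dt` applied to `e^{-jt}(A h + C t h')`, where `(t h')' = -t h`
by Bessel's equation. The initial pair is chosen as `h - j(1-e)(h' + h/(2t))`, a regularised form of
`(g - j g')/√t` for `g = √t h`; hence the terms growing with `t` cancel through `t r = 1 - e` and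
`j² = -1`. -/
theorem ampA_succ {j e r t : ℂ} (hj : j ^ 2 = -1) (he : e * (1 + t ^ 2) = 1) (hr : r = t * e)
    {k : ℕ} (hk : k < 2) :
    t * ampA' j e r k - j * t * ampA j e r k - t ^ 2 * ampC j e r k = ampA j e r (k + 1) := by
  have hD : 1 + t ^ 2 ≠ 0 := fun h => by rw [h, mul_zero] at he; exact zero_ne_one he
  obtain rfl : e = 1 / (1 + t ^ 2) := by rw [eq_div_iff hD]; exact he
  subst hr
  match k with
  | 0 =>
    simp only [ampA, ampA', ampC]
    linear_combination (norm := skip) (t * (t * (1 / (1 + t ^ 2))) / 2) * hj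
    field_simp
    ring
  | 1 =>
    simp only [ampA, ampA', ampC]
    linear_combination (norm := skip) (t * (t * (1 / (1 + t ^ 2))) * (1 / (1 + t ^ 2) + 1 / 2)) * hj
    field_simp
    ring
  | (k + 2) => omega

theorem ampC_succ {j e r t : ℂ} (hj : j ^ 2 = -1) (he : e * (1 + t ^ 2) = 1) (hr : r = t * e)
    {k : ℕ} (hk : k < 2) :
    t * ampC' j e r k - j * t * ampC j e r k + ampA j e r k = ampC j e r (k + 1) := by
  have hD : 1 + t ^ 2 ≠ 0 := fun h => by rw [h, mul_zero] at he; exact zero_ne_one he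
  obtain rfl : e = 1 / (1 + t ^ 2) := by rw [eq_div_iff hD]; exact he
  subst hr
  match k with
  | 0 =>
    simp only [ampA, ampC, ampC']
    linear_combination (norm := skip) (t * (t * (1 / (1 + t ^ 2)))) * hj
    field_simp
    ring
  | 1 =>
    simp only [ampA, ampC, ampC']
    linear_combination (norm := skip) (t * (t * (1 / (1 + t ^ 2))) * (2 * (1 / (1 + t ^ 2)) - 1 / 2)) * hj
    field_simp
    ring
  | (k + 2) => omega

theorem exists_bound_closedBall {F : ℂ × ℂ → ℂ} (hF : Continuous F) :
    ∃ K : ℝ, 0 ≤ K ∧ ∀ e r : ℂ, ‖e‖ ≤ 1 → ‖r‖ ≤ 1 → ‖F (e, r)‖ ≤ K := by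
  obtain ⟨K, hK⟩ := (isCompact_closedBall (0 : ℂ × ℂ) 1).exists_bound_of_continuousOn hF.continuousOn
  refine ⟨K, (norm_nonneg _).trans (hK 0 (by simp)), fun e r he hr => hK _ ?_⟩
  rw [mem_closedBall_zero_iff, Prod.norm_def]
  exact max_le he hr

/-- The relations between `e = 1 / (1 + t²)`, `r = t / (1 + t²)` and `t > 0`. -/
structure AmpVars (t : ℝ) (e r : ℂ) : Prop where
  norm_e : ‖e‖ ≤ 1
  norm_r : ‖r‖ ≤ 1
  norm_r_le : ‖r‖ ≤ t
  norm_sub : ‖1 - e‖ ≤ t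
  tr : (t : ℂ) * r = 1 - e
  te : r = t * e

theorem ampVars {t : ℝ} (ht : 0 < t) : AmpVars t (invOneSq t) (mulInvOneSq t) := by
  obtain ⟨h1, h2⟩ := invOneSq_mem t
  obtain ⟨h3, h4⟩ := mulInvOneSq_mem ht
  have h5 := mulInvOneSq_eq t
  have h6 := mul_mulInvOneSq t
  have e1 : (1 : ℂ) - invOneSq t = ((1 - invOneSq t : ℝ) : ℂ) := by push_cast; ring
  refine ⟨?_, ?_, ?_, ?_, ?_, ?_⟩
  · rw [Complex.norm_real, Real.norm_of_nonneg h1]; exact h2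
  · rw [Complex.norm_real, Real.norm_of_nonneg h3]; exact h4
  · rw [Complex.norm_real, Real.norm_of_nonneg h3, h5]; nlinarith
  · rw [e1, Complex.norm_real, Real.norm_of_nonneg (by linarith), ← h6]; nlinarith
  · rw [e1, ← h6]; push_cast; ring
  · rw [h5]; push_cast; ring

/-- The amplitude coefficients, extended by one more Euler derivative. -/
noncomputable def ampAx (j : ℂ) (t : ℝ) (e r : ℂ) (k : ℕ) : ℂ :=
  -- The second branch serves `k = 3`: of the third Euler derivative only the size matters, so the
  -- cancellation is not carried out.
  if k < 3 then ampA j e r k else t * ampA' j e r 2 - j * t * ampA j e r 2 - t ^ 2 * ampC j e r 2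

/-- The amplitude coefficients, extended by one more Euler derivative. -/
noncomputable def ampCx (j : ℂ) (t : ℝ) (e r : ℂ) (k : ℕ) : ℂ :=
  if k < 3 then ampC j e r k else t * ampC' j e r 2 - j * t * ampC j e r 2 + ampA j e r 2

/-- Polynomials are bounded on the unit bidisc. For indices 1 and 2 every term contains `r` or `1 -
e`, both at most `t`; for index 3 a factor `t` comes out explicitly. The factor `t` later turns
`t^(-1/2)` into `√t`. -/
theorem ampA_bounds (j : ℂ) : ∃ K : ℝ, 0 ≤ K ∧ ∀ (t : ℝ) (e r : ℂ), 0 < t → AmpVars t e r →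
    (∀ k, k < 3 → ‖ampA j e r k‖ ≤ K) ∧ (∀ k, k < 3 → ‖ampAx j t e r (k + 1)‖ ≤ K * t) := by
  have hc : ∀ k, Continuous fun p : ℂ × ℂ => ampA j p.1 p.2 k := by
    intro k
    match k with
    | 0 => simp only [ampA]; fun_prop
    | 1 => simp only [ampA]; fun_prop
    | (k + 2) => simp only [ampA]; fun_prop
  have hc' : ∀ k, Continuous fun p : ℂ × ℂ => ampA' j p.1 p.2 k := by
    intro k
    match k with
    | 0 => simp only [ampA']; fun_prop
    | 1 => simp only [ampA']; fun_prop
    | (k + 2) => simp only [ampA']; fun_prop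
  obtain ⟨K0, k0, hK0⟩ := exists_bound_closedBall (hc 0)
  obtain ⟨K1, k1, hK1⟩ := exists_bound_closedBall (hc 1)
  obtain ⟨K2, k2, hK2⟩ := exists_bound_closedBall (hc 2)
  obtain ⟨K3, k3, hK3⟩ := exists_bound_closedBall (hc' 2)
  obtain ⟨K4, k4, hK4⟩ := exists_bound_closedBall (F := fun p => -j * (p.1 + 1 / 2)) (by fun_prop)
  obtain ⟨K5, k5, hK5⟩ := exists_bound_closedBall (F := fun p => 2 * p.1 + 3 / 2) (by fun_prop)
  obtain ⟨K6, k6, hK6⟩ := exists_bound_closedBall (F := fun p => j *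
    (2 * (1 - p.1) - (2 * p.1 - 1) * (p.1 + 1 / 2) + 2 * p.1 * (1 - p.1))) (by fun_prop)
  obtain ⟨K7, k7, hK7⟩ := exists_bound_closedBall (F := fun p => -4 * p.2 * (1 - p.1)
      + j * (1 - p.1) * (-(2 * p.1 - 1) * (2 * p.1 - 1 / 2) + 4 * p.1 * (1 - p.1) - 1 - (p.1 + 1 / 2)))
      (by fun_prop)
  refine ⟨K0 + K1 + K2 + (K4 + 1) + (K5 + K6) + (K3 + ‖j‖ * K2 + K7), by positivity,
    fun t e r ht hv => ⟨fun k hk => ?_, fun k hk => ?_⟩⟩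
  · have := norm_nonneg j
    have hp : 0 ≤ ‖j‖ * K2 := by positivity
    interval_cases k
    · have := hK0 e r hv.norm_e hv.norm_r; linarith
    · have := hK1 e r hv.norm_e hv.norm_r; linarith
    · have := hK2 e r hv.norm_e hv.norm_r; linarith
  · have hp : 0 ≤ ‖j‖ * K2 := by positivity
    interval_cases k
    · have h1 : ‖ampAx j t e r 1‖ ≤ K4 * t + 1 * t := by
        rw [ampAx, if_pos (by norm_num), ampA]
        refine (norm_sub_le _ _).trans (add_le_add ?_ ?_)
        · rw [show -j * r * (e + 1 / 2) = (-j * (e + 1 / 2)) * r by ring, norm_mul]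
          exact mul_le_mul (hK4 e r hv.norm_e hv.norm_r) hv.norm_r_le (norm_nonneg _) k4
        · rw [norm_div]
          have := hv.norm_sub
          simp only [Complex.norm_ofNat]
          linarith
      refine h1.trans ?_
      rw [← add_mul]
      exact mul_le_mul_of_nonneg_right (by linarith) ht.le
    · have h1 : ‖ampAx j t e r 2‖ ≤ t * K5 + K6 * t := by
        rw [ampAx, if_pos (by norm_num), ampA]
        refine (norm_add_le _ _).trans (add_le_add ?_ ?_)
        · rw [norm_mul, norm_neg]
          exact mul_le_mul hv.norm_sub (hK5 e r hv.norm_e hv.norm_r) (norm_nonneg _) ht.le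
        · rw [show ∀ x, j * r * x = (j * x) * r from fun x => by ring, norm_mul]
          exact mul_le_mul (hK6 e r hv.norm_e hv.norm_r) hv.norm_r_le (norm_nonneg _) k6
      refine h1.trans ?_
      rw [mul_comm t, ← add_mul]
      exact mul_le_mul_of_nonneg_right (by linarith) ht.le
    · have h1 : ‖ampAx j t e r 3‖ ≤ t * K3 + ‖j‖ * t * K2 + t * K7 := by
        rw [ampAx, if_neg (by norm_num)]
        have hnt : ‖(t : ℂ)‖ = t := by rw [Complex.norm_real, Real.norm_of_nonneg ht.le]
        refine (norm_sub_le _ _).trans (add_le_add ((norm_sub_le _ _).trans (add_le_add ?_ ?_)) ?_)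
        · rw [norm_mul, hnt]; gcongr; exact hK3 e r hv.norm_e hv.norm_r
        · rw [norm_mul, norm_mul, hnt]; gcongr; exact hK2 e r hv.norm_e hv.norm_r
        -- One of the two factors `t` is absorbed by `t e = r` and `t r = 1 - e`.
        · have : (t : ℂ) ^ 2 * ampC j e r 2 = t * (-4 * r * (1 - e)
            + j * (1 - e) * (-(2 * e - 1) * (2 * e - 1 / 2) + 4 * e * (1 - e) - 1 - (e + 1 / 2))) := by
            rw [ampC]
            linear_combination (-4 * (t : ℂ) * (1 - e)) * -hv.te + (t : ℂ) * j *
              (-(2 * e - 1) * (2 * e - 1 / 2) + 4 * e * (1 - e) - 1 - (e + 1 / 2)) * hv.tr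
          rw [this, norm_mul, hnt]; gcongr; exact hK7 e r hv.norm_e hv.norm_r
      refine h1.trans ?_
      rw [show t * K3 + ‖j‖ * t * K2 + t * K7 = (K3 + ‖j‖ * K2 + K7) * t by ring]
      exact mul_le_mul_of_nonneg_right (by linarith) ht.le

/-- Every term of the coefficients with index below 3 contains `r` or `e`, which decay at infinity.
This compensates the growth `√t` of `t h'`. -/
theorem ampC_bounds (j : ℂ) : ∃ K : ℝ, 0 ≤ K ∧ ∀ (t : ℝ) (e r : ℂ), 0 < t → AmpVars t e r →
    (∀ k, k < 3 → ‖ampC j e r k‖ ≤ K * (‖r‖ + ‖e‖)) ∧ (∀ k, k < 3 → ‖ampCx j t e r (k + 1)‖ ≤ K) := by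
  have hc : ∀ k, Continuous fun p : ℂ × ℂ => ampC j p.1 p.2 k := by
    intro k
    match k with
    | 0 => simp only [ampC]; fun_prop
    | 1 => simp only [ampC]; fun_prop
    | (k + 2) => simp only [ampC]; fun_prop
  obtain ⟨K1, k1, hK1⟩ := exists_bound_closedBall (hc 1)
  obtain ⟨K2, k2, hK2⟩ := exists_bound_closedBall (hc 2)
  obtain ⟨K3, k3, hK3⟩ := exists_bound_closedBall (F := fun p => j * (2 * p.1 - 1 / 2)) (by fun_prop)
  obtain ⟨K4, k4, hK4⟩ := exists_bound_closedBall (F := fun p => -4 * (1 - p.1)) (by fun_prop)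
  obtain ⟨K5, k5, hK5⟩ := exists_bound_closedBall (F := fun p => j * (-(2 * p.1 - 1) * (2 * p.1 - 1 / 2)
    + 4 * p.1 * (1 - p.1) - 1 - (p.1 + 1 / 2))) (by fun_prop)
  -- This polynomial is `t C' - j t C + A` at index 2, with each `t` removed through `t r = 1 - e`
  -- and `t e = r`.
  obtain ⟨K6, k6, hK6⟩ := exists_bound_closedBall (F := fun p => -4 * (-2 * p.1 * (1 - p.1)) * (1 - 2 * p.1)
      + j * (p.2 * (2 * p.1 - 1)) * (-(2 * p.1 - 1) * (2 * p.1 - 1 / 2) + 4 * p.1 * (1 - p.1) - 1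
        - (p.1 + 1 / 2)) + j * (1 - p.1) * ((-2 * p.1 * p.2) * (6 - 16 * p.1))
      - j * (-4 * p.2 * (1 - p.1) + j * (1 - p.1) * (-(2 * p.1 - 1) * (2 * p.1 - 1 / 2)
        + 4 * p.1 * (1 - p.1) - 1 - (p.1 + 1 / 2))) + ampA j p.1 p.2 2) (by simp only [ampA]; fun_prop)
  refine ⟨‖j‖ + (1 + K3) + (K4 + K5) + K1 + K2 + K6, by positivity,
    fun t e r ht hv => ⟨fun k hk => ?_, fun k hk => ?_⟩⟩
  · have hj := norm_nonneg j
    have hr := norm_nonneg r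
    have he := norm_nonneg e
    have hmono : ∀ A : ℝ, A ≤ ‖j‖ + (1 + K3) + (K4 + K5) + K1 + K2 + K6 →
        A * (‖r‖ + ‖e‖) ≤ (‖j‖ + (1 + K3) + (K4 + K5) + K1 + K2 + K6) * (‖r‖ + ‖e‖) :=
      fun A hA => mul_le_mul_of_nonneg_right hA (by positivity)
    interval_cases k
    · refine le_trans ?_ (hmono ‖j‖ (by linarith))
      rw [ampC, norm_mul, norm_neg]
      gcongr
      linarith
    · refine le_trans ?_ (hmono (1 + K3) (by linarith))
      have : ‖ampC j e r 1‖ ≤ ‖e‖ + K3 * ‖r‖ := by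
        rw [ampC, show j * r * (2 * e - 1 / 2) = (j * (2 * e - 1 / 2)) * r by ring]
        refine (norm_sub_le _ _).trans (add_le_add le_rfl ?_)
        rw [norm_mul]
        exact mul_le_mul_of_nonneg_right (hK3 e r hv.norm_e hv.norm_r) hr
      nlinarith [mul_nonneg k3 he]
    · refine le_trans ?_ (hmono (K4 + K5) (by linarith))
      have : ‖ampC j e r 2‖ ≤ K4 * ‖e‖ + K5 * ‖r‖ := by
        rw [ampC, show -4 * e * (1 - e) = (-4 * (1 - e)) * e by ring,
          show ∀ x, j * r * x = (j * x) * r from fun x => by ring]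
        refine (norm_add_le _ _).trans (add_le_add ?_ ?_)
        · rw [norm_mul]
          exact mul_le_mul_of_nonneg_right (hK4 e r hv.norm_e hv.norm_r) he
        · rw [norm_mul]
          exact mul_le_mul_of_nonneg_right (hK5 e r hv.norm_e hv.norm_r) hr
      nlinarith [mul_nonneg k4 hr, mul_nonneg k5 he]
  · have hj := norm_nonneg j
    interval_cases k
    · have := hK1 e r hv.norm_e hv.norm_r
      rw [ampCx, if_pos (by norm_num)]; linarith
    · have := hK2 e r hv.norm_e hv.norm_r
      rw [ampCx, if_pos (by norm_num)]; linarith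
    · have h := hK6 e r hv.norm_e hv.norm_r
      rw [ampCx, if_neg (by norm_num)]
      refine le_trans (le_of_eq ?_) (h.trans (by linarith))
      congr 1
      rw [ampC', ampC]
      have h1 := hv.tr
      have h2 := hv.te
      linear_combination (-4 * (-2 * e) * (1 - 2 * e) + j * (-2 * e * r) * (6 - 16 * e)
        - j * j * (-(2 * e - 1) * (2 * e - 1 / 2) + 4 * e * (1 - e) - 1 - (e + 1 / 2))) * h1
        - (j * (2 * e - 1) * (-(2 * e - 1) * (2 * e - 1 / 2) + 4 * e * (1 - e) - 1 - (e + 1 / 2))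
          + 4 * j * (1 - e)) * h2

/-- The Euler derivatives of the amplitude with phase `j = ± i` of the solution `h`. -/
noncomputable def amplitude (j : ℂ) (h h' : ℝ → ℂ) (k : ℕ) (t : ℝ) : ℂ :=
  1 / 2 * Complex.exp (-j * t) * (ampAx j t (invOneSq t) (mulInvOneSq t) k * h t
    + ampCx j t (invOneSq t) (mulInvOneSq t) k * (t * h' t))

theorem hasDerivAt_amplitude {j : ℂ} (hj : j ^ 2 = -1) {h h' : ℝ → ℂ} {t : ℝ} (ht : 0 < t)
    (hh : HasDerivAt h (h' t) t) (hh' : HasDerivAt h' (-h t - h' t / t) t) {k : ℕ} (hk : k < 3) :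
    HasDerivAt (amplitude j h h' k) (amplitude j h h' (k + 1) t / t) t := by
  have hE : HasDerivAt (fun t => (invOneSq t : ℂ))
      (-2 * (invOneSq t : ℂ) * (mulInvOneSq t : ℂ)) t := by
    have := (hasDerivAt_invOneSq t).ofReal_comp
    push_cast at this; exact this
  have hR : HasDerivAt (fun t => (mulInvOneSq t : ℂ))
      ((invOneSq t : ℂ) * (2 * (invOneSq t : ℂ) - 1)) t := by
    have := (hasDerivAt_mulInvOneSq t).ofReal_comp
    push_cast at this; exact this
  have hv := ampVars ht
  have htc : (t : ℂ) ≠ 0 := by exact_mod_cast ht.ne'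
  have hid : HasDerivAt (fun t : ℝ => (t : ℂ)) 1 t := (hasDerivAt_id t).ofReal_comp
  have hp : HasDerivAt (fun t : ℝ => (t : ℂ) * h' t) (-t * h t) t := by
    refine (hid.mul hh').congr_deriv ?_
    field_simp
    ring
  have hexp : HasDerivAt (fun t : ℝ => 1 / 2 * Complex.exp (-j * t))
      (1 / 2 * (Complex.exp (-j * t) * (-j * 1))) t := ((hid.const_mul (-j)).cexp).const_mul _
  have hA' := hasDerivAt_ampA (E := fun t => (invOneSq t : ℂ)) (R := fun t => (mulInvOneSq t : ℂ)) hE hR j k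
  have hC' := hasDerivAt_ampC (E := fun t => (invOneSq t : ℂ)) (R := fun t => (mulInvOneSq t : ℂ)) hE hR j k
  have hmain := hexp.mul ((hA'.mul hh).add (hC'.mul hp))
  have heq : amplitude j h h' k = fun t : ℝ => 1 / 2 * Complex.exp (-j * t) *
      (ampA j (invOneSq t) (mulInvOneSq t) k * h t + ampC j (invOneSq t) (mulInvOneSq t) k * (t * h' t)) := by
    funext s
    rw [amplitude, ampAx, ampCx, if_pos hk, if_pos hk]
  rw [heq]
  refine hmain.congr_deriv ?_
  set e : ℂ := (invOneSq t : ℂ)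
  set r : ℂ := (mulInvOneSq t : ℂ)
  have he : e * (1 + (t : ℂ) ^ 2) = 1 := by
    linear_combination hv.tr - (t : ℂ) * hv.te
  have hA : ampAx j t e r (k + 1) = t * ampA' j e r k - j * t * ampA j e r k - t ^ 2 * ampC j e r k := by
    rw [ampAx]
    split_ifs with hk2
    · exact (ampA_succ hj he hv.te (by omega)).symm
    · obtain rfl : k = 2 := by omega
      rfl
  have hC : ampCx j t e r (k + 1) = t * ampC' j e r k - j * t * ampC j e r k + ampA j e r k := by
    rw [ampCx]
    split_ifs with hk2
    · exact (ampC_succ hj he hv.te (by omega)).symm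
    · obtain rfl : k = 2 := by omega
      rfl
  rw [amplitude, hA, hC]
  simp only [Pi.mul_apply, Pi.add_apply]
  field_simp
  ring

/-- The exponential is unimodular because `j = ±i`. The first bound uses `h = O(t^(-1/2))`, `t h' =
O(√t + κ)` and the decay `(t+1)/(1+t²)` of the coefficients of `t h'`; the second uses that the
coefficients of `h` are `O(t)` from index 1 on. -/
theorem isSymbol_amplitude {j : ℂ} (hj : j ^ 2 = -1) {h h' : ℝ → ℂ}
    (hh : ∀ t, 0 < t → HasDerivAt h (h' t) t)
    (hh' : ∀ t, 0 < t → HasDerivAt h' (-h t - h' t / t) t) {M κ : ℝ} (hM : 0 ≤ M) (hκ0 : 0 ≤ κ)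
    (hκ1 : κ ≤ 1) (hb : ∀ t, 0 < t → ‖h t‖ ≤ M * (√t)⁻¹)
    (hb' : ∀ t, 0 < t → ‖h' t‖ ≤ M * ((√t)⁻¹ + κ * t⁻¹)) :
    ∃ M', 0 ≤ M' ∧ IsSymbol (amplitude j h h') M' κ := by
  obtain ⟨K1, k1, hK1⟩ := ampA_bounds j
  obtain ⟨K2, k2, hK2⟩ := ampC_bounds j
  have hnj : j = Complex.I ∨ j = -Complex.I := by
    have : (j - Complex.I) * (j + Complex.I) = 0 := by
      linear_combination hj - Complex.I_sq
    rcases mul_eq_zero.1 this with h | h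
    · exact Or.inl (sub_eq_zero.1 h)
    · exact Or.inr (eq_neg_of_add_eq_zero_left h)
  have hexp : ∀ t : ℝ, ‖Complex.exp (-j * t)‖ = 1 := by
    intro t
    rw [Complex.norm_exp]
    rcases hnj with rfl | rfl <;> simp
  have hnorm : ∀ (k : ℕ) (t : ℝ), ‖amplitude j h h' k t‖ ≤
      ‖ampAx j t (invOneSq t) (mulInvOneSq t) k‖ * ‖h t‖
      + ‖ampCx j t (invOneSq t) (mulInvOneSq t) k‖ * ‖t * h' t‖ := by
    intro k t
    rw [amplitude, norm_mul, norm_mul, hexp, ← norm_mul, ← norm_mul]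
    have h1 : ‖(1 / 2 : ℂ)‖ * 1 ≤ 1 := by norm_num
    exact (mul_le_of_le_one_left (norm_nonneg _) h1).trans (norm_add_le _ _)
  have hsq : ∀ t : ℝ, 0 < t → t * (√t)⁻¹ = √t := fun t ht => by
    have : 0 < √t := Real.sqrt_pos.2 ht
    rw [← div_eq_mul_inv, div_eq_iff this.ne', Real.mul_self_sqrt ht.le]
  have hp : ∀ t : ℝ, 0 < t → ‖(t : ℂ) * h' t‖ ≤ M * (√t + κ) := by
    intro t ht
    rw [norm_mul, Complex.norm_real, Real.norm_of_nonneg ht.le]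
    calc t * ‖h' t‖ ≤ t * (M * ((√t)⁻¹ + κ * t⁻¹)) := by gcongr; exact hb' t ht
      _ = M * (t * (√t)⁻¹ + κ * (t * t⁻¹)) := by ring
      _ = M * (√t + κ) := by rw [hsq t ht, mul_inv_cancel₀ ht.ne', mul_one]
  refine ⟨K1 * M + K2 * (M * 4) + K2 * M, by positivity,
    fun k hk t ht => hasDerivAt_amplitude hj ht (hh t ht) (hh' t ht) hk, fun k hk t ht => ?_,
    fun k hk t ht => ?_⟩
  · have hv := ampVars ht
    have hs : 0 < √t := Real.sqrt_pos.2 ht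
    refine (hnorm k t).trans ?_
    rw [ampAx, ampCx, if_pos hk, if_pos hk]
    have h1 := (hK1 t _ _ ht hv).1 k hk
    have h2 := (hK2 t _ _ ht hv).1 k hk
    have h3 : ‖(mulInvOneSq t : ℂ)‖ + ‖(invOneSq t : ℂ)‖ = (t + 1) * invOneSq t := by
      rw [Complex.norm_real, Complex.norm_real, Real.norm_of_nonneg (mulInvOneSq_mem ht).1,
        Real.norm_of_nonneg (invOneSq_mem t).1, mulInvOneSq_eq]
      ring
    have h4 : (t + 1) * invOneSq t * (√t + κ) ≤ 4 * (√t)⁻¹ := by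
      have h5 : √t ^ 2 = t := Real.sq_sqrt ht.le
      rw [invOneSq, ← div_eq_mul_inv 4, le_div_iff₀ hs, mul_one_div, div_mul_eq_mul_div,
        div_mul_eq_mul_div, div_le_iff₀ (by positivity)]
      have h6 : (√t + κ) * √t ≤ 2 * (t + 1) := by nlinarith [sq_nonneg (√t - 1)]
      have h7 : (t + 1) * ((√t + κ) * √t) ≤ (t + 1) * (2 * (t + 1)) := by gcongr
      nlinarith [sq_nonneg (t - 1)]
    calc _ ≤ K1 * (M * (√t)⁻¹) + K2 * ((t + 1) * invOneSq t) * (M * (√t + κ)) := by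
          rw [← h3]
          gcongr
          · exact hb t ht
          · exact hp t ht
      _ = K1 * M * (√t)⁻¹ + K2 * M * ((t + 1) * invOneSq t * (√t + κ)) := by ring
      _ ≤ K1 * M * (√t)⁻¹ + K2 * M * (4 * (√t)⁻¹) := by gcongr
      _ ≤ _ := by
        have : 0 ≤ K2 * M * (√t)⁻¹ := by positivity
        linarith
  · have hv := ampVars ht
    have hs : 0 < √t := Real.sqrt_pos.2 ht
    refine (hnorm (k + 1) t).trans ?_
    have h1 := (hK1 t _ _ ht hv).2 k hk
    have h2 := (hK2 t _ _ ht hv).2 k hk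
    calc _ ≤ K1 * t * (M * (√t)⁻¹) + K2 * (M * (√t + κ)) := by
          gcongr
          · exact hb t ht
          · exact hp t ht
      _ = K1 * M * (t * (√t)⁻¹) + K2 * M * (√t + κ) := by ring
      _ = K1 * M * √t + K2 * M * (√t + κ) := by rw [hsq t ht]
      _ ≤ _ := by
        have : 0 ≤ K1 * M * κ + K2 * (M * 4) * (√t + κ) := by positivity
        linarith

/-- The terms of the two amplitudes that are odd in `j` cancel; the differential equation plays no
role. -/
theorem amplitude_sum (h h' : ℝ → ℂ) (t : ℝ) :
    h t = Complex.exp (Complex.I * t) * amplitude Complex.I h h' 0 t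
      + Complex.exp (-Complex.I * t) * amplitude (-Complex.I) h h' 0 t := by
  have h1 : Complex.exp (Complex.I * t) * Complex.exp (-Complex.I * t) = 1 := by
    rw [← Complex.exp_add]; simp
  simp only [amplitude, ampAx, ampCx, ampA, ampC, neg_neg]
  norm_num
  rw [neg_mul] at h1
  linear_combination (-(h t)) * h1

/-! ### Families of functions as families in `L²` -/

theorem toL2_eq {f : Plane → ℂ} (hf : MemLp f 2 (volume : Measure Plane)) : toL2 f = hf.toLp f := by
  rw [toL2, dif_pos hf]

theorem toL2_eq_zero {f : Plane → ℂ} (hf : ¬MemLp f 2 (volume : Measure Plane)) : toL2 f = 0 := by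
  rw [toL2, dif_neg hf]

theorem coeFn_toL2 {f : Plane → ℂ} (hf : MemLp f 2 (volume : Measure Plane)) :
    (toL2 f : Plane → ℂ) =ᵐ[volume] f := by
  rw [toL2_eq hf]; exact hf.coeFn_toLp

theorem toL2_add {f g : Plane → ℂ} (hf : MemLp f 2 (volume : Measure Plane))
    (hg : MemLp g 2 (volume : Measure Plane)) : toL2 (fun z => f z + g z) = toL2 f + toL2 g := by
  rw [toL2_eq hf, toL2_eq hg, ← MemLp.toLp_add]; exact toL2_eq (hf.add hg)

theorem toL2_sub {f g : Plane → ℂ} (hf : MemLp f 2 (volume : Measure Plane))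
    (hg : MemLp g 2 (volume : Measure Plane)) : toL2 (fun z => f z - g z) = toL2 f - toL2 g := by
  rw [toL2_eq hf, toL2_eq hg, ← MemLp.toLp_sub]; exact toL2_eq (hf.sub hg)

theorem toL2_const_mul {f : Plane → ℂ} (hf : MemLp f 2 (volume : Measure Plane)) (c : ℂ) :
    toL2 (fun z => c * f z) = c • toL2 f := by
  rw [toL2_eq hf, ← MemLp.toLp_const_smul]; exact toL2_eq (hf.const_smul c)

theorem toL2_congr {f g : Plane → ℂ} (h : f =ᵐ[volume] g) : toL2 f = toL2 g := by
  by_cases hf : MemLp f 2 (volume : Measure Plane)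
  · rw [toL2_eq hf, toL2_eq (hf.ae_eq h)]
    exact MemLp.toLp_congr _ _ h
  · rw [toL2_eq_zero hf, toL2_eq_zero fun hg => hf (hg.ae_eq h.symm)]

theorem norm_toL2 {f : Plane → ℂ} (hf : MemLp f 2 (volume : Measure Plane)) :
    ‖toL2 f‖ = (eLpNorm f 2 volume).toReal := by
  rw [toL2_eq hf, Lp.norm_toLp]

/-- No measurability of `f` is needed, since `toL2` is `0` outside `L²`. -/
theorem norm_toL2_le {f : Plane → ℂ} {g : Plane → ℝ} {c : ℝ} (hc : 0 ≤ c)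
    (hg : MemLp g 2 (volume : Measure Plane)) (h : ∀ᵐ z, ‖f z‖ ≤ c * ‖g z‖) :
    ‖toL2 f‖ ≤ c * (eLpNorm g 2 volume).toReal := by
  by_cases hf : MemLp f 2 (volume : Measure Plane)
  · rw [norm_toL2 hf]
    have h1 := eLpNorm_le_mul_eLpNorm_of_ae_le_mul h 2
    have h2 := ENNReal.toReal_mono (ENNReal.mul_ne_top ENNReal.ofReal_ne_top hg.eLpNorm_ne_top) h1
    rwa [ENNReal.toReal_mul, ENNReal.toReal_ofReal hc] at h2
  · rw [toL2_eq_zero hf, norm_zero]; positivity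

theorem norm_toL2_sq {f : Plane → ℂ} (hf : MemLp f 2 (volume : Measure Plane)) :
    ‖toL2 f‖ ^ 2 = ∫ z, ‖f z‖ ^ 2 := by
  rw [norm_toL2 hf, hf.eLpNorm_eq_integral_rpow_norm two_ne_zero ENNReal.ofNat_ne_top,
    ENNReal.toReal_ofReal (by positivity)]
  simp only [ENNReal.toReal_ofNat, Real.rpow_ofNat]
  rw [← one_div, ← Real.sqrt_eq_rpow, Real.sq_sqrt (by positivity)]

theorem eLpNorm_two_eq {E : Type*} [NormedAddCommGroup E] (f : Plane → E) :
    eLpNorm f 2 volume = (∫⁻ z, ‖f z‖ₑ ^ 2) ^ (1 / 2 : ℝ) := by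
  rw [eLpNorm_eq_lintegral_rpow_enorm_toReal (by norm_num) (by norm_num)]
  norm_num

/-- Distances to a fixed element are measurable by Tonelli's theorem, and in the separable space
`L²` every open set is a countable union of balls. -/
theorem stronglyMeasurable_toL2 {α : Type*} [MeasurableSpace α] {F : α → Plane → ℂ}
    (hF : Measurable (Function.uncurry F)) (hF2 : ∀ a, MemLp (F a) 2 (volume : Measure Plane)) :
    StronglyMeasurable fun a => toL2 (F a) := by
  have : Fact ((2 : ℝ≥0∞) ≠ ⊤) := ⟨ENNReal.ofNat_ne_top⟩
  borelize L2
  refine Measurable.stronglyMeasurable ?_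
  have hdist : ∀ g : L2, Measurable fun a => edist (toL2 (F a)) g := by
    intro g
    have h1 : ∀ a, edist (toL2 (F a)) g = (∫⁻ z, ‖F a z - g z‖ₑ ^ 2) ^ (1 / 2 : ℝ) := by
      intro a
      rw [Lp.edist_def, eLpNorm_two_eq]
      congr 1
      refine lintegral_congr_ae ?_
      filter_upwards [coeFn_toL2 (hF2 a)] with z hz
      simp [hz]
    simp only [h1]
    refine Measurable.pow_const ?_ _
    refine Measurable.lintegral_prod_right' (f := fun p : α × Plane => ‖F p.1 p.2 - g p.2‖ₑ ^ 2) ?_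
    exact ((hF.sub ((Lp.stronglyMeasurable g).measurable.comp measurable_snd)).enorm).pow_const 2
  refine measurable_of_isOpen fun U hU => ?_
  have hex : ∀ x : U, ∃ ε > 0, Metric.eball (x : L2) ε ⊆ U := fun x =>
    EMetric.isOpen_iff.1 hU x x.2
  choose ε hε hsub using hex
  obtain ⟨T, hT, hTU⟩ := TopologicalSpace.isOpen_iUnion_countable
    (fun x : U => Metric.eball (x : L2) (ε x)) (fun x => Metric.isOpen_eball)
  have hU' : U = ⋃ x ∈ T, Metric.eball (x : L2) (ε x) := by
    rw [hTU]
    refine Set.Subset.antisymm (fun x hx => Set.mem_iUnion.2 ⟨⟨x, hx⟩, Metric.mem_eball_self (hε _)⟩)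
      (Set.iUnion_subset hsub)
  rw [hU', Set.preimage_iUnion₂]
  refine MeasurableSet.biUnion hT fun x _ => ?_
  exact measurableSet_lt (hdist x) measurable_const

theorem tendsto_norm_toL2 {ι : Type*} {l : Filter ι} [l.IsCountablyGenerated] {q : ι → Plane → ℂ}
    {Φ : Plane → ℝ} (hq : ∀ᶠ i in l, AEStronglyMeasurable (q i) volume)
    (hΦ : MemLp Φ 2 (volume : Measure Plane)) (hb : ∀ᶠ i in l, ∀ᵐ z, ‖q i z‖ ≤ Φ z)
    (hlim : ∀ᵐ z, Tendsto (fun i => q i z) l (𝓝 0)) :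
    Tendsto (fun i => ‖toL2 (q i)‖) l (𝓝 0) := by
  have h1 : Tendsto (fun i => ∫ z, ‖q i z‖ ^ 2) l (𝓝 (∫ _ : Plane, (0 : ℝ))) := by
    refine tendsto_integral_filter_of_dominated_convergence (fun z => ‖Φ z‖ ^ 2) ?_ ?_ ?_ ?_
    · filter_upwards [hq] with i hi
      exact hi.norm.pow 2
    · filter_upwards [hb] with i hi
      filter_upwards [hi] with z hz
      rw [norm_pow, norm_norm]
      gcongr
      exact hz.trans (Real.le_norm_self _)
    · exact hΦ.integrable_norm_pow two_ne_zero
    · filter_upwards [hlim] with z hz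
      simpa using hz.norm.pow 2
  rw [integral_zero] at h1
  have h2 : Tendsto (fun i => √(∫ z, ‖q i z‖ ^ 2)) l (𝓝 0) := by
    have := (Real.continuous_sqrt.tendsto 0).comp h1
    rwa [Real.sqrt_zero] at this
  refine squeeze_zero (fun i => norm_nonneg _) (fun i => ?_) h2
  by_cases h : MemLp (q i) 2 (volume : Measure Plane)
  · rw [← norm_toL2_sq h, Real.sqrt_sq (norm_nonneg _)]
  · rw [toL2_eq_zero h, norm_zero]; positivity

theorem hasDerivAt_toL2 {F F' : ℝ → Plane → ℂ} {l₀ δ : ℝ} (hδ : 0 < δ)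
    (hF : ∀ l ∈ Metric.ball l₀ δ, MemLp (F l) 2 (volume : Measure Plane))
    (hF' : MemLp (F' l₀) 2 (volume : Measure Plane)) {Φ : Plane → ℝ}
    (hΦ : MemLp Φ 2 (volume : Measure Plane))
    (hd : ∀ᵐ z, ∀ l ∈ Metric.ball l₀ δ, HasDerivAt (fun l => F l z) (F' l z) l ∧ ‖F' l z‖ ≤ Φ z) :
    HasDerivAt (fun l => toL2 (F l)) (toL2 (F' l₀)) l₀ := by
  have h0 : l₀ ∈ Metric.ball l₀ δ := Metric.mem_ball_self hδ
  rw [hasDerivAt_iff_tendsto]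
  set q : ℝ → Plane → ℂ := fun l z =>
    ((‖l - l₀‖⁻¹ : ℝ) : ℂ) * ((F l z - F l₀ z) - ((l - l₀ : ℝ) : ℂ) * F' l₀ z) with hq
  have hmem : ∀ l ∈ Metric.ball l₀ δ, MemLp (q l) 2 (volume : Measure Plane) := fun l hl =>
    (((hF l hl).sub (hF l₀ h0)).sub (hF'.const_mul _)).const_mul _
  have heq : ∀ᶠ l in 𝓝 l₀, ‖toL2 (q l)‖ =
      ‖l - l₀‖⁻¹ * ‖toL2 (F l) - toL2 (F l₀) - (l - l₀) • toL2 (F' l₀)‖ := by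
    filter_upwards [Metric.ball_mem_nhds l₀ hδ] with l hl
    have h1 : toL2 (q l) = ((‖l - l₀‖⁻¹ : ℝ) : ℂ) •
        (toL2 (F l) - toL2 (F l₀) - ((l - l₀ : ℝ) : ℂ) • toL2 (F' l₀)) := by
      rw [← toL2_sub (hF l hl) (hF l₀ h0), ← toL2_const_mul hF',
        ← toL2_sub (f := fun z => F l z - F l₀ z) ((hF l hl).sub (hF l₀ h0)) (hF'.const_mul _),
        ← toL2_const_mul]
      exact (((hF l hl).sub (hF l₀ h0)).sub (hF'.const_mul _))
    rw [h1, norm_smul, Complex.norm_real, norm_inv, norm_norm]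
    rfl
  -- One `Φ` bounds the difference quotient by the mean value inequality, the other bounds the
  -- derivative at `l₀`.
  refine Tendsto.congr' heq (tendsto_norm_toL2 (Φ := fun z => 2 * Φ z) ?_ (hΦ.const_mul 2) ?_ ?_)
  · filter_upwards [Metric.ball_mem_nhds l₀ hδ] with l hl using (hmem l hl).1
  · filter_upwards [Metric.ball_mem_nhds l₀ hδ] with l hl
    filter_upwards [hd] with z hz
    have h1 : ‖F l z - F l₀ z‖ ≤ Φ z * ‖l - l₀‖ :=
      (convex_ball l₀ δ).norm_image_sub_le_of_norm_hasDerivWithin_le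
        (fun x hx => (hz x hx).1.hasDerivWithinAt) (fun x hx => (hz x hx).2) h0 hl
    have h2 := (hz l₀ h0).2
    rw [hq]
    simp only
    rw [norm_mul, Complex.norm_real, norm_inv, norm_norm]
    have hΦ0 : 0 ≤ Φ z := (norm_nonneg _).trans h2
    rw [← div_eq_inv_mul]
    refine div_le_of_le_mul₀ (norm_nonneg _) (by positivity) ?_
    refine (norm_sub_le _ _).trans ?_
    rw [norm_mul, Complex.norm_real]
    nlinarith [norm_nonneg (l - l₀)]
  · filter_upwards [hd] with z hz
    have h1 := (hz l₀ h0).1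
    rw [hasDerivAt_iff_tendsto] at h1
    rw [tendsto_zero_iff_norm_tendsto_zero]
    refine h1.congr fun l => ?_
    rw [hq]
    simp only
    rw [norm_mul, Complex.norm_real, norm_inv, norm_norm, Complex.real_smul]

theorem inner_toL2_left {f : Plane → ℂ} (hf : MemLp f 2 (volume : Measure Plane)) (g : L2) :
    inner ℂ (toL2 f) g = ∫ z, g z * (starRingEnd ℂ) (f z) := by
  rw [L2.inner_def]
  refine integral_congr_ae ?_
  filter_upwards [coeFn_toL2 hf] with z hz
  rw [RCLike.inner_apply, hz]

theorem inner_toL2_right {f : Plane → ℂ} (hf : MemLp f 2 (volume : Measure Plane)) (g : L2) :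
    inner ℂ g (toL2 f) = ∫ z, f z * (starRingEnd ℂ) (g z) := by
  rw [L2.inner_def]
  refine integral_congr_ae ?_
  filter_upwards [coeFn_toL2 hf] with z hz
  rw [RCLike.inner_apply, hz]

theorem integrable_mul_conj {f g : Plane → ℂ} (hf : MemLp f 2 (volume : Measure Plane))
    (hg : MemLp g 2 (volume : Measure Plane)) : Integrable (fun z => g z * (starRingEnd ℂ) (f z)) :=
  MemLp.integrable_mul hg (hf.star)

/-! ### Weights and integrals over the plane -/

/-- The weight `(1 + |z|)^(-(1 + ε))`. -/
noncomputable def weight (ε : ℝ) (z : Plane) : ℝ := (1 + ‖z‖) ^ (-(1 + ε))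

/-- The kernel `(1 + |x|)^(-1/2) (1 + |y|)^(-1/2) (1 + ||x| - |y||)^(-2)`. -/
noncomputable def radialKernel (x y : Plane) : ℝ :=
  (√(1 + ‖x‖))⁻¹ * (√(1 + ‖y‖))⁻¹ * ((1 + |‖x‖ - ‖y‖|) ^ 2)⁻¹

/-- The envelope `(1 + |z|)^(-(1 + ε)) ((1 + |x|)^(-1/2) + |x - z|^(-1/2))`. -/
noncomputable def envelope (ε : ℝ) (x z : Plane) : ℝ :=
  weight ε z * ((√(1 + ‖x‖))⁻¹ + (√‖x - z‖)⁻¹)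

theorem weight_pos (ε : ℝ) (z : Plane) : 0 < weight ε z := by
  rw [weight]; positivity

theorem envelope_nonneg (ε : ℝ) (x z : Plane) : 0 ≤ envelope ε x z :=
  mul_nonneg (weight_pos ε z).le (by positivity)

theorem weight_sq (ε : ℝ) (z : Plane) : weight ε z ^ 2 = (1 + ‖z‖) ^ (-(2 + 2 * ε)) := by
  rw [weight, ← Real.rpow_natCast, ← Real.rpow_mul (by positivity)]
  congr 1
  push_cast
  ring

theorem measurable_weight (ε : ℝ) : Measurable (weight ε) := by
  unfold weight; fun_prop

theorem measurable_envelope (ε : ℝ) : Measurable (Function.uncurry (envelope ε)) := by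
  unfold envelope weight
  simp only [Function.uncurry_def]
  fun_prop

theorem integrable_weight_sq {ε : ℝ} (hε : 0 < ε) : Integrable fun z => weight ε z ^ 2 := by
  simp only [weight_sq]
  refine integrable_one_add_norm ?_
  rw [finrank_euclideanSpace_fin]
  push_cast
  linarith

theorem exists_integral_radial : ∃ c : ℝ, 0 ≤ c ∧ ∀ f : ℝ → ℝ,
    (Integrable (fun z : Plane => f ‖z‖) ↔ IntegrableOn (fun r => r * f r) (Set.Ioi 0)) ∧
    ∫ z : Plane, f ‖z‖ = c * ∫ r in Set.Ioi (0 : ℝ), r * f r := by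
  refine ⟨2 * (volume : Measure Plane).real (Metric.ball 0 1), by positivity, fun f => ⟨?_, ?_⟩⟩
  · rw [integrable_fun_norm_addHaar, finrank_euclideanSpace_fin]
    simp
  · rw [integral_fun_norm_addHaar, finrank_euclideanSpace_fin]
    simp
    ring

theorem exists_integral_inv_norm : ∃ c : ℝ, 0 ≤ c ∧ ∀ (R : ℝ), 0 ≤ R → ∀ x : Plane,
    Integrable (fun z : Plane => (Set.Iio R).indicator (fun r => r⁻¹) ‖x - z‖) ∧
    ∫ z : Plane, (Set.Iio R).indicator (fun r => r⁻¹) ‖x - z‖ = c * R := by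
  obtain ⟨c, hc, h⟩ := exists_integral_radial
  refine ⟨c, hc, fun R hR x => ?_⟩
  obtain ⟨h1, h2⟩ := h ((Set.Iio R).indicator (fun r => r⁻¹))
  have heq : Set.EqOn (fun r : ℝ => r * (Set.Iio R).indicator (fun r => r⁻¹) r)
      ((Set.Iio R).indicator fun _ => 1) (Set.Ioi 0) := by
    intro r (hr : 0 < r)
    by_cases h : r < R <;> simp [Set.indicator, h, hr.ne']
  have hint : IntegrableOn (fun r : ℝ => r * (Set.Iio R).indicator (fun r => r⁻¹) r) (Set.Ioi 0) := by
    rw [integrableOn_congr_fun heq measurableSet_Ioi, integrableOn_indicator_iff measurableSet_Iio,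
      Set.Iio_inter_Ioi]
    exact integrableOn_const (by simp)
  constructor
  · exact (h1.2 hint).comp_sub_left x
  · rw [integral_sub_left_eq_self (fun z : Plane => (Set.Iio R).indicator (fun r => r⁻¹) ‖z‖), h2,
      setIntegral_congr_fun measurableSet_Ioi heq, setIntegral_indicator measurableSet_Iio,
      Set.Ioi_inter_Iio]
    simp [hR]

/-- Where `|x-z| < (1+|x|)/2` one has `1+|z| ≥ (1+|x|)/2`, so the squared weight is
`O((1+|x|)^(-2))`, and the integral of `|x-z|⁻¹` over this disc is linear in the radius. Elsewhere
`|x-z|⁻¹` is itself `O((1+|x|)⁻¹)`. -/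
theorem exists_integral_weight_div {ε : ℝ} (hε : 0 < ε) : ∃ C : ℝ, 0 ≤ C ∧ ∀ x : Plane,
    Integrable (fun z => weight ε z ^ 2 * ‖x - z‖⁻¹) ∧
    ∫ z, weight ε z ^ 2 * ‖x - z‖⁻¹ ≤ C * (1 + ‖x‖)⁻¹ := by
  obtain ⟨c, hc, hcR⟩ := exists_integral_inv_norm
  set I := ∫ z, weight ε z ^ 2 with hI
  have hI0 : 0 ≤ I := integral_nonneg fun z => by positivity
  refine ⟨2 * I + c * 2, by positivity, fun x => ?_⟩
  set X := 1 + ‖x‖ with hX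
  have hX1 : 1 ≤ X := by simp [hX]
  have hX0 : 0 < X := by linarith
  obtain ⟨hi1, hi2⟩ := hcR (X / 2) (by positivity) x
  have hbound : ∀ z, weight ε z ^ 2 * ‖x - z‖⁻¹ ≤ weight ε z ^ 2 * (2 * X⁻¹)
      + 4 * X⁻¹ ^ 2 * (Set.Iio (X / 2)).indicator (fun r => r⁻¹) ‖x - z‖ := by
    intro z
    by_cases h : ‖x - z‖ < X / 2
    · rw [Set.indicator_of_mem (by exact h)]
      have h1 : X / 2 ≤ 1 + ‖z‖ := by
        have := norm_sub_norm_le x z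
        rw [hX] at *
        linarith
      have h2 : weight ε z ^ 2 ≤ 4 * X⁻¹ ^ 2 := by
        have h3 : (1 : ℝ) ≤ 1 + ‖z‖ := by simp
        have h4 : weight ε z ≤ (1 + ‖z‖)⁻¹ := by
          rw [weight, ← Real.rpow_neg_one]
          exact Real.rpow_le_rpow_of_exponent_le h3 (by linarith)
        have h5 : (1 + ‖z‖)⁻¹ ≤ 2 * X⁻¹ := by
          rw [← div_eq_mul_inv, ← inv_div]
          gcongr
        calc weight ε z ^ 2 ≤ (2 * X⁻¹) ^ 2 :=
              pow_le_pow_left₀ (weight_pos ε z).le (h4.trans h5) 2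
          _ = _ := by ring
      have h6 : 0 ≤ ‖x - z‖⁻¹ := by positivity
      have h7 : 0 ≤ weight ε z ^ 2 * (2 * X⁻¹) := by positivity
      nlinarith [mul_le_mul_of_nonneg_right h2 h6]
    · rw [Set.indicator_of_notMem (by exact h), mul_zero, add_zero]
      gcongr
      rw [← div_eq_mul_inv, ← inv_div]
      gcongr
      exact not_lt.1 h
  have hint : Integrable fun z => weight ε z ^ 2 * (2 * X⁻¹)
      + 4 * X⁻¹ ^ 2 * (Set.Iio (X / 2)).indicator (fun r => r⁻¹) ‖x - z‖ :=
    ((integrable_weight_sq hε).mul_const _).add (hi1.const_mul _)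
  have hmeas : AEStronglyMeasurable (fun z => weight ε z ^ 2 * ‖x - z‖⁻¹) volume := by
    have := measurable_weight ε
    exact Measurable.aestronglyMeasurable (by fun_prop)
  have hmain : Integrable (fun z => weight ε z ^ 2 * ‖x - z‖⁻¹) := by
    refine hint.mono' hmeas (Eventually.of_forall fun z => ?_)
    rw [Real.norm_of_nonneg (by positivity)]
    exact hbound z
  refine ⟨hmain, (integral_mono hmain hint hbound).trans ?_⟩
  rw [integral_add ((integrable_weight_sq hε).mul_const _) (hi1.const_mul _), integral_mul_const,
    integral_const_mul, hi2]
  have : X⁻¹ ^ 2 * X = X⁻¹ := by field_simp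
  nlinarith

/-- In weighted `L²` norm the singular term `|x-z|^(-1/2)` decays in `x` no slower than
`(1+|x|)^(-1/2)`. This supplies the spatial decay of the kernel. -/
theorem exists_envelope_bound {ε : ℝ} (hε : 0 < ε) : ∃ C : ℝ, 0 ≤ C ∧ ∀ x : Plane,
    MemLp (envelope ε x) 2 (volume : Measure Plane) ∧
    (eLpNorm (envelope ε x) 2 volume).toReal ≤ C * (√(1 + ‖x‖))⁻¹ := by
  obtain ⟨C, hC, h⟩ := exists_integral_weight_div hε
  set I := ∫ z, weight ε z ^ 2 with hI
  have hI0 : 0 ≤ I := integral_nonneg fun z => by positivity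
  refine ⟨√(2 * I + 2 * C), by positivity, fun x => ?_⟩
  set X := 1 + ‖x‖ with hX
  have hX0 : 0 < X := by positivity
  have hb : ∀ z, envelope ε x z ^ 2 ≤
      weight ε z ^ 2 * (2 * X⁻¹) + 2 * (weight ε z ^ 2 * ‖x - z‖⁻¹) := by
    intro z
    have h1 : (√X)⁻¹ ^ 2 = X⁻¹ := by rw [inv_pow, Real.sq_sqrt hX0.le]
    have h2 : (√‖x - z‖)⁻¹ ^ 2 = ‖x - z‖⁻¹ := by rw [inv_pow, Real.sq_sqrt (norm_nonneg _)]
    rw [envelope, mul_pow, ← h1, ← h2]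
    nlinarith [mul_nonneg (sq_nonneg (weight ε z)) (sq_nonneg ((√X)⁻¹ - (√‖x - z‖)⁻¹))]
  have hint : Integrable fun z => weight ε z ^ 2 * (2 * X⁻¹) + 2 * (weight ε z ^ 2 * ‖x - z‖⁻¹) :=
    ((integrable_weight_sq hε).mul_const _).add ((h x).1.const_mul _)
  have hm : Measurable (envelope ε x) := (measurable_envelope ε).of_uncurry_left
  have hsq : Integrable fun z => envelope ε x z ^ 2 := by
    refine hint.mono' (hm.pow_const 2).aestronglyMeasurable (Eventually.of_forall fun z => ?_)
    rw [Real.norm_of_nonneg (by positivity)]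
    exact hb z
  have hmem : MemLp (envelope ε x) 2 (volume : Measure Plane) :=
    (memLp_two_iff_integrable_sq hm.aestronglyMeasurable).2 hsq
  refine ⟨hmem, ?_⟩
  rw [hmem.eLpNorm_eq_integral_rpow_norm two_ne_zero ENNReal.ofNat_ne_top,
    ENNReal.toReal_ofReal (by positivity)]
  simp only [ENNReal.toReal_ofNat, Real.rpow_ofNat]
  rw [← one_div, ← Real.sqrt_eq_rpow, ← Real.sqrt_inv, ← Real.sqrt_mul (by positivity)]
  refine Real.sqrt_le_sqrt ?_
  simp only [Real.norm_eq_abs, sq_abs]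
  refine (integral_mono hsq hint hb).trans ?_
  rw [integral_add ((integrable_weight_sq hε).mul_const _) ((h x).1.const_mul _), integral_mul_const,
    integral_const_mul]
  nlinarith [(h x).2]

theorem radialKernel_comm (x y : Plane) : radialKernel x y = radialKernel y x := by
  rw [radialKernel, radialKernel, abs_sub_comm, mul_comm (√(1 + ‖x‖))⁻¹]

theorem radialKernel_nonneg (x y : Plane) : 0 ≤ radialKernel x y := by
  rw [radialKernel]; positivity

/-- In polar coordinates the Jacobian `r` leaves `√(1+r) / √(1+|x|)`, at most `√s` for `s = 1 +
||x|-r|`. What remains is `s^(-3/2)`, integrable over the line uniformly in `x`. -/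
theorem exists_integral_radialKernel : ∃ C : ℝ, 0 ≤ C ∧ ∀ x : Plane,
    Integrable (radialKernel x) ∧ ∫ y, radialKernel x y ≤ C := by
  obtain ⟨c, hc, h⟩ := exists_integral_radial
  set J := ∫ s : ℝ, (1 + ‖s‖) ^ (-(3 / 2 : ℝ)) with hJ
  have hJint : Integrable fun s : ℝ => (1 + ‖s‖) ^ (-(3 / 2 : ℝ)) := by
    refine integrable_one_add_norm ?_
    rw [Module.finrank_self]; norm_num
  have hJ0 : 0 ≤ J := integral_nonneg fun s => by positivity
  refine ⟨c * (2 * J), by positivity, fun x => ?_⟩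
  obtain ⟨h1, h2⟩ := h fun r => (√(1 + ‖x‖))⁻¹ * (√(1 + r))⁻¹ * ((1 + |‖x‖ - r|) ^ 2)⁻¹
  set g : ℝ → ℝ := fun r => r * ((√(1 + ‖x‖))⁻¹ * (√(1 + r))⁻¹ * ((1 + |‖x‖ - r|) ^ 2)⁻¹) with hg
  have hb : ∀ r, 0 < r → g r ≤ 2 * (1 + ‖‖x‖ - r‖) ^ (-(3 / 2 : ℝ)) := by
    intro r hr
    set s := 1 + |‖x‖ - r| with hs
    have hs1 : 1 ≤ s := by simp [hs]
    have hs0 : 0 < s := by linarith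
    have e1 : (1 + ‖‖x‖ - r‖) ^ (-(3 / 2 : ℝ)) = √s * (s ^ 2)⁻¹ := by
      rw [Real.norm_eq_abs, ← hs, Real.sqrt_eq_rpow, ← Real.rpow_natCast, ← Real.rpow_neg hs0.le,
        ← Real.rpow_add hs0]
      norm_num
    rw [e1, hg]
    have hX : 0 < √(1 + ‖x‖) := by positivity
    have hr1 : 0 < √(1 + r) := by positivity
    have h3 : r * (√(1 + r))⁻¹ ≤ √(1 + r) := by
      rw [← div_eq_mul_inv, div_le_iff₀ hr1, Real.mul_self_sqrt (by positivity)]; linarith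
    have h4 : √(1 + r) ≤ √(1 + ‖x‖) * √s := by
      rw [← Real.sqrt_mul (by positivity)]
      refine Real.sqrt_le_sqrt ?_
      have := neg_abs_le (‖x‖ - r)
      have h5 := norm_nonneg x
      rw [hs]
      nlinarith [abs_nonneg (‖x‖ - r)]
    have h6 : (√(1 + ‖x‖))⁻¹ * (r * (√(1 + r))⁻¹) ≤ √s := by
      rw [inv_mul_le_iff₀ hX]
      exact h3.trans h4
    have h7 : 0 ≤ √s * (s ^ 2)⁻¹ := by positivity
    calc r * ((√(1 + ‖x‖))⁻¹ * (√(1 + r))⁻¹ * (s ^ 2)⁻¹)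
        = ((√(1 + ‖x‖))⁻¹ * (r * (√(1 + r))⁻¹)) * (s ^ 2)⁻¹ := by ring
      _ ≤ √s * (s ^ 2)⁻¹ := by gcongr
      _ ≤ _ := by linarith
  have hJx : Integrable fun r : ℝ => 2 * (1 + ‖‖x‖ - r‖) ^ (-(3 / 2 : ℝ)) :=
    (hJint.comp_sub_left ‖x‖).const_mul 2
  have hgm : Measurable g := by fun_prop
  have hgint : IntegrableOn g (Set.Ioi 0) := by
    refine hJx.integrableOn.mono' hgm.aestronglyMeasurable
      ((ae_restrict_iff' measurableSet_Ioi).2 (Eventually.of_forall fun r hr => ?_))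
    have hr : 0 < r := hr
    rw [Real.norm_of_nonneg (by simp only [hg]; positivity)]
    exact hb r hr
  refine ⟨h1.2 hgint, ?_⟩
  refine h2.trans_le (mul_le_mul_of_nonneg_left ?_ hc)
  calc ∫ r in Set.Ioi 0, g r ≤ ∫ r in Set.Ioi 0, 2 * (1 + ‖‖x‖ - r‖) ^ (-(3 / 2 : ℝ)) :=
        setIntegral_mono_on hgint hJx.integrableOn measurableSet_Ioi hb
    _ ≤ ∫ r, 2 * (1 + ‖‖x‖ - r‖) ^ (-(3 / 2 : ℝ)) :=
        setIntegral_le_integral hJx (Eventually.of_forall fun r => by positivity)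
    _ = 2 * J := by
      rw [integral_const_mul, integral_sub_left_eq_self (fun s : ℝ => (1 + ‖s‖) ^ (-(3 / 2 : ℝ)))]

/-! ### The potential factor -/

/-- Decay of `v`, in a form adapted to the envelope. -/
theorem exists_vfun_le {V : Plane → ℝ} {C ε : ℝ} (hε : 0 < ε)
    (hdecay : ∀ x : Plane, vfun V x ≤ C * bracket x ^ (-(3 + ε))) :
    ∃ C', 0 ≤ C' ∧ ∀ z, (1 + ‖z‖) ^ 2 * vfun V z ≤ C' * weight ε z := by
  -- The power of 2 comes from `⟨z⟩ ≥ (1+|z|)/2`.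
  refine ⟨|C| * 2 ^ (3 + ε), by positivity, fun z => ?_⟩
  have hb0 : 0 < bracket z := by rw [bracket]; positivity
  have hb : (1 + ‖z‖) / 2 ≤ bracket z := by
    rw [bracket]
    refine Real.le_sqrt_of_sq_le ?_
    nlinarith [sq_nonneg (‖z‖ - 1), sq_nonneg ‖z‖]
  have hZ : 0 < 1 + ‖z‖ := by positivity
  have h1 : bracket z ^ (-(3 + ε)) ≤ 2 ^ (3 + ε) * (1 + ‖z‖) ^ (-(3 + ε)) := by
    calc bracket z ^ (-(3 + ε)) ≤ ((1 + ‖z‖) / 2) ^ (-(3 + ε)) :=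
          Real.rpow_le_rpow_of_nonpos (by positivity) hb (by linarith)
      _ = _ := by
        rw [Real.div_rpow hZ.le zero_le_two, Real.rpow_neg zero_le_two, div_inv_eq_mul, mul_comm]
  have h2 : weight ε z = (1 + ‖z‖) ^ 2 * (1 + ‖z‖) ^ (-(3 + ε)) := by
    rw [weight, ← Real.rpow_natCast, ← Real.rpow_add hZ]
    congr 1
    push_cast
    ring
  calc (1 + ‖z‖) ^ 2 * vfun V z ≤ (1 + ‖z‖) ^ 2 * (|C| * (2 ^ (3 + ε) * (1 + ‖z‖) ^ (-(3 + ε)))) := by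
        gcongr
        refine (hdecay z).trans ?_
        refine (mul_le_mul_of_nonneg_right (le_abs_self C) (by positivity)).trans ?_
        gcongr
    _ = _ := by rw [h2]; ring

theorem vfun_nonneg (V : Plane → ℝ) (z : Plane) : 0 ≤ vfun V z := Real.sqrt_nonneg _

theorem measurable_vfun {V : Plane → ℝ} (hV : Measurable V) : Measurable (vfun V) := by
  unfold vfun; exact (hV.abs).sqrt

theorem memLp_weight {ε : ℝ} (hε : 0 < ε) : MemLp (weight ε) 2 (volume : Measure Plane) :=
  (memLp_two_iff_integrable_sq (measurable_weight ε).aestronglyMeasurable).2 (integrable_weight_sq hε)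

/-! ### Self-adjoint operators that are invertible modulo compact operators -/

section Fredholm

variable {H : Type*} [NormedAddCommGroup H] [InnerProductSpace ℂ H]

/-- Otherwise there are unit vectors `q n` with `A' (q n) → 0`, so `A (q n) → 0` and `S (q n) → 0`.
By compactness of `K`, a subsequence of `q n = R A (q n) - K (q n)` converges to a unit vector in
the kernels of both `A` and `S`, and `S` fixes the kernel of `A`. -/
theorem exists_le_norm_of_parametrix {A' A S R K : H →L[ℂ] H}
    (hA' : ∀ q, ‖A' q‖ ^ 2 = ‖A q‖ ^ 2 + ‖S q‖ ^ 2) (hker : ∀ q, A q = 0 → S q = q)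
    (hR : R ∘L A = 1 + K) (hK : IsCompactOperator K) :
    ∃ c : ℝ, 0 < c ∧ ∀ q, c * ‖q‖ ≤ ‖A' q‖ := by
  by_contra hcon
  push Not at hcon
  have hex : ∀ n : ℕ, ∃ q : H, ‖q‖ = 1 ∧ ‖A' q‖ < 1 / ((n : ℝ) + 1) := by
    intro n
    obtain ⟨q, hq⟩ := hcon (1 / ((n : ℝ) + 1)) (by positivity)
    have hq0 : 0 < ‖q‖ := by
      rcases (norm_nonneg q).lt_or_eq with h | h
      · exact h
      · rw [← h, mul_zero] at hq
        exact absurd hq (not_lt.2 (norm_nonneg _))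
    refine ⟨((‖q‖⁻¹ : ℝ) : ℂ) • q, ?_, ?_⟩
    · rw [norm_smul, Complex.norm_real, norm_inv, norm_norm, inv_mul_cancel₀ hq0.ne']
    · rw [map_smul, norm_smul, Complex.norm_real, norm_inv, norm_norm, inv_mul_lt_iff₀ hq0, mul_comm]
      exact hq
  choose q hq1 hq2 using hex
  have hA'0 : Tendsto (fun n => ‖A' (q n)‖) atTop (𝓝 0) :=
    squeeze_zero (fun n => norm_nonneg _) (fun n => (hq2 n).le) tendsto_one_div_add_atTop_nhds_zero_nat
  have hA0 : Tendsto (fun n => A (q n)) atTop (𝓝 0) := by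
    rw [tendsto_zero_iff_norm_tendsto_zero]
    refine squeeze_zero (fun n => norm_nonneg _) (fun n => ?_) hA'0
    refine (sq_le_sq₀ (norm_nonneg _) (norm_nonneg _)).1 ?_
    rw [hA']; nlinarith [sq_nonneg ‖S (q n)‖]
  have hS0 : Tendsto (fun n => S (q n)) atTop (𝓝 0) := by
    rw [tendsto_zero_iff_norm_tendsto_zero]
    refine squeeze_zero (fun n => norm_nonneg _) (fun n => ?_) hA'0
    refine (sq_le_sq₀ (norm_nonneg _) (norm_nonneg _)).1 ?_
    rw [hA']; nlinarith [sq_nonneg ‖A (q n)‖]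
  obtain ⟨Z, hZ, hsub⟩ := IsCompactOperator.image_closedBall_subset_compact (f := (K : H →ₗ[ℂ] H)) hK 1
  have hmem : ∀ n, K (q n) ∈ Z := fun n => hsub ⟨q n, by simp [hq1 n], rfl⟩
  obtain ⟨w, -, φ, hφ, hw⟩ := hZ.tendsto_subseq hmem
  have hRA : ∀ n, q n = R (A (q n)) - K (q n) := by
    intro n
    have := congrArg (fun L : H →L[ℂ] H => L (q n)) hR
    simp only [ContinuousLinearMap.comp_apply, add_apply,
      one_apply_eq_self] at this
    rw [this]; abel
  have hlim : Tendsto (fun n => q (φ n)) atTop (𝓝 (-w)) := by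
    have h1 : Tendsto (fun n => R (A (q (φ n))) - K (q (φ n))) atTop (𝓝 (R 0 - w)) :=
      ((R.continuous.tendsto 0).comp (hA0.comp hφ.tendsto_atTop)).sub hw
    rw [map_zero, zero_sub] at h1
    exact h1.congr fun n => (hRA _).symm
  have e1 : A (-w) = 0 :=
    tendsto_nhds_unique ((A.continuous.tendsto _).comp hlim) (hA0.comp hφ.tendsto_atTop)
  have e2 : S (-w) = 0 :=
    tendsto_nhds_unique ((S.continuous.tendsto _).comp hlim) (hS0.comp hφ.tendsto_atTop)
  have e3 : -w = 0 := (hker _ e1).symm.trans e2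
  have e4 : ‖-w‖ = 1 := tendsto_nhds_unique hlim.norm (by simp [hq1])
  rw [e3, norm_zero] at e4
  exact zero_ne_one e4

/-- A self-adjoint operator with a parametrix becomes invertible after adding the projection onto
its kernel. -/
theorem isUnit_add_ker_starProjection [CompleteSpace H] {A R K : H →L[ℂ] H}
    (hA : ∀ p q, inner ℂ (A p) q = inner ℂ p (A q)) (hR : R ∘L A = 1 + K)
    (hK : IsCompactOperator K) : IsUnit (A + A.ker.starProjection) := by
  set S := A.ker.starProjection with hS
  have hSmem : ∀ q, A (S q) = 0 := fun q => A.ker.starProjection_apply_mem q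
  have horth : ∀ p q, inner ℂ (A p) (S q) = 0 := fun p q => by rw [hA, hSmem, inner_zero_right]
  have hSsymm : ∀ p q, inner ℂ (S p) q = inner ℂ p (S q) := fun p q =>
    A.ker.inner_starProjection_left_eq_right p q
  have hA' : ∀ q, ‖(A + S) q‖ ^ 2 = ‖A q‖ ^ 2 + ‖S q‖ ^ 2 := by
    intro q
    rw [add_apply, sq, sq, sq]
    exact norm_add_sq_eq_norm_sq_add_norm_sq_of_inner_eq_zero _ _ (horth q q)
  obtain ⟨c, hc, hb⟩ := exists_le_norm_of_parametrix hA'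
    (fun q hq => A.ker.starProjection_eq_self_iff.2 hq) hR hK
  have hsymm : ∀ p q, inner ℂ ((A + S) p) q = inner ℂ p ((A + S) q) := by
    intro p q
    simp only [add_apply, inner_add_left, inner_add_right, hA, hSsymm]
  -- The square is coercive: `⟪(A+S)² q, q⟫ = ‖(A+S) q‖²` by symmetry.
  rw [← isUnit_pow_iff two_ne_zero]
  refine ContinuousLinearMap.isUnit_of_forall_le_norm_inner_map _ (c := ⟨c ^ 2, by positivity⟩)
    (show (0 : ℝ) < c ^ 2 by positivity) fun q => ?_
  rw [pow_two (A + S), mul_apply_eq_comp, hsymm, inner_self_eq_norm_sq_to_K]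
  rw [norm_pow, RCLike.norm_ofReal, abs_norm]
  show ‖q‖ ^ 2 * c ^ 2 ≤ _
  calc ‖q‖ ^ 2 * c ^ 2 = (c * ‖q‖) ^ 2 := by ring
    _ ≤ _ := pow_le_pow_left₀ (by positivity) (hb q) 2

end Fredholm

/-! ### Hilbert–Schmidt operators -/

/-- The operator `f ↦ (x ↦ Φ x f)` defined by a square integrable field of functionals. -/
noncomputable def hsOp : Lp (L2 →L[ℂ] ℂ) 2 (volume : Measure Plane) →L[ℂ] L2 →L[ℂ] L2 :=
  LinearMap.mkContinuous₂
    (LinearMap.mk₂ ℂ (fun Φ f => (ContinuousLinearMap.apply ℂ ℂ f).compLpL 2 volume Φ)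
      (fun Φ Ψ f => map_add _ _ _) (fun c Φ f => map_smul _ _ _)
      (fun Φ f g => by rw [map_add, ContinuousLinearMap.add_compLpL, add_apply])
      (fun c Φ f => by rw [map_smul, ContinuousLinearMap.smul_compLpL, smul_apply]))
    1 fun Φ f => by
      rw [LinearMap.mk₂_apply, one_mul, mul_comm]
      refine (ContinuousLinearMap.norm_compLp_le _ _).trans ?_
      gcongr
      refine ContinuousLinearMap.opNorm_le_bound _ (norm_nonneg _) fun L => ?_
      rw [ContinuousLinearMap.apply_apply, mul_comm]
      exact L.le_opNorm f

theorem coeFn_hsOp (Φ : Lp (L2 →L[ℂ] ℂ) 2 (volume : Measure Plane)) (f : L2) :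
    (hsOp Φ f : Plane → ℂ) =ᵐ[volume] fun x => Φ x f :=
  (ContinuousLinearMap.apply ℂ ℂ f).coeFn_compLpL Φ

/-- A constant functional on a set of finite measure gives a rank-one operator; sums and norm limits
of compact operators are compact, and simple fields are dense. -/
theorem isCompactOperator_hsOp (Φ : Lp (L2 →L[ℂ] ℂ) 2 (volume : Measure Plane)) :
    IsCompactOperator (hsOp Φ) := by
  refine Lp.induction ENNReal.ofNat_ne_top (motive := fun Φ => IsCompactOperator (hsOp Φ))
    ?_ ?_ ?_ Φ
  · intro c s hs hμs
    have h : hsOp (Lp.simpleFunc.indicatorConst 2 hs hμs.ne c : Lp (L2 →L[ℂ] ℂ) 2 (volume : Measure Plane))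
        = ((ContinuousLinearMap.id ℂ ℂ).smulRight (indicatorConstLp 2 hs hμs.ne (1 : ℂ))) ∘L c := by
      ext1 f
      refine Lp.ext ?_
      rw [Lp.simpleFunc.coe_indicatorConst]
      have h1 : ((((ContinuousLinearMap.id ℂ ℂ).smulRight (indicatorConstLp 2 hs hμs.ne (1 : ℂ))) ∘L c) f : L2)
          = c f • indicatorConstLp 2 hs hμs.ne (1 : ℂ) := rfl
      rw [h1]
      filter_upwards [coeFn_hsOp (indicatorConstLp 2 hs hμs.ne c) f,
        indicatorConstLp_coeFn (p := 2) (hs := hs) (hμs := hμs.ne) (c := c),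
        indicatorConstLp_coeFn (p := 2) (hs := hs) (hμs := hμs.ne) (c := (1 : ℂ)),
        Lp.coeFn_smul (c f) (indicatorConstLp 2 hs hμs.ne (1 : ℂ))] with x h1 h2 h3 h4
      rw [h1, h2, h4, Pi.smul_apply, h3]
      by_cases hx : x ∈ s <;> simp [hx]
    rw [h]
    have hc : IsCompactOperator c := isCompactOperator_of_locallyCompactSpace_dom c
    exact hc.clm_comp ((ContinuousLinearMap.id ℂ ℂ).smulRight (indicatorConstLp 2 hs hμs.ne (1 : ℂ)))
  · intro f g hf hg _ h1 h2
    rw [map_add]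
    exact h1.add h2
  · exact isClosed_setOfPred_isCompactOperator.preimage hsOp.continuous

/-! ### The operator `T = U + v G₀ v` -/

theorem abs_log_le_sqrt_add (r : ℝ) (hr : 0 ≤ r) : |Real.log r| ≤ √r + (√r)⁻¹ := by
  rcases hr.eq_or_lt with rfl | hr
  · simp
  have hs : 0 < √r := Real.sqrt_pos.2 hr
  have h1 := Real.log_le_sub_one_of_pos hs
  have h2 := Real.log_le_sub_one_of_pos (inv_pos.2 hs)
  rw [Real.log_inv] at h2
  rw [Real.log_sqrt hr.le] at h1 h2
  have h3 := mul_inv_cancel₀ hs.ne'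
  have h5 : 2 ≤ √r + (√r)⁻¹ := by
    have h4 : 0 < (√r)⁻¹ := inv_pos.2 hs
    nlinarith [sq_nonneg (√r - (√r)⁻¹)]
  by_cases h : 1 ≤ r
  · rw [abs_of_nonneg (Real.log_nonneg h)]
    have := Real.add_one_le_exp (Real.log r / 2)
    have h6 := Real.log_le_sub_one_of_pos (Real.sqrt_pos.2 hs)
    rw [Real.log_sqrt hs.le, Real.log_sqrt hr.le] at h6
    have h7 : √(√r) ^ 2 = √r := Real.sq_sqrt hs.le
    have h8 : 0 < (√r)⁻¹ := inv_pos.2 hs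
    -- Here `log r = 4 log r^(1/4) ≤ 4 r^(1/4) - 4 ≤ r^(1/2)`, the last step being this square.
    nlinarith [sq_nonneg (√(√r) - 2)]
  · rw [abs_of_nonpos (Real.log_nonpos hr.le (not_le.1 h).le)]
    have h9 : 0 < √(√r)⁻¹ := Real.sqrt_pos.2 (inv_pos.2 hs)
    have h6 := Real.log_le_sub_one_of_pos h9
    rw [Real.log_sqrt (inv_pos.2 hs).le, Real.log_inv, Real.log_sqrt hr.le] at h6
    have h7 : √(√r)⁻¹ ^ 2 = (√r)⁻¹ := Real.sq_sqrt (inv_pos.2 hs).le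
    nlinarith [sq_nonneg (√(√r)⁻¹ - 2)]

/-- The real symmetric kernel of `v G₀ v`. -/
noncomputable def logKernel (V : Plane → ℝ) (x y : Plane) : ℝ :=
  -(1 / (2 * Real.pi)) * (vfun V x * Real.log ‖x - y‖ * vfun V y)

theorem logKernel_comm (V : Plane → ℝ) (x y : Plane) : logKernel V x y = logKernel V y x := by
  rw [logKernel, logKernel, norm_sub_rev]; ring

theorem measurable_logKernel {V : Plane → ℝ} (hV : Measurable V) :
    Measurable (Function.uncurry (logKernel V)) := by
  have := measurable_vfun hV
  unfold logKernel
  simp only [Function.uncurry_def]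
  fun_prop

/-- The two spare powers of `1+|x|` and `1+|y|` in the decay of `v` absorb the growth of the
logarithm; its singularity is covered by the term `|x-y|^(-1/2)` of the envelope. -/
theorem abs_logKernel_le {V : Plane → ℝ} {C ε : ℝ} (hC : 0 ≤ C)
    (hv : ∀ z, (1 + ‖z‖) ^ 2 * vfun V z ≤ C * weight ε z) (x y : Plane) :
    |logKernel V x y| ≤ C ^ 2 * weight ε x * envelope ε x y := by
  set X := 1 + ‖x‖ with hX
  set Y := 1 + ‖y‖ with hY
  have hX1 : 1 ≤ X := by simp [hX]
  have hY1 : 1 ≤ Y := by simp [hY]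
  have hvx := vfun_nonneg V x
  have hvy := vfun_nonneg V y
  have hpi : 1 / (2 * Real.pi) ≤ 1 := by
    rw [div_le_one (by positivity)]; linarith [Real.pi_gt_three]
  have hr : √‖x - y‖ ≤ X * Y := by
    refine Real.sqrt_le_iff.2 ⟨by positivity, ?_⟩
    have h1 := norm_sub_le x y
    have h2 : ‖x - y‖ ≤ X * Y := by rw [hX, hY]; nlinarith [norm_nonneg x, norm_nonneg y]
    have h3 : 1 ≤ X * Y := one_le_mul_of_one_le_of_one_le hX1 hY1
    nlinarith
  have hXs : X ^ 2 * (√X)⁻¹ ≥ X := by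
    have h4 : √X ≤ X := Real.sqrt_le_iff.2 ⟨by linarith, by nlinarith⟩
    have h5 : 0 < √X := by positivity
    rw [ge_iff_le, ← div_eq_mul_inv, le_div_iff₀ h5]
    nlinarith
  have hlog := abs_log_le_sqrt_add ‖x - y‖ (norm_nonneg _)
  have hi : 0 ≤ (√‖x - y‖)⁻¹ := by positivity
  have hXi : 0 ≤ (√X)⁻¹ := by positivity
  have key : |Real.log ‖x - y‖| ≤ (X ^ 2 * Y ^ 2) * ((√X)⁻¹ + (√‖x - y‖)⁻¹) := by
    have h6 : X * Y ≤ X ^ 2 * Y ^ 2 * (√X)⁻¹ := by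
      have h7 : X * Y ≤ (X ^ 2 * (√X)⁻¹) * Y := by gcongr
      have h8 : (X ^ 2 * (√X)⁻¹) * Y ≤ (X ^ 2 * (√X)⁻¹) * Y ^ 2 := by gcongr; nlinarith
      linarith
    have h9 : (√‖x - y‖)⁻¹ ≤ X ^ 2 * Y ^ 2 * (√‖x - y‖)⁻¹ := by
      refine le_mul_of_one_le_left hi ?_
      exact one_le_mul_of_one_le_of_one_le (one_le_pow₀ hX1) (one_le_pow₀ hY1)
    rw [mul_add]; linarith
  calc |logKernel V x y| = 1 / (2 * Real.pi) * (vfun V x * |Real.log ‖x - y‖| * vfun V y) := by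
        rw [logKernel, abs_mul, abs_neg, abs_mul, abs_mul, abs_of_nonneg hvx, abs_of_nonneg hvy,
          abs_of_pos (by positivity)]
    _ ≤ vfun V x * |Real.log ‖x - y‖| * vfun V y := mul_le_of_le_one_left (by positivity) hpi
    _ ≤ vfun V x * ((X ^ 2 * Y ^ 2) * ((√X)⁻¹ + (√‖x - y‖)⁻¹)) * vfun V y := by gcongr
    _ = (X ^ 2 * vfun V x) * (Y ^ 2 * vfun V y) * ((√X)⁻¹ + (√‖x - y‖)⁻¹) := by ring
    _ ≤ (C * weight ε x) * (C * weight ε y) * ((√X)⁻¹ + (√‖x - y‖)⁻¹) := by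
        have := weight_pos ε x
        exact mul_le_mul_of_nonneg_right
          (mul_le_mul (hv x) (hv y) (by positivity) (by positivity)) (by positivity)
    _ = _ := by rw [envelope]; ring

theorem memLp_logKernel {V : Plane → ℝ} (hV : Measurable V) {C ε : ℝ} (hε : 0 < ε) (hC : 0 ≤ C)
    (hv : ∀ z, (1 + ‖z‖) ^ 2 * vfun V z ≤ C * weight ε z) (x : Plane) :
    MemLp (fun y => (logKernel V x y : ℂ)) 2 (volume : Measure Plane) := by
  obtain ⟨C₁, -, hC₁⟩ := exists_envelope_bound hε
  refine ((hC₁ x).1.const_mul (C ^ 2 * weight ε x)).mono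
    (Measurable.aestronglyMeasurable ?_) (Eventually.of_forall fun y => ?_)
  · have := (measurable_logKernel hV).of_uncurry_left (x := x)
    fun_prop
  · rw [Complex.norm_real, Real.norm_eq_abs]
    exact (abs_logKernel_le hC hv x y).trans (Real.le_norm_self _)

/-- The section of the kernel at `x` has `L²` norm `O(weight x)`, which is square integrable, so the
operator is Hilbert–Schmidt. Symmetry is Fubini's theorem for a real symmetric kernel. -/
theorem exists_vGv {V : Plane → ℝ} (hV : Measurable V) {C ε : ℝ} (hε : 0 < ε) (hC : 0 ≤ C)
    (hv : ∀ z, (1 + ‖z‖) ^ 2 * vfun V z ≤ C * weight ε z) :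
    ∃ S : L2 →L[ℂ] L2, IsCompactOperator S ∧
      (∀ f : L2, (S f : Plane → ℂ) =ᵐ[volume] fun x => ∫ y, f y * (logKernel V x y : ℂ)) ∧
      ∀ f g, inner ℂ (S f) g = inner ℂ f (S g) := by
  obtain ⟨C₁, hC₁0, hC₁⟩ := exists_envelope_bound hε
  have hmem := memLp_logKernel hV hε hC hv
  have hmeas : Measurable (Function.uncurry fun x y => (logKernel V x y : ℂ)) := by
    have := measurable_logKernel hV
    exact Complex.measurable_ofReal.comp this
  set k : Plane → L2 := fun x => toL2 fun y => (logKernel V x y : ℂ) with hk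
  have hkm : StronglyMeasurable k := stronglyMeasurable_toL2 hmeas hmem
  have hkb : ∀ x, ‖k x‖ ≤ (C ^ 2 * C₁) * weight ε x := by
    intro x
    have h1 : ‖k x‖ ≤ (C ^ 2 * weight ε x) * (eLpNorm (envelope ε x) 2 volume).toReal := by
      refine norm_toL2_le (by have := weight_pos ε x; positivity) (hC₁ x).1 (Eventually.of_forall fun y => ?_)
      rw [Complex.norm_real, Real.norm_eq_abs]
      refine (abs_logKernel_le hC hv x y).trans ?_
      have := weight_pos ε x
      gcongr
      exact Real.le_norm_self _
    refine h1.trans ?_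
    have h2 : (√(1 + ‖x‖))⁻¹ ≤ 1 := inv_le_one_of_one_le₀ (Real.one_le_sqrt.2 (by simp))
    have h3 : (eLpNorm (envelope ε x) 2 volume).toReal ≤ C₁ :=
      (hC₁ x).2.trans (mul_le_of_le_one_right hC₁0 h2)
    have := weight_pos ε x
    calc _ ≤ (C ^ 2 * weight ε x) * C₁ := by gcongr
      _ = _ := by ring
  have hΦm : MemLp (fun x => innerSL ℂ (k x)) 2 (volume : Measure Plane) := by
    refine ((memLp_weight hε).const_mul (C ^ 2 * C₁)).mono
      ((innerSL ℂ).continuous.comp_stronglyMeasurable hkm).aestronglyMeasurable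
      (Eventually.of_forall fun x => ?_)
    rw [innerSL_apply_norm]
    exact (hkb x).trans (Real.le_norm_self _)
  have hS : ∀ f : L2, (hsOp (hΦm.toLp _) f : Plane → ℂ) =ᵐ[volume]
      fun x => ∫ y, f y * (logKernel V x y : ℂ) := by
    intro f
    filter_upwards [coeFn_hsOp (hΦm.toLp _) f, hΦm.coeFn_toLp] with x h1 h2
    rw [h1, h2, innerSL_apply_apply, hk, inner_toL2_left (hmem x)]
    simp only [Complex.conj_ofReal]
  have hfk : ∀ (f : L2) x, Integrable fun y => f y * (logKernel V x y : ℂ) := by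
    intro f x
    have := integrable_mul_conj (hmem x) (Lp.memLp f)
    simpa only [Complex.conj_ofReal] using this
  -- Cauchy–Schwarz, applied to the classes of the absolute values; it gives the absolute
  -- integrability that Fubini's theorem needs.
  have hnfk : ∀ (f : L2) x, ∫ y, ‖f y * (logKernel V x y : ℂ)‖ ≤ ‖f‖ * ((C ^ 2 * C₁) * weight ε x) := by
    intro f x
    have hn : MemLp (fun y => ((‖f y‖ : ℝ) : ℂ)) 2 (volume : Measure Plane) :=
      (Lp.memLp f).norm.ofReal
    have hn2 : MemLp (fun y => ((|logKernel V x y| : ℝ) : ℂ)) 2 (volume : Measure Plane) := by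
      have := (hmem x).norm.ofReal (K := ℂ)
      simpa using this
    have h1 : inner ℂ (toL2 fun y => ((|logKernel V x y| : ℝ) : ℂ)) (toL2 fun y => ((‖f y‖ : ℝ) : ℂ))
        = ((∫ y, ‖f y * (logKernel V x y : ℂ)‖ : ℝ) : ℂ) := by
      rw [inner_toL2_left hn2, ← integral_complex_ofReal]
      refine integral_congr_ae ?_
      filter_upwards [coeFn_toL2 hn] with y hy
      rw [hy, Complex.conj_ofReal, norm_mul, Complex.norm_real, Real.norm_eq_abs]
      push_cast
      ring
    have h2 := norm_inner_le_norm (𝕜 := ℂ) (toL2 fun y => ((|logKernel V x y| : ℝ) : ℂ))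
      (toL2 fun y => ((‖f y‖ : ℝ) : ℂ))
    rw [h1, Complex.norm_real, Real.norm_of_nonneg (integral_nonneg fun y => norm_nonneg _)] at h2
    have h3 : ‖toL2 fun y => ((‖f y‖ : ℝ) : ℂ)‖ = ‖f‖ := by
      rw [norm_toL2 hn, Lp.norm_def]
      congr 1
      exact eLpNorm_congr_norm_ae (Eventually.of_forall fun y => by simp)
    have h4 : ‖toL2 fun y => ((|logKernel V x y| : ℝ) : ℂ)‖ = ‖k x‖ := by
      rw [norm_toL2 hn2, hk, norm_toL2 (hmem x)]
      congr 1
      exact eLpNorm_congr_norm_ae (Eventually.of_forall fun y => by simp)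
    rw [h3, h4] at h2
    refine h2.trans ?_
    rw [mul_comm]
    gcongr
    exact hkb x
  refine ⟨hsOp (hΦm.toLp _), isCompactOperator_hsOp _, hS, fun f g => ?_⟩
  set S := hsOp (hΦm.toLp _)
  have e1 : inner ℂ (S f) g = ∫ x, ∫ y, g x * ((starRingEnd ℂ) (f y) * (logKernel V x y : ℂ)) := by
    rw [L2.inner_def]
    refine integral_congr_ae ?_
    filter_upwards [hS f] with x hx
    rw [RCLike.inner_apply, hx, ← integral_conj, ← integral_const_mul]
    simp only [map_mul, Complex.conj_ofReal]
  have e2 : inner ℂ f (S g) = ∫ x, ∫ y, g y * ((starRingEnd ℂ) (f x) * (logKernel V y x : ℂ)) := by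
    rw [L2.inner_def]
    refine integral_congr_ae ?_
    filter_upwards [hS g] with x hx
    rw [RCLike.inner_apply, hx, ← integral_mul_const]
    refine integral_congr_ae (Eventually.of_forall fun y => ?_)
    simp only
    rw [logKernel_comm V y x]
    ring
  rw [e1, e2]
  refine integral_integral_swap ?_
  have hm : AEStronglyMeasurable (Function.uncurry fun x y =>
      g x * ((starRingEnd ℂ) (f y) * (logKernel V x y : ℂ))) ((volume : Measure Plane).prod volume) := by
    have hf := (Lp.stronglyMeasurable f).measurable
    have hg := (Lp.stronglyMeasurable g).measurable
    refine Measurable.aestronglyMeasurable ?_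
    exact (hg.comp measurable_fst).mul
      ((Complex.continuous_conj.measurable.comp (hf.comp measurable_snd)).mul hmeas)
  rw [integrable_prod_iff hm]
  have hnorm : ∀ x y, ‖g x * ((starRingEnd ℂ) (f y) * (logKernel V x y : ℂ))‖
      = ‖g x‖ * ‖f y * (logKernel V x y : ℂ)‖ := by
    intro x y
    rw [norm_mul, norm_mul, norm_mul, RCLike.norm_conj]
  constructor
  · refine Eventually.of_forall fun x => ?_
    have h5 := (hfk f x).norm.const_mul ‖g x‖
    refine h5.mono (Measurable.aestronglyMeasurable ?_) (Eventually.of_forall fun y => ?_)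
    · have hf := (Lp.stronglyMeasurable f).measurable
      have := hmeas.of_uncurry_left (x := x)
      exact ((Complex.continuous_conj.measurable.comp hf).mul this).const_mul (g x)
    · simp only [Function.uncurry]
      rw [hnorm]
      exact Real.le_norm_self _
  · simp only [Function.uncurry, hnorm, integral_const_mul]
    have h6 : Integrable fun x => ‖g x‖ * (‖f‖ * ((C ^ 2 * C₁) * weight ε x)) := by
      have := MemLp.integrable_mul (Lp.memLp g).norm (memLp_weight hε)
      refine (this.const_mul (‖f‖ * (C ^ 2 * C₁))).congr (Eventually.of_forall fun x => ?_)
      simp only [Pi.mul_apply]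
      ring
    refine h6.mono ?_ (Eventually.of_forall fun x => ?_)
    · refine (Lp.stronglyMeasurable g).norm.aestronglyMeasurable.mul ?_
      have hf := (Lp.stronglyMeasurable f).measurable
      exact (StronglyMeasurable.integral_prod_right' (f := fun p : Plane × Plane =>
        ‖f p.2 * (logKernel V p.1 p.2 : ℂ)‖)
        (((hf.comp measurable_snd).mul hmeas).norm.stronglyMeasurable)).aestronglyMeasurable
    · rw [Real.norm_of_nonneg (mul_nonneg (norm_nonneg _) (integral_nonneg fun y => norm_nonneg _))]
      refine le_trans ?_ (Real.le_norm_self _)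
      gcongr
      exact hnfk f x

theorem norm_Ufun (V : Plane → ℝ) (z : Plane) : ‖(Ufun V z : ℂ)‖ = 1 := by
  rw [Complex.norm_real, Ufun]; split_ifs <;> simp

theorem memLp_Ufun_mul {V : Plane → ℝ} (hV : Measurable V) {f : Plane → ℂ}
    (hf : MemLp f 2 (volume : Measure Plane)) :
    MemLp (fun z => (Ufun V z : ℂ) * f z) 2 (volume : Measure Plane) := by
  have hU : Measurable (Ufun V) := by
    unfold Ufun; exact Measurable.ite (hV measurableSet_Ici) measurable_const measurable_const
  refine hf.mono ((Complex.measurable_ofReal.comp hU).aestronglyMeasurable.mul hf.1)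
    (Eventually.of_forall fun z => ?_)
  rw [norm_mul, norm_Ufun, one_mul]

/-- Multiplication by the sign `U` is a symmetric involution of `L²`. -/
theorem exists_mul_Ufun {V : Plane → ℝ} (hV : Measurable V) :
    ∃ M : L2 →L[ℂ] L2, (∀ f : L2, (M f : Plane → ℂ) =ᵐ[volume] fun z => (Ufun V z : ℂ) * f z) ∧
      (M ∘L M = 1) ∧ ∀ f g, inner ℂ (M f) g = inner ℂ f (M g) := by
  have hm := fun f : L2 => memLp_Ufun_mul hV (Lp.memLp f)
  let L : L2 →ₗ[ℂ] L2 :=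
    { toFun := fun f => toL2 fun z => (Ufun V z : ℂ) * f z
      map_add' := fun f g => by
        rw [← toL2_add (hm f) (hm g)]
        refine toL2_congr ?_
        filter_upwards [Lp.coeFn_add f g] with z hz
        rw [hz, Pi.add_apply, mul_add]
      map_smul' := fun c f => by
        rw [RingHom.id_apply, ← toL2_const_mul (hm f)]
        refine toL2_congr ?_
        filter_upwards [Lp.coeFn_smul c f] with z hz
        rw [hz, Pi.smul_apply, smul_eq_mul]
        ring }
  have hL : ∀ f : L2, (L f : Plane → ℂ) =ᵐ[volume] fun z => (Ufun V z : ℂ) * f z := fun f =>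
    coeFn_toL2 (hm f)
  have hUU : ∀ z, (Ufun V z : ℂ) * (Ufun V z : ℂ) = 1 := by
    intro z; rw [Ufun]; split_ifs <;> simp
  refine ⟨L.mkContinuous 1 fun f => ?_, hL, ?_, fun f g => ?_⟩
  · rw [one_mul, show L f = toL2 fun z => (Ufun V z : ℂ) * f z from rfl, norm_toL2 (hm f), Lp.norm_def]
    refine le_of_eq ?_
    congr 1
    exact eLpNorm_congr_norm_ae (Eventually.of_forall fun z => by rw [norm_mul, norm_Ufun, one_mul])
  · ext1 f
    refine Lp.ext ?_
    show (L (L f) : Plane → ℂ) =ᵐ[volume] f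
    filter_upwards [hL (L f), hL f] with z h1 h2
    rw [h1, h2, ← mul_assoc, hUU, one_mul]
  · rw [L2.inner_def, L2.inner_def]
    refine integral_congr_ae ?_
    simp only [LinearMap.mkContinuous_apply]
    filter_upwards [hL f, hL g] with z h1 h2
    rw [RCLike.inner_apply, RCLike.inner_apply, h1, h2, map_mul, Complex.conj_ofReal]
    ring

/-- The spanning set has at most one element, so the projection `P` exists and is compact. -/
instance (V : Plane → ℝ) : FiniteDimensional ℂ
    (Submodule.span ℂ {f : L2 | (f : Plane → ℂ) =ᵐ[volume] fun x => (vfun V x : ℂ)}) := by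
  refine FiniteDimensional.span_of_finite ℂ (Set.Subsingleton.finite fun f hf g hg => ?_)
  exact Lp.ext (Filter.EventuallyEq.trans hf (Filter.EventuallyEq.symm hg))

theorem exists_isUvGv {V : Plane → ℝ} (hV : Measurable V) {C ε : ℝ} (hε : 0 < ε) (hC : 0 ≤ C)
    (hv : ∀ z, (1 + ‖z‖) ^ 2 * vfun V z ≤ C * weight ε z) :
    ∃ T : L2 →L[ℂ] L2, IsUvGv V T ∧ IsUnit (QTQ V T + S1 V T) := by
  obtain ⟨S, hSc, hS, hSs⟩ := exists_vGv hV hε hC hv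
  obtain ⟨M, hM, hMM, hMs⟩ := exists_mul_Ufun hV
  refine ⟨M + S, fun f => ?_, ?_⟩
  · filter_upwards [Lp.coeFn_add (M f) (S f), hM f, hS f] with x h1 h2 h3
    rw [add_apply, h1, Pi.add_apply, h2, h3, G0, ← mul_assoc, ← integral_const_mul]
    congr 1
    refine integral_congr_ae (Eventually.of_forall fun y => ?_)
    simp only [logKernel]
    push_cast
    ring
  · set N := Submodule.span ℂ {f : L2 | (f : Plane → ℂ) =ᵐ[volume] fun x => (vfun V x : ℂ)} with hN
    have hPc : IsCompactOperator N.starProjection :=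
      (isCompactOperator_of_locallyCompactSpace_dom N.orthogonalProjectionOnto).clm_comp N.subtypeL
    have hproj : (QL2 V).subtypeL ∘L (QL2 V).orthogonalProjectionOnto = 1 - N.starProjection :=
      Submodule.starProjection_orthogonal' N
    set p := (QL2 V).orthogonalProjectionOnto with hp
    set i := (QL2 V).subtypeL with hi
    -- With `i p = 1 - P` and `M² = 1`, one gets `(p M i)(p (M+S) i) = 1 + p (M S - M P (M+S)) i`,
    -- and `S` and `P` are compact.
    refine isUnit_add_ker_starProjection (R := p ∘L M ∘L i)
      (K := p ∘L (M ∘L S - (M ∘L N.starProjection) ∘L (M + S)) ∘L i) ?_ ?_ ?_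
    · intro a b
      have hT : ∀ f g, inner ℂ ((M + S) f) g = inner ℂ f ((M + S) g) := fun f g => by
        simp only [add_apply, inner_add_left, inner_add_right, hMs, hSs]
      calc inner ℂ (QTQ V (M + S) a) b = inner ℂ ((M + S) (a : L2)) (b : L2) :=
            Submodule.inner_orthogonalProjectionOnto_eq_of_mem_right b ((M + S) (a : L2))
        _ = inner ℂ (a : L2) ((M + S) (b : L2)) := hT _ _
        _ = _ := (Submodule.inner_orthogonalProjectionOnto_eq_of_mem_left a ((M + S) (b : L2))).symm
    · ext1 q
      have h1 : ∀ f : L2, i (p f) = f - N.starProjection f := fun f => by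
        have := congrArg (fun L : L2 →L[ℂ] L2 => L f) hproj
        simpa using this
      have h2 : ∀ f : L2, M (M f) = f := fun f => by
        have := congrArg (fun L : L2 →L[ℂ] L2 => L f) hMM
        simpa using this
      have h3 : p (i q) = q := Submodule.orthogonalProjectionOnto_mem_subspace_eq_self q
      simp only [QTQ, ContinuousLinearMap.comp_apply, add_apply, sub_apply, one_apply_eq_self]
      rw [← hp, ← hi, h1]
      simp only [map_add, map_sub, h2, h3]
      abel
    · have h1 : IsCompactOperator (M ∘L S) := hSc.clm_comp M
      have h2 : IsCompactOperator ((M ∘L N.starProjection) ∘L (M + S)) :=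
        (hPc.clm_comp M).comp_clm (M + S)
      exact ((h1.sub h2).comp_clm i).clm_comp p

/-! ### Subtracted amplitudes -/

/-- The derivative `b (k+1) t / t` is at most `M (t^(-1/2) + κ/t)`; the right-hand side is the
increment of a primitive of this bound. -/
theorem IsSymbol.norm_sub_le_of_le {b : ℕ → ℝ → ℂ} {M κ : ℝ} (hb : IsSymbol b M κ) {k : ℕ}
    (hk : k < 3) {s t : ℝ} (hs : 0 < s) (hst : s ≤ t) :
    ‖b k t - b k s‖ ≤ M * (2 * √t + κ * Real.log t) - M * (2 * √s + κ * Real.log s) := by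
  have hpos : ∀ x ∈ Set.Icc s t, 0 < x := fun x hx => hs.trans_le hx.1
  have hB : ∀ x, 0 < x → HasDerivAt (fun x => M * (2 * √x + κ * Real.log x)
      - M * (2 * √s + κ * Real.log s)) (M * ((√x)⁻¹ + κ * x⁻¹)) x := by
    intro x hx
    have h1 := (((Real.hasDerivAt_sqrt hx.ne').const_mul 2).add
      ((Real.hasDerivAt_log hx.ne').const_mul κ)).const_mul M
    refine (h1.sub_const _).congr_deriv ?_
    congr 2
    field_simp
  refine image_norm_le_of_norm_deriv_right_le_deriv_boundary' (f := fun x => b k x - b k s)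
    (f' := fun x => b (k + 1) x / x) (a := s) (b := t)
    (B' := fun x => M * ((√x)⁻¹ + κ * x⁻¹))
    (fun x hx => ((hb.hasDerivAt k hk x (hpos x hx)).sub_const _).continuousAt.continuousWithinAt)
    (fun x hx => ((hb.hasDerivAt k hk x (hpos x ⟨hx.1, hx.2.le⟩)).sub_const _).hasDerivWithinAt)
    (by simp)
    (fun x hx => (hB x (hpos x hx)).continuousAt.continuousWithinAt)
    (fun x hx => (hB x (hpos x ⟨hx.1, hx.2.le⟩)).hasDerivWithinAt)
    (fun x hx => ?_) ⟨hst, le_rfl⟩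
  have hx0 := hpos x ⟨hx.1, hx.2.le⟩
  rw [norm_div, Complex.norm_real, Real.norm_of_nonneg hx0.le, div_le_iff₀ hx0]
  refine (hb.bound_succ k hk x hx0).trans (le_of_eq ?_)
  have h2 : (√x)⁻¹ * x = √x := by
    have h3 : 0 < √x := Real.sqrt_pos.2 hx0
    rw [inv_mul_eq_iff_eq_mul₀ h3.ne', Real.mul_self_sqrt hx0.le]
  rw [mul_assoc, add_mul, h2, mul_assoc, inv_mul_cancel₀ hx0.ne', mul_one]

theorem abs_sqrt_sub_sqrt_le {r X : ℝ} (hr : 0 < r) (hX : 0 < X) :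
    |√r - √X| ≤ |r - X| * (√X)⁻¹ := by
  have h1 : 0 < √r := Real.sqrt_pos.2 hr
  have h2 : 0 < √X := Real.sqrt_pos.2 hX
  rw [← div_eq_mul_inv, le_div_iff₀ h2]
  have h3 : r - X = (√r - √X) * (√r + √X) := by
    nlinarith [Real.mul_self_sqrt hr.le, Real.mul_self_sqrt hX.le]
  rw [h3, abs_mul, abs_of_pos (by positivity : 0 < √r + √X)]
  gcongr
  linarith

theorem abs_log_sub_log_le {r X : ℝ} (hr : 0 < r) (hX : 1 ≤ X) :
    |Real.log r - Real.log X| ≤ 2 * (|r - X| * (√r)⁻¹) := by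
  have hX0 : 0 < X := by linarith
  have h1 : 0 < √r := Real.sqrt_pos.2 hr
  have h2 : 0 < √X := Real.sqrt_pos.2 hX0
  have h2' : 1 ≤ √X := Real.one_le_sqrt.2 hX
  have e1 : Real.log r - Real.log X = 2 * Real.log (√r / √X) := by
    rw [Real.log_div h1.ne' h2.ne', Real.log_sqrt hr.le, Real.log_sqrt hX0.le]; ring
  have hsq1 := Real.mul_self_sqrt hr.le
  have hsq2 := Real.mul_self_sqrt hX0.le
  rw [e1, abs_mul, abs_two]
  refine mul_le_mul_of_nonneg_left ?_ zero_le_two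
  rw [← div_eq_mul_inv, le_div_iff₀ h1]
  rcases le_total X r with h | h
  · have hle : √X ≤ √r := Real.sqrt_le_sqrt h
    have h3 := Real.log_le_sub_one_of_pos (div_pos h1 h2)
    rw [abs_of_nonneg (Real.log_nonneg ((one_le_div h2).2 hle)), abs_of_nonneg (by linarith)]
    have h4 : Real.log (√r / √X) * √r ≤ (√r / √X - 1) * √r := by gcongr
    have h5 : (√r / √X - 1) * √r = (√r - √X) * √r / √X := by field_simp
    have h6 : (√r - √X) * √r / √X ≤ (√r - √X) * √r :=
      div_le_self (mul_nonneg (by linarith) h1.le) h2'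
    nlinarith
  · have hle : √r ≤ √X := Real.sqrt_le_sqrt h
    have h3 := Real.log_le_sub_one_of_pos (div_pos h2 h1)
    have h7 : Real.log (√r / √X) = -Real.log (√X / √r) := by
      rw [← Real.log_inv, inv_div]
    rw [h7, abs_neg, abs_of_nonneg (Real.log_nonneg ((one_le_div h1).2 hle)), abs_of_nonpos (by linarith)]
    have h4 : Real.log (√X / √r) * √r ≤ (√X / √r - 1) * √r := by gcongr
    have h5 : (√X / √r - 1) * √r = √X - √r := by field_simp
    nlinarith

/-- Increments of `√t` scale by `√l`, whereas increments of `log t` do not see the dilation. Hence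
only the logarithmic term, carried by `κ`, fails to gain a power of `l`. -/
theorem IsSymbol.norm_sub_le {b : ℕ → ℝ → ℂ} {M κ : ℝ} (hM : 0 ≤ M) (hκ : 0 ≤ κ)
    (hb : IsSymbol b M κ) {k : ℕ} (hk : k < 3) {l r X Z : ℝ} (hl : 0 < l) (hr : 0 < r)
    (hX : 1 ≤ X) (hZ : |r - X| ≤ Z) :
    ‖b k (l * r) - b k (l * X)‖ ≤ 2 * M * Z * (√l * (√X)⁻¹ + κ * (√r)⁻¹) := by
  have hX0 : 0 < X := by linarith
  have hmain : ∀ {p q : ℝ}, 0 < p → 0 < q → p ≤ q → ‖b k (l * q) - b k (l * p)‖ ≤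
      M * (2 * √l * |√q - √p| + κ * |Real.log q - Real.log p|) := by
    intro p q hp hq hpq
    refine (hb.norm_sub_le_of_le hk (mul_pos hl hp) (by gcongr)).trans ?_
    rw [← mul_sub]
    refine mul_le_mul_of_nonneg_left ?_ hM
    rw [Real.sqrt_mul hl.le, Real.sqrt_mul hl.le, Real.log_mul hl.ne' hq.ne',
      Real.log_mul hl.ne' hp.ne']
    have h1 := mul_le_mul_of_nonneg_left (le_abs_self (√q - √p)) (by positivity : 0 ≤ 2 * √l)
    have h2 := mul_le_mul_of_nonneg_left (le_abs_self (Real.log q - Real.log p)) hκ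
    linarith
  have hboth : ‖b k (l * r) - b k (l * X)‖ ≤
      M * (2 * √l * |√r - √X| + κ * |Real.log r - Real.log X|) := by
    rcases le_total X r with h | h
    · exact hmain hX0 hr h
    · rw [norm_sub_rev, abs_sub_comm (√r), abs_sub_comm (Real.log r)]
      exact hmain hr hX0 h
  have h1 := abs_sqrt_sub_sqrt_le hr hX0
  have h2 := abs_log_sub_log_le hr hX
  calc _ ≤ M * (2 * √l * (Z * (√X)⁻¹) + κ * (2 * (Z * (√r)⁻¹))) := by
        refine hboth.trans ?_
        gcongr
        · exact h1.trans (by gcongr)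
        · exact h2.trans (by gcongr)
    _ = _ := by ring

/-- The Euler derivatives in `l` of `e^{j l (r - X)} b(l r) - b(l X)`. -/
noncomputable def subAmp (j : ℂ) (b : ℕ → ℝ → ℂ) (r X : ℝ) : ℕ → ℝ → ℂ
  | 0, l => Complex.exp (j * (r - X) * l) * b 0 (l * r) - b 0 (l * X)
  | 1, l => Complex.exp (j * (r - X) * l) * (b 1 (l * r) + j * (r - X) * l * b 0 (l * r)) - b 1 (l * X)
  | _ + 2, l => Complex.exp (j * (r - X) * l) * (b 2 (l * r) + 2 * (j * (r - X) * l) * b 1 (l * r)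
      + (j * (r - X) * l + (j * (r - X) * l) ^ 2) * b 0 (l * r)) - b 2 (l * X)

theorem hasDerivAt_subAmp {j : ℂ} {b : ℕ → ℝ → ℂ} {M κ : ℝ} (hb : IsSymbol b M κ) {r X l : ℝ}
    (hr : 0 < r) (hX : 0 < X) (hl : 0 < l) {k : ℕ} (hk : k < 2) :
    HasDerivAt (subAmp j b r X k) (subAmp j b r X (k + 1) l / l) l := by
  have hlc : (l : ℂ) ≠ 0 := by exact_mod_cast hl.ne'
  have hid : HasDerivAt (fun l : ℝ => (l : ℂ)) 1 l := (hasDerivAt_id l).ofReal_comp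
  have hlin : HasDerivAt (fun l : ℝ => j * (r - X) * (l : ℂ)) (j * (r - X) * 1) l := hid.const_mul _
  have hE := hlin.cexp
  have hcomp : ∀ {c : ℝ} {k : ℕ}, 0 < c → k < 3 →
      HasDerivAt (fun l : ℝ => b k (l * c)) (b (k + 1) (l * c) / l) l := by
    intro c k hc hk
    have h1 : HasDerivAt (fun l : ℝ => l * c) c l := by simpa using (hasDerivAt_id l).mul_const c
    have h2 := HasDerivAt.scomp l (hb.hasDerivAt k hk (l * c) (mul_pos hl hc)) h1
    refine h2.congr_deriv ?_
    have hcc : (c : ℂ) ≠ 0 := by exact_mod_cast hc.ne'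
    rw [Complex.real_smul]
    push_cast
    field_simp
  match k with
  | 0 =>
    refine ((hE.mul (hcomp hr (by norm_num))).sub (hcomp hX (by norm_num))).congr_deriv ?_
    rw [subAmp]
    field_simp
    ring
  | 1 =>
    refine ((hE.mul ((hcomp hr (by norm_num)).add (hlin.mul (hcomp hr (by norm_num))))).sub
      (hcomp hX (by norm_num))).congr_deriv ?_
    simp only [subAmp, Pi.add_apply, Pi.mul_apply]
    field_simp
    ring
  | k + 2 => omega

/-- Both `e^{j l (r-X)} - 1` and each Euler derivative of this exponential supply a factor `l|r-X| ≤
l Z`, which beats the size `(l r)^(-1/2)` of `b`; the remaining difference `b(l r) - b(l X)` is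
controlled by `IsSymbol.norm_sub_le`. The case of two derivatives sets the exponent of `Z` and the
constant `6 + L = 3 + 2 + 1 + L`. -/
theorem norm_subAmp_le {j : ℂ} (hj : j = Complex.I ∨ j = -Complex.I) {b : ℕ → ℝ → ℂ} {M κ : ℝ}
    (hM : 0 ≤ M) (hκ : 0 ≤ κ) (hb : IsSymbol b M κ) {r X l L Z : ℝ} (hr : 0 < r) (hX : 1 ≤ X)
    (hl : 0 < l) (hlL : l ≤ L) (hZ1 : 1 ≤ Z) (hZ : |r - X| ≤ Z) {k : ℕ} (hk : k < 3) :
    ‖subAmp j b r X k l‖ ≤ M * (6 + L) * (κ + √l) * (Z ^ 2 * ((√X)⁻¹ + (√r)⁻¹)) := by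
  set E := Complex.exp (j * (r - X) * l) with hE
  set n : ℂ := j * (r - X) * l with hn
  have hnI : n = Complex.I * ((l * (r - X) : ℝ) : ℂ) ∨ n = Complex.I * ((-(l * (r - X)) : ℝ) : ℂ) := by
    rcases hj with rfl | rfl
    · left; rw [hn]; push_cast; ring
    · right; rw [hn]; push_cast; ring
  have hnn : ‖n‖ ≤ l * Z := by
    have : ‖n‖ = l * |r - X| := by
      rcases hnI with h | h <;>
        rw [h, norm_mul, Complex.norm_I, one_mul, Complex.norm_real, Real.norm_eq_abs] <;>
        simp only [abs_neg, abs_mul, abs_of_pos hl]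
    rw [this]; gcongr
  have hE1 : ‖E‖ = 1 := by
    rw [hE]
    rcases hnI with h | h <;> rw [h] <;> exact Complex.norm_exp_I_mul_ofReal _
  have hEs : ‖E - 1‖ ≤ l * Z := by
    have h0 : ‖E - 1‖ ≤ ‖n‖ := by
      rw [hE]
      have hx : ∀ y : ℝ, ‖Complex.exp (Complex.I * y) - 1‖ ≤ ‖Complex.I * (y : ℂ)‖ := by
        intro y
        rw [norm_mul, Complex.norm_I, one_mul, Complex.norm_real]
        exact Real.norm_exp_I_mul_ofReal_sub_one_le
      rcases hnI with h | h <;> rw [h] <;> exact hx _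
    exact h0.trans hnn
  have hsl : 0 < √l := Real.sqrt_pos.2 hl
  have hsr : 0 < (√r)⁻¹ := inv_pos.2 (Real.sqrt_pos.2 hr)
  have hsX : 0 < (√X)⁻¹ := inv_pos.2 (Real.sqrt_pos.2 (by linarith))
  have hbk : ∀ {i : ℕ}, i < 3 → l * ‖b i (l * r)‖ ≤ M * (√l * (√r)⁻¹) := by
    intro i hi
    have h1 := hb.bound i hi (l * r) (mul_pos hl hr)
    rw [Real.sqrt_mul hl.le, mul_inv] at h1
    have h2 : l * (√l)⁻¹ = √l := by
      rw [← div_eq_mul_inv, div_eq_iff hsl.ne', Real.mul_self_sqrt hl.le]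
    calc l * ‖b i (l * r)‖ ≤ l * (M * ((√l)⁻¹ * (√r)⁻¹)) := by gcongr
      _ = M * ((l * (√l)⁻¹) * (√r)⁻¹) := by ring
      _ = _ := by rw [h2]
  set S := (κ + √l) * (Z ^ 2 * ((√X)⁻¹ + (√r)⁻¹)) with hS
  have hZ0 : 0 ≤ Z := by linarith
  have hZZ : Z ≤ Z ^ 2 := by nlinarith
  have hA : √l * (√r)⁻¹ * Z ^ 2 ≤ S := by
    have h3 : √l * (√r)⁻¹ ≤ (κ + √l) * ((√X)⁻¹ + (√r)⁻¹) := by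
      apply mul_le_mul <;> linarith
    have h4 := mul_le_mul_of_nonneg_right h3 (sq_nonneg Z)
    rw [hS]; linarith
  have hA1 : √l * (√r)⁻¹ * Z ≤ S := le_trans (by gcongr) hA
  have hn1 : ∀ {i : ℕ}, i < 3 → ‖n * b i (l * r)‖ ≤ M * S := by
    intro i hi
    rw [norm_mul]
    calc ‖n‖ * ‖b i (l * r)‖ ≤ l * Z * ‖b i (l * r)‖ := by gcongr
      _ = (l * ‖b i (l * r)‖) * Z := by ring
      _ ≤ (M * (√l * (√r)⁻¹)) * Z := mul_le_mul_of_nonneg_right (hbk hi) hZ0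
      _ = M * (√l * (√r)⁻¹ * Z) := by ring
      _ ≤ _ := by gcongr
  have hd : ∀ {i : ℕ}, i < 3 → ‖E * b i (l * r) - b i (l * X)‖ ≤ M * S + 2 * M * S := by
    intro i hi
    have e1 : E * b i (l * r) - b i (l * X) = (E - 1) * b i (l * r) + (b i (l * r) - b i (l * X)) := by ring
    rw [e1]
    refine (norm_add_le _ _).trans (add_le_add ?_ ?_)
    · rw [norm_mul]
      calc ‖E - 1‖ * ‖b i (l * r)‖ ≤ l * Z * ‖b i (l * r)‖ := by gcongr
        _ = (l * ‖b i (l * r)‖) * Z := by ring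
        _ ≤ (M * (√l * (√r)⁻¹)) * Z := mul_le_mul_of_nonneg_right (hbk hi) hZ0
        _ = M * (√l * (√r)⁻¹ * Z) := by ring
        _ ≤ _ := by gcongr
    · refine (hb.norm_sub_le hM hκ hi hl hr hX hZ).trans ?_
      have h5 : √l * (√X)⁻¹ + κ * (√r)⁻¹ ≤ (κ + √l) * ((√X)⁻¹ + (√r)⁻¹) := by
        have := mul_nonneg hκ hsX.le
        have := mul_nonneg hsl.le hsr.le
        linarith
      calc 2 * M * Z * (√l * (√X)⁻¹ + κ * (√r)⁻¹)
          ≤ 2 * M * Z ^ 2 * ((κ + √l) * ((√X)⁻¹ + (√r)⁻¹)) := by gcongr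
        _ = _ := by rw [hS]; ring
  have hL : 0 ≤ L := by linarith
  -- Of the two factors `l` one is used as in the linear terms, the other is bounded by `L`.
  have hn2 : ‖n ^ 2 * b 0 (l * r)‖ ≤ L * (M * S) := by
    rw [norm_mul, norm_pow]
    calc ‖n‖ ^ 2 * ‖b 0 (l * r)‖ ≤ (l * Z) ^ 2 * ‖b 0 (l * r)‖ := by gcongr
      _ = l * ((l * ‖b 0 (l * r)‖) * Z ^ 2) := by ring
      _ ≤ L * ((M * (√l * (√r)⁻¹)) * Z ^ 2) :=
        mul_le_mul hlL (mul_le_mul_of_nonneg_right (hbk (i := 0) (by norm_num)) (sq_nonneg Z))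
          (by positivity) (by linarith)
      _ = L * (M * (√l * (√r)⁻¹ * Z ^ 2)) := by ring
      _ ≤ _ := by gcongr
  have hS0 : 0 ≤ M * S := by positivity
  have hgoal : M * (6 + L) * (κ + √l) * (Z ^ 2 * ((√X)⁻¹ + (√r)⁻¹)) = (6 + L) * (M * S) := by
    rw [hS]; ring
  rw [hgoal]
  have hLS : 0 ≤ L * (M * S) := by positivity
  match k with
  | 0 =>
    have := hd (i := 0) (by norm_num)
    rw [subAmp]
    linarith
  | 1 =>
    have h1 := hd (i := 1) (by norm_num)
    have h2 := hn1 (i := 0) (by norm_num)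
    have e1 : subAmp j b r X 1 l = (E * b 1 (l * r) - b 1 (l * X)) + E * (n * b 0 (l * r)) := by
      rw [subAmp]; ring
    rw [e1]
    refine (norm_add_le _ _).trans ?_
    rw [norm_mul, hE1]
    linarith
  | k + 2 =>
    have h1 := hd (i := 2) (by norm_num)
    have h2 := hn1 (i := 0) (by norm_num)
    have h3 := hn1 (i := 1) (by norm_num)
    have e1 : subAmp j b r X (k + 2) l = (E * b 2 (l * r) - b 2 (l * X)) + E * (n * b 1 (l * r))
        + E * (n * b 1 (l * r)) + E * (n * b 0 (l * r)) + E * (n ^ 2 * b 0 (l * r)) := by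
      rw [subAmp]; ring
    rw [e1]
    refine (norm_add_le _ _).trans ((add_le_add (norm_add_le _ _) le_rfl).trans
      ((add_le_add (add_le_add (norm_add_le _ _) le_rfl) le_rfl).trans
      ((add_le_add (add_le_add (add_le_add (norm_add_le _ _) le_rfl) le_rfl) le_rfl).trans ?_)))
    simp only [norm_mul E, hE1, one_mul]
    linarith

/-! ### Symbols with values in `L²` -/

/-- A family `F 0, F 1, F 2` of `L²`-valued functions on the half line, each the Euler derivative
of the preceding one, of size `N (κ + √l)` on `(0, L]`. -/
structure IsL2Symbol (F : ℕ → ℝ → L2) (N κ L : ℝ) : Prop where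
  hasDerivAt : ∀ k < 2, ∀ l, 0 < l → HasDerivAt (F k) (l⁻¹ • F (k + 1) l) l
  bound : ∀ k < 3, ∀ l, 0 < l → l ≤ L → ‖F k l‖ ≤ N * (κ + √l)

/-- The class in `L²` of `v(z)` times a subtracted amplitude at distance `|x - z|`. -/
noncomputable def ampL2 (V : Plane → ℝ) (j : ℂ) (b : ℕ → ℝ → ℂ) (x : Plane) (k : ℕ) (l : ℝ) : L2 :=
  toL2 fun z => (vfun V z : ℂ) * subAmp j b ‖x - z‖ (1 + ‖x‖) k l

theorem ae_norm_sub_pos (x : Plane) : ∀ᵐ z : Plane, 0 < ‖x - z‖ := by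
  filter_upwards [compl_mem_ae_iff.2 (measure_singleton (μ := (volume : Measure Plane)) x)] with z hz
  rw [norm_pos_iff, sub_ne_zero]
  exact fun h => hz h.symm

theorem IsSymbol.continuousOn {b : ℕ → ℝ → ℂ} {M κ : ℝ} (hb : IsSymbol b M κ) {k : ℕ} (hk : k < 3) :
    ContinuousOn (b k) (Set.Ioi 0) := fun t ht =>
  (hb.hasDerivAt k hk t ht).continuousAt.continuousWithinAt

theorem continuousOn_subAmp {j : ℂ} {b : ℕ → ℝ → ℂ} {M κ : ℝ} (hb : IsSymbol b M κ) {X l : ℝ}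
    (hl : 0 < l) {k : ℕ} (hk : k < 3) : ContinuousOn (fun r => subAmp j b r X k l) (Set.Ioi 0) := by
  have h1 : ∀ {i : ℕ}, i < 3 → ContinuousOn (fun r => b i (l * r)) (Set.Ioi 0) := fun hi =>
    (hb.continuousOn hi).comp (by fun_prop) fun r hr => mul_pos hl hr
  have h2 : ContinuousOn (fun r : ℝ => Complex.exp (j * (r - X) * l)) (Set.Ioi 0) := by fun_prop
  have h3 : ContinuousOn (fun r : ℝ => j * (r - X) * l) (Set.Ioi 0) := by fun_prop
  match k with
  | 0 => exact (h2.mul (h1 (by norm_num))).sub continuousOn_const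
  | 1 => exact (h2.mul ((h1 (by norm_num)).add (h3.mul (h1 (by norm_num))))).sub continuousOn_const
  | 2 =>
    exact (h2.mul (((h1 (by norm_num)).add ((h3.const_mul 2).mul (h1 (by norm_num)))).add
      ((h3.add (h3.pow 2)).mul (h1 (by norm_num))))).sub continuousOn_const
  | k + 3 => omega

theorem aestronglyMeasurable_subAmp {j : ℂ} {b : ℕ → ℝ → ℂ} {M κ : ℝ} (hb : IsSymbol b M κ)
    {X l : ℝ} (hl : 0 < l) {k : ℕ} (hk : k < 3) (x : Plane) :
    AEStronglyMeasurable (fun z : Plane => subAmp j b ‖x - z‖ X k l) volume := by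
  have h1 : ContinuousOn (fun z : Plane => subAmp j b ‖x - z‖ X k l) {z | 0 < ‖x - z‖} :=
    (continuousOn_subAmp hb hl hk).comp (by fun_prop) fun z hz => hz
  have hm : MeasurableSet {z : Plane | 0 < ‖x - z‖} := measurableSet_lt (by fun_prop) (by fun_prop)
  have h2 := h1.aestronglyMeasurable (μ := volume) hm
  rwa [Measure.restrict_eq_self_of_ae_mem (s := {z : Plane | 0 < ‖x - z‖}) (ae_norm_sub_pos x)] at h2

/-- The triangle inequality permits `Z = 1 + |z|`, and the resulting loss `Z²` is paid by the decay
of `v`. -/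
theorem norm_vfun_mul_subAmp_le {V : Plane → ℝ} {ε C : ℝ}
    (hv : ∀ z, (1 + ‖z‖) ^ 2 * vfun V z ≤ C * weight ε z) {j : ℂ}
    (hj : j = Complex.I ∨ j = -Complex.I) {b : ℕ → ℝ → ℂ} {M κ : ℝ} (hM : 0 ≤ M) (hκ : 0 ≤ κ)
    (hb : IsSymbol b M κ) {x z : Plane} (hz : 0 < ‖x - z‖) {l L : ℝ} (hl : 0 < l) (hlL : l ≤ L)
    {k : ℕ} (hk : k < 3) :
    ‖(vfun V z : ℂ) * subAmp j b ‖x - z‖ (1 + ‖x‖) k l‖ ≤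
      M * (6 + L) * (κ + √l) * C * envelope ε x z := by
  have hZ : |‖x - z‖ - (1 + ‖x‖)| ≤ 1 + ‖z‖ := by
    have h1 := norm_sub_le x z
    have h2 := norm_sub_norm_le x z
    have h3 : ‖x‖ ≤ ‖x - z‖ + ‖z‖ := by linarith
    rw [abs_le]; constructor <;> linarith [norm_nonneg z]
  have h := norm_subAmp_le hj hM hκ hb hz (by linarith [norm_nonneg x] : 1 ≤ 1 + ‖x‖) hl hlL
    (by linarith [norm_nonneg z] : 1 ≤ 1 + ‖z‖) hZ hk
  have hA : 0 ≤ M * (6 + L) * (κ + √l) := by have : 0 ≤ L := by linarith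
                                             positivity
  rw [norm_mul, Complex.norm_real, Real.norm_of_nonneg (vfun_nonneg V z)]
  calc vfun V z * ‖subAmp j b ‖x - z‖ (1 + ‖x‖) k l‖
      ≤ vfun V z * _ := mul_le_mul_of_nonneg_left h (vfun_nonneg V z)
    _ = M * (6 + L) * (κ + √l) * ((1 + ‖z‖) ^ 2 * vfun V z) * ((√(1 + ‖x‖))⁻¹ + (√‖x - z‖)⁻¹) := by
      ring
    _ ≤ M * (6 + L) * (κ + √l) * (C * weight ε z) * ((√(1 + ‖x‖))⁻¹ + (√‖x - z‖)⁻¹) :=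
      mul_le_mul_of_nonneg_right (mul_le_mul_of_nonneg_left (hv z) hA) (by positivity)
    _ = _ := by rw [envelope]; ring

theorem memLp_vfun_mul_subAmp {V : Plane → ℝ} (hV : Measurable V) {ε C : ℝ} (hε : 0 < ε)
    (hv : ∀ z, (1 + ‖z‖) ^ 2 * vfun V z ≤ C * weight ε z) {j : ℂ}
    (hj : j = Complex.I ∨ j = -Complex.I) {b : ℕ → ℝ → ℂ} {M κ : ℝ} (hM : 0 ≤ M) (hκ : 0 ≤ κ)
    (hb : IsSymbol b M κ) (x : Plane) {l : ℝ} (hl : 0 < l) {k : ℕ} (hk : k < 3) :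
    MemLp (fun z => (vfun V z : ℂ) * subAmp j b ‖x - z‖ (1 + ‖x‖) k l) 2
      (volume : Measure Plane) := by
  obtain ⟨_, -, hE⟩ := exists_envelope_bound hε
  refine (hE x).1.of_le_mul (c := M * (6 + l) * (κ + √l) * C) ?_ ?_
  · exact (Complex.continuous_ofReal.measurable.comp (measurable_vfun hV)).aestronglyMeasurable.mul
      (aestronglyMeasurable_subAmp hb hl hk x)
  · filter_upwards [ae_norm_sub_pos x] with z hz
    rw [Real.norm_of_nonneg (envelope_nonneg ε x z)]
    exact norm_vfun_mul_subAmp_le hv hj hM hκ hb hz hl le_rfl hk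

theorem hasDerivAt_ampL2 {V : Plane → ℝ} (hV : Measurable V) {ε C : ℝ} (hε : 0 < ε)
    (hC : 0 ≤ C) (hv : ∀ z, (1 + ‖z‖) ^ 2 * vfun V z ≤ C * weight ε z) {j : ℂ}
    (hj : j = Complex.I ∨ j = -Complex.I) {b : ℕ → ℝ → ℂ} {M κ : ℝ} (hM : 0 ≤ M) (hκ : 0 ≤ κ)
    (hb : IsSymbol b M κ) (x : Plane) {l : ℝ} (hl : 0 < l) {k : ℕ} (hk : k < 2) :
    HasDerivAt (ampL2 V j b x k) (l⁻¹ • ampL2 V j b x (k + 1) l) l := by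
  obtain ⟨_, -, hE⟩ := exists_envelope_bound hε
  -- On this ball `m` is comparable to `l`, so one multiple of the envelope dominates all
  -- derivatives.
  have hball : ∀ m ∈ Metric.ball l (l / 2), l / 2 < m ∧ m < 2 * l := by
    intro m hm
    rw [Metric.mem_ball, Real.dist_eq, abs_lt] at hm
    constructor <;> linarith
  have hX : 0 < 1 + ‖x‖ := by positivity
  have h := hasDerivAt_toL2 (l₀ := l) (δ := l / 2)
    (F := fun l z => (vfun V z : ℂ) * subAmp j b ‖x - z‖ (1 + ‖x‖) k l)
    (F' := fun l z => (l : ℂ)⁻¹ * ((vfun V z : ℂ) * subAmp j b ‖x - z‖ (1 + ‖x‖) (k + 1) l))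
    (Φ := fun z => (l / 2)⁻¹ * (M * (6 + 2 * l) * (κ + √(2 * l)) * C) * envelope ε x z)
    (by positivity)
    (fun m hm => memLp_vfun_mul_subAmp hV hε hv hj hM hκ hb x (by linarith [hball m hm])
      (by omega))
    ((memLp_vfun_mul_subAmp hV hε hv hj hM hκ hb x hl (by omega)).const_mul _)
    ((hE x).1.const_mul _) ?_
  · rw [toL2_const_mul (memLp_vfun_mul_subAmp hV hε hv hj hM hκ hb x hl (by omega))] at h
    refine h.congr_deriv ?_
    rw [← Complex.ofReal_inv]
    exact Complex.coe_smul l⁻¹ _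
  · filter_upwards [ae_norm_sub_pos x] with z hz m hm
    have hm' := hball m hm
    have hm0 : 0 < m := by linarith
    refine ⟨((hasDerivAt_subAmp hb hz hX hm0 hk).const_mul _).congr_deriv (by ring), ?_⟩
    rw [norm_mul, norm_inv, Complex.norm_real, Real.norm_of_nonneg hm0.le, mul_assoc]
    refine mul_le_mul (inv_anti₀ (by positivity) hm'.1.le) ?_ (norm_nonneg _) (by positivity)
    refine (norm_vfun_mul_subAmp_le hv hj hM hκ hb hz hm0 hm'.2.le (by omega)).trans ?_
    have := envelope_nonneg ε x z
    have hs := Real.sqrt_le_sqrt hm'.2.le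
    gcongr

theorem exists_isL2Symbol_ampL2 {V : Plane → ℝ} (hV : Measurable V) {ε C : ℝ} (hε : 0 < ε)
    (hC : 0 ≤ C) (hv : ∀ z, (1 + ‖z‖) ^ 2 * vfun V z ≤ C * weight ε z) {j : ℂ}
    (hj : j = Complex.I ∨ j = -Complex.I) {b : ℕ → ℝ → ℂ} {M κ : ℝ} (hM : 0 ≤ M) (hκ : 0 ≤ κ)
    (hb : IsSymbol b M κ) {L : ℝ} (hL : 0 ≤ L) :
    ∃ N, 0 ≤ N ∧ ∀ x, IsL2Symbol (ampL2 V j b x) (N * (√(1 + ‖x‖))⁻¹) κ L := by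
  obtain ⟨C₁, hC₁, hE⟩ := exists_envelope_bound hε
  refine ⟨M * (6 + L) * C * C₁, by positivity, fun x => ⟨fun k hk l hl =>
    hasDerivAt_ampL2 hV hε hC hv hj hM hκ hb x hl hk, fun k hk l hl hlL => ?_⟩⟩
  refine (norm_toL2_le (by positivity : 0 ≤ M * (6 + L) * (κ + √l) * C) (hE x).1 ?_).trans ?_
  · filter_upwards [ae_norm_sub_pos x] with z hz
    rw [Real.norm_of_nonneg (envelope_nonneg ε x z)]
    exact norm_vfun_mul_subAmp_le hv hj hM hκ hb hz hl hlL hk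
  · calc M * (6 + L) * (κ + √l) * C * (eLpNorm (envelope ε x) 2 volume).toReal
        ≤ M * (6 + L) * (κ + √l) * C * (C₁ * (√(1 + ‖x‖))⁻¹) :=
          mul_le_mul_of_nonneg_left (hE x).2 (by positivity)
      _ = _ := by ring

/-! ### Oscillatory integrals -/

theorem integrableOn_sqrt_inv (L : ℝ) : IntegrableOn (fun l : ℝ => (√l)⁻¹) (Set.Ioc 0 L) := by
  rcases le_total L 0 with hL | hL
  · rw [Set.Ioc_eq_empty (not_lt.2 hL)]; exact integrableOn_empty
  have h := intervalIntegral.intervalIntegrable_rpow' (a := 0) (b := L) (r := -(1 / 2))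
    (by norm_num)
  rw [intervalIntegrable_iff_integrableOn_Ioc_of_le hL] at h
  refine h.congr_fun (fun l hl => ?_) measurableSet_Ioc
  simp only [Real.sqrt_eq_rpow, Real.rpow_neg hl.1.le]

theorem integral_sqrt_inv {L : ℝ} (hL : 0 ≤ L) : ∫ l in Set.Ioc 0 L, (√l)⁻¹ = 2 * √L := by
  rw [← intervalIntegral.integral_of_le hL]
  have h : ∫ l in (0 : ℝ)..L, (√l)⁻¹ = ∫ l in (0 : ℝ)..L, l ^ (-(1 / 2) : ℝ) := by
    refine intervalIntegral.integral_congr fun l hl => ?_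
    rw [Set.uIcc_of_le hL] at hl
    simp only [Real.sqrt_eq_rpow, Real.rpow_neg hl.1]
  rw [h, integral_rpow (Or.inl (by norm_num)), Real.sqrt_eq_rpow]
  norm_num
  ring

/-- Two integrations by parts, for an amplitude whose second derivative is `O(l^{-1/2})`. -/
theorem norm_integral_exp_mul_le {Φ₀ Φ₁ Φ₂ : ℝ → ℂ} {N L : ℝ} (hL : 0 < L)
    (h0 : ∀ l, 0 < l → HasDerivAt Φ₀ (Φ₁ l) l) (h1 : ∀ l, 0 < l → HasDerivAt Φ₁ (Φ₂ l) l)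
    (hb0 : ∀ l, 0 < l → l ≤ L → ‖Φ₀ l‖ ≤ N) (hb2 : ∀ l, 0 < l → l ≤ L → ‖Φ₂ l‖ ≤ N * (√l)⁻¹)
    (ht0 : Tendsto Φ₀ (𝓝[>] 0) (𝓝 0)) (ht1 : Tendsto Φ₁ (𝓝[>] 0) (𝓝 0))
    (hz0 : ∀ l, L ≤ l → Φ₀ l = 0) (hz1 : Φ₁ L = 0) (ρ : ℝ) :
    IntegrableOn (fun l : ℝ => Complex.exp (Complex.I * ρ * l) * Φ₀ l) (Set.Ioi 0) ∧
    ‖∫ l in Set.Ioi (0 : ℝ), Complex.exp (Complex.I * ρ * l) * Φ₀ l‖ * (1 + ρ ^ 2) ≤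
      N * (L + 2 * √L) := by
  set e : ℝ → ℂ := fun l => Complex.exp (Complex.I * ρ * l) with he
  have hen : ∀ l, ‖e l‖ = 1 := fun l => by
    have : Complex.I * ρ * l = Complex.I * ((ρ * l : ℝ) : ℂ) := by push_cast; ring
    rw [he]; simp only [this, Complex.norm_exp_I_mul_ofReal]
  have hec : Continuous e := by fun_prop
  have hed : ∀ l, HasDerivAt e (e l * (Complex.I * ρ)) l := fun l => by
    have hid : HasDerivAt (fun l : ℝ => (l : ℂ)) 1 l := (hasDerivAt_id l).ofReal_comp
    simpa using (hid.const_mul (Complex.I * ρ)).cexp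
  have hfin : volume (Set.Ioc (0 : ℝ) L) ≠ ⊤ := by simp
  have hc0 : ContinuousOn Φ₀ (Set.Ioi 0) := fun l hl => (h0 l hl).continuousAt.continuousWithinAt
  have hm0 : AEStronglyMeasurable Φ₀ (volume.restrict (Set.Ioc 0 L)) :=
    (hc0.mono fun l hl => hl.1).aestronglyMeasurable measurableSet_Ioc
  have hm2 : AEStronglyMeasurable Φ₂ (volume.restrict (Set.Ioc 0 L)) := by
    refine (measurable_deriv Φ₁).aestronglyMeasurable.congr ?_
    filter_upwards [ae_restrict_mem measurableSet_Ioc] with l hl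
    exact (h1 l hl.1).deriv
  have hi0 : IntegrableOn (fun l => e l * Φ₀ l) (Set.Ioc 0 L) := by
    refine Integrable.mono' (g := fun _ => N) (integrableOn_const hfin)
      (hec.aestronglyMeasurable.mul hm0) ?_
    filter_upwards [ae_restrict_mem measurableSet_Ioc] with l hl
    rw [norm_mul, hen, one_mul]; exact hb0 l hl.1 hl.2
  have hi2 : IntegrableOn (fun l => e l * Φ₂ l) (Set.Ioc 0 L) := by
    refine Integrable.mono' ((integrableOn_sqrt_inv L).const_mul N)
      (hec.aestronglyMeasurable.mul hm2) ?_
    filter_upwards [ae_restrict_mem measurableSet_Ioc] with l hl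
    rw [norm_mul, hen, one_mul]; exact hb2 l hl.1 hl.2
  have hoff : ∀ l ∈ Set.Ioi (0 : ℝ) \ Set.Ioc 0 L, e l * Φ₀ l = 0 := fun l hl => by
    have : L ≤ l := by
      by_contra h
      exact hl.2 ⟨hl.1, (not_le.1 h).le⟩
    rw [hz0 l this, mul_zero]
  have hint : IntegrableOn (fun l => e l * Φ₀ l) (Set.Ioi 0) :=
    hi0.of_forall_sdiff_eq_zero measurableSet_Ioi hoff
  have heq : ∫ l in Set.Ioi (0 : ℝ), e l * Φ₀ l = ∫ l in Set.Ioc 0 L, e l * Φ₀ l :=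
    setIntegral_eq_of_subset_of_forall_sdiff_eq_zero measurableSet_Ioi (fun l hl => hl.1) hoff
  refine ⟨hint, ?_⟩
  have hA : ‖∫ l in Set.Ioc 0 L, e l * Φ₀ l‖ ≤ N * L := by
    have := norm_setIntegral_le_of_norm_le_const (μ := volume) (s := Set.Ioc 0 L)
      (f := fun l => e l * Φ₀ l) (C := N) (by simp) fun l hl => by
        rw [norm_mul, hen, one_mul]; exact hb0 l hl.1 hl.2
    simpa [Measure.real, hL.le] using this
  have hB : ‖∫ l in Set.Ioc 0 L, e l * Φ₂ l‖ ≤ N * (2 * √L) := by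
    rw [← integral_sqrt_inv hL.le, ← integral_const_mul]
    refine norm_integral_le_of_norm_le ((integrableOn_sqrt_inv L).const_mul N) ?_
    filter_upwards [ae_restrict_mem measurableSet_Ioc] with l hl
    rw [norm_mul, hen, one_mul]; exact hb2 l hl.1 hl.2
  have hI2 : (Complex.I : ℂ) ^ 2 = -1 := Complex.I_sq
  -- Both integrations by parts at once: the terms `e Φ₁` cancel, and the boundary values at `0` and
  -- `L` vanish, so the integral of `ρ² e Φ₀` is minus that of `e Φ₂`.
  have hW : ∀ l ∈ Set.Ioo 0 L, HasDerivAt (fun l => e l * (-(Complex.I * ρ) * Φ₀ l + Φ₁ l))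
      ((ρ : ℂ) ^ 2 * (e l * Φ₀ l) + e l * Φ₂ l) l := fun l hl => by
    refine ((hed l).mul (((h0 l hl.1).const_mul (-(Complex.I * ρ))).add (h1 l hl.1))).congr_deriv ?_
    simp only [Pi.add_apply]
    linear_combination (-(e l * (ρ : ℂ) ^ 2 * Φ₀ l)) * hI2
  have hlim0 : Tendsto (fun l => e l * (-(Complex.I * ρ) * Φ₀ l + Φ₁ l)) (𝓝[>] 0) (𝓝 0) := by
    have := (hec.tendsto 0).mono_left (nhdsWithin_le_nhds (s := Set.Ioi 0))
    simpa using this.mul ((ht0.const_mul (-(Complex.I * ρ))).add ht1)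
  have hlimL : Tendsto (fun l => e l * (-(Complex.I * ρ) * Φ₀ l + Φ₁ l)) (𝓝[<] L) (𝓝 0) := by
    have h2 := (hec.tendsto L).mul
      (((h0 L hL).continuousAt.tendsto.const_mul (-(Complex.I * ρ))).add
        (h1 L hL).continuousAt.tendsto)
    rw [hz0 L le_rfl, hz1] at h2
    simpa using h2.mono_left (nhdsWithin_le_nhds (s := Set.Iio L))
  have hiW : IntegrableOn (fun l => (ρ : ℂ) ^ 2 * (e l * Φ₀ l) + e l * Φ₂ l) (Set.Ioc 0 L) :=
    (hi0.const_mul _).add hi2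
  have hFTC := intervalIntegral.integral_eq_sub_of_hasDerivAt_of_tendsto hL hW
    ((intervalIntegrable_iff_integrableOn_Ioc_of_le hL.le).2 hiW) hlim0 hlimL
  rw [intervalIntegral.integral_of_le hL.le, integral_add (hi0.const_mul _) hi2,
    integral_const_mul, sub_zero, add_eq_zero_iff_eq_neg] at hFTC
  have hρ : ρ ^ 2 * ‖∫ l in Set.Ioc 0 L, e l * Φ₀ l‖ ≤ N * (2 * √L) := by
    have := congrArg norm hFTC
    rw [norm_mul, norm_neg, norm_pow, Complex.norm_real, Real.norm_eq_abs, sq_abs] at this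
    rw [this]; exact hB
  rw [heq]
  linarith

/-- The amplitude `ξ(l) l χ(l)` for a scalar symbol `ξ = O(√l)`. -/
theorem exists_norm_integral_symbol_le {χ : ℝ → ℝ} (hχ : ContDiff ℝ ∞ χ) {L : ℝ} (hL : 0 < L)
    (hχL : ∀ l, L ≤ l → χ l = 0) (hχL' : deriv χ L = 0) :
    ∃ K, 0 ≤ K ∧ ∀ (ξ : ℕ → ℝ → ℂ) (N : ℝ), 0 ≤ N →
      (∀ k < 2, ∀ l : ℝ, 0 < l → HasDerivAt (ξ k) ((l : ℂ)⁻¹ * ξ (k + 1) l) l) →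
      (∀ k < 3, ∀ l : ℝ, 0 < l → l ≤ L → ‖ξ k l‖ ≤ N * √l) → ∀ ρ : ℝ,
      IntegrableOn (fun l : ℝ => Complex.exp (Complex.I * ρ * l) * (ξ 0 l * l * χ l)) (Set.Ioi 0) ∧
      ‖∫ l in Set.Ioi (0 : ℝ), Complex.exp (Complex.I * ρ * l) * (ξ 0 l * l * χ l)‖ * (1 + ρ ^ 2) ≤
        K * N := by
  have hχ1 : ContDiff ℝ ∞ (deriv χ) := ((contDiff_infty_iff_deriv (𝕜 := ℝ)).1 hχ).2
  have hχ2 : ContDiff ℝ ∞ (deriv (deriv χ)) := ((contDiff_infty_iff_deriv (𝕜 := ℝ)).1 hχ1).2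
  have hd0 : ∀ l, HasDerivAt (fun l => (χ l : ℂ)) ((deriv χ l : ℝ) : ℂ) l := fun l =>
    ((hχ.differentiable (by simp)) l).hasDerivAt.ofReal_comp
  have hd1 : ∀ l, HasDerivAt (fun l => ((deriv χ l : ℝ) : ℂ)) ((deriv (deriv χ) l : ℝ) : ℂ) l := fun l =>
    ((hχ1.differentiable (by simp)) l).hasDerivAt.ofReal_comp
  obtain ⟨D, hD0, hD⟩ : ∃ D, 0 ≤ D ∧ ∀ l, 0 < l → l ≤ L →
      |χ l| ≤ D ∧ |deriv χ l| ≤ D ∧ |deriv (deriv χ) l| ≤ D := by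
    have hcont : Continuous fun l => |χ l| + |deriv χ l| + |deriv (deriv χ) l| := by
      have := hχ.continuous; have := hχ1.continuous; have := hχ2.continuous
      fun_prop
    obtain ⟨D, hD⟩ := (isCompact_Icc (a := 0) (b := L)).bddAbove_image hcont.continuousOn
    have hD' : ∀ l, 0 < l → l ≤ L → |χ l| + |deriv χ l| + |deriv (deriv χ) l| ≤ D :=
      fun l h0 h1 => hD ⟨l, ⟨h0.le, h1⟩, rfl⟩
    refine ⟨D, le_trans (by positivity) (hD' L hL le_rfl), fun l h0 h1 => ?_⟩
    have := hD' l h0 h1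
    have := abs_nonneg (χ l); have := abs_nonneg (deriv χ l)
    have := abs_nonneg (deriv (deriv χ) l)
    refine ⟨?_, ?_, ?_⟩ <;> linarith
  set R := D * (2 + 4 * L + L ^ 2 + L * √L) with hR
  refine ⟨R * (L + 2 * √L), by positivity, fun ξ N hN hξ hξb ρ => ?_⟩
  have hsl : ∀ l, 0 < l → l ≤ L → √l ≤ L * (√l)⁻¹ := fun l h0 h1 => by
    rw [← div_eq_mul_inv, le_div_iff₀ (Real.sqrt_pos.2 h0), Real.mul_self_sqrt h0.le]; exact h1
  have hid : ∀ l : ℝ, HasDerivAt (fun l : ℝ => (l : ℂ)) 1 l := fun l =>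
    (hasDerivAt_id l).ofReal_comp
  have hb : ∀ {k : ℕ} {l : ℝ} {c : ℝ}, k < 3 → 0 < l → l ≤ L → |c| ≤ D →
      ‖ξ k l * (c : ℂ)‖ ≤ N * √l * D := fun hk h0 h1 hc => by
    rw [norm_mul, Complex.norm_real]
    exact mul_le_mul (hξb _ hk _ h0 h1) hc (norm_nonneg _) (by positivity)
  have hb' : ∀ {k : ℕ} {l : ℝ} {c : ℝ}, k < 3 → 0 < l → l ≤ L → |c| ≤ D →
      ‖ξ k l * (c : ℂ)‖ ≤ N * D * L * (√l)⁻¹ := fun hk h0 h1 hc => by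
    refine (hb hk h0 h1 hc).trans ?_
    have := mul_le_mul_of_nonneg_left (hsl _ h0 h1) (mul_nonneg hN hD0)
    linarith
  have hbl : ∀ {k : ℕ} {l : ℝ} {c : ℝ}, k < 3 → 0 < l → l ≤ L → |c| ≤ D →
      ‖ξ k l * l * (c : ℂ)‖ ≤ L * (N * √l * D) := fun {k l c} hk h0 h1 hc => by
    rw [mul_right_comm, norm_mul _ (l : ℂ), Complex.norm_real, Real.norm_of_nonneg h0.le, mul_comm]
    exact mul_le_mul h1 (hb hk h0 h1 hc) (norm_nonneg _) hL.le
  have hT : ∀ {f : ℝ → ℂ} {c : ℝ}, (∀ l, 0 < l → l ≤ L → ‖f l‖ ≤ c * √l) →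
      Tendsto f (𝓝[>] 0) (𝓝 0) := fun {f c} hf => by
    have h1 : Tendsto (fun l => c * √l) (𝓝[>] 0) (𝓝 0) := by
      have : Continuous fun l => c * √l := by fun_prop
      simpa using (this.tendsto 0).mono_left (nhdsWithin_le_nhds (s := Set.Ioi 0))
    refine squeeze_zero_norm' ?_ h1
    filter_upwards [Ioo_mem_nhdsGT hL] with l hl
    exact hf l hl.1 hl.2.le
  -- Near `0` these are of sizes `l^(3/2)`, `l^(1/2)` and `l^(-1/2)`: the last is integrable and the
  -- first two vanish at the origin.
  have key := norm_integral_exp_mul_le (N := R * N) (L := L) hL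
    (Φ₀ := fun l => ξ 0 l * l * χ l)
    (Φ₁ := fun l => ξ 1 l * χ l + ξ 0 l * χ l + ξ 0 l * l * ((deriv χ l : ℝ) : ℂ))
    (Φ₂ := fun l => (l : ℂ)⁻¹ * (ξ 2 l * χ l) + (l : ℂ)⁻¹ * (ξ 1 l * χ l) + ξ 1 l * ((deriv χ l : ℝ) : ℂ)
      + ξ 1 l * ((deriv χ l : ℝ) : ℂ) + ξ 0 l * ((deriv χ l : ℝ) : ℂ) + ξ 0 l * ((deriv χ l : ℝ) : ℂ)
      + ξ 0 l * l * ((deriv (deriv χ) l : ℝ) : ℂ))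
    ?_ ?_ ?_ ?_ ?_ ?_ ?_ ?_ ρ
  · refine ⟨key.1, key.2.trans (le_of_eq (by ring))⟩
  · intro l hl
    have hlc : (l : ℂ) ≠ 0 := by exact_mod_cast hl.ne'
    refine (((hξ 0 (by norm_num) l hl).mul (hid l)).mul (hd0 l)).congr_deriv ?_
    simp only [Pi.mul_apply]
    field_simp
  · intro l hl
    have hlc : (l : ℂ) ≠ 0 := by exact_mod_cast hl.ne'
    have k0 := hξ 0 (by norm_num) l hl
    have k1 := hξ 1 (by norm_num) l hl
    refine (((k1.mul (hd0 l)).add (k0.mul (hd0 l))).add ((k0.mul (hid l)).mul (hd1 l))).congr_deriv ?_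
    simp only [Pi.mul_apply]
    field_simp
    ring
  · intro l h0 h1
    refine (hbl (by norm_num) h0 h1 (hD l h0 h1).1).trans ?_
    have h2 : L * (N * √l * D) ≤ L * (N * √L * D) := by
      have := Real.sqrt_le_sqrt h1
      gcongr
    refine h2.trans ?_
    have : 0 ≤ D * (2 + 4 * L + L ^ 2) * N := by positivity
    rw [hR]; linarith
  · intro l h0 h1
    have hs := Real.sqrt_pos.2 h0
    have hli : ∀ {k : ℕ}, k < 3 → ‖(l : ℂ)⁻¹ * (ξ k l * χ l)‖ ≤ N * D * (√l)⁻¹ := fun hk => by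
      rw [norm_mul, norm_inv, Complex.norm_real, Real.norm_of_nonneg h0.le]
      have h2 : l⁻¹ * √l = (√l)⁻¹ := by
        field_simp
        exact Real.sq_sqrt h0.le
      calc l⁻¹ * ‖ξ _ l * χ l‖ ≤ l⁻¹ * (N * √l * D) :=
            mul_le_mul_of_nonneg_left (hb hk h0 h1 (hD l h0 h1).1) (by positivity)
        _ = N * D * (l⁻¹ * √l) := by ring
        _ = _ := by rw [h2]
    have e1 := hli (k := 2) (by norm_num)
    have e2 := hli (k := 1) (by norm_num)
    have e3 := hb' (k := 1) (by norm_num) h0 h1 (hD l h0 h1).2.1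
    have e4 := hb' (k := 0) (by norm_num) h0 h1 (hD l h0 h1).2.1
    have e5 : ‖ξ 0 l * l * ((deriv (deriv χ) l : ℝ) : ℂ)‖ ≤ N * D * L ^ 2 * (√l)⁻¹ := by
      refine (hbl (k := 0) (by norm_num) h0 h1 (hD l h0 h1).2.2).trans ?_
      have := mul_le_mul_of_nonneg_left (hsl _ h0 h1) (mul_nonneg (mul_nonneg hN hD0) hL.le)
      linarith
    have e6 : 0 ≤ D * (L * √L) * N * (√l)⁻¹ := by positivity
    refine (norm_add_le _ _).trans ((add_le_add_left (norm_add_le _ _) _).trans ?_)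
    refine (add_le_add_left (add_le_add_left (norm_add_le _ _) _) _).trans ?_
    refine (add_le_add_left (add_le_add_left (add_le_add_left (norm_add_le _ _) _) _) _).trans ?_
    refine (add_le_add_left (add_le_add_left (add_le_add_left (add_le_add_left
      (norm_add_le _ _) _) _) _) _).trans ?_
    refine (add_le_add_left (add_le_add_left (add_le_add_left (add_le_add_left (add_le_add_left
      (norm_add_le _ _) _) _) _) _) _).trans ?_
    rw [hR]
    linarith
  · refine hT (c := L * N * D) fun l h0 h1 => ?_
    exact (hbl (by norm_num) h0 h1 (hD l h0 h1).1).trans (le_of_eq (by ring))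
  · refine hT (c := 2 * N * D + L * N * D) fun l h0 h1 => ?_
    have e1 := hb (k := 1) (by norm_num) h0 h1 (hD l h0 h1).1
    have e2 := hb (k := 0) (by norm_num) h0 h1 (hD l h0 h1).1
    have e3 := hbl (k := 0) (by norm_num) h0 h1 (hD l h0 h1).2.1
    refine (norm_add_le _ _).trans ((add_le_add_left (norm_add_le _ _) _).trans ?_)
    linarith
  · intro l hl
    simp [hχL l hl]
  · simp [hχL L le_rfl, hχL']

/-! ### Pairings of `L²`-valued symbols -/

/-- The Euler derivatives of `⟪F 0, B (G 0)⟫`. -/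
noncomputable def pairing (B : L2 →L[ℂ] L2) (F G : ℕ → ℝ → L2) : ℕ → ℝ → ℂ
  | 0, l => inner ℂ (F 0 l) (B (G 0 l))
  | 1, l => inner ℂ (F 0 l) (B (G 1 l)) + inner ℂ (F 1 l) (B (G 0 l))
  | _ + 2, l => inner ℂ (F 0 l) (B (G 2 l)) + inner ℂ (F 1 l) (B (G 1 l)) +
      (inner ℂ (F 1 l) (B (G 1 l)) + inner ℂ (F 2 l) (B (G 0 l)))

theorem hasDerivAt_pairing (B : L2 →L[ℂ] L2) {F G : ℕ → ℝ → L2} {N κ N' κ' L : ℝ}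
    (hF : IsL2Symbol F N κ L) (hG : IsL2Symbol G N' κ' L) {k : ℕ} (hk : k < 2) {l : ℝ}
    (hl : 0 < l) :
    HasDerivAt (pairing B F G k) ((l : ℂ)⁻¹ * pairing B F G (k + 1) l) l := by
  have hi : ∀ {a b : ℕ}, a < 2 → b < 2 → HasDerivAt (fun l => inner ℂ (F a l) (B (G b l)))
      ((l : ℂ)⁻¹ * (inner ℂ (F a l) (B (G (b + 1) l)) + inner ℂ (F (a + 1) l) (B (G b l)))) l := by
    intro a b ha hb
    have h1 : HasDerivAt (fun l => B (G b l)) (l⁻¹ • B (G (b + 1) l)) l := by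
      have := (B.restrictScalars ℝ).hasFDerivAt.comp_hasDerivAt l (hG.hasDerivAt b hb l hl)
      rw [map_smul] at this
      exact this
    refine ((hF.hasDerivAt a ha l hl).inner ℂ h1).congr_deriv ?_
    have hs : ∀ g : L2, l⁻¹ • g = ((l⁻¹ : ℝ) : ℂ) • g := fun g => (Complex.coe_smul l⁻¹ g).symm
    rw [hs, hs, inner_smul_left, inner_smul_right, Complex.conj_ofReal]
    push_cast
    ring
  match k with
  | 0 => exact hi (by norm_num) (by norm_num)
  | 1 =>
    refine ((hi (a := 0) (b := 1) (by norm_num) (by norm_num)).add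
      (hi (a := 1) (b := 0) (by norm_num) (by norm_num))).congr_deriv ?_
    rw [pairing]; ring
  | k + 2 => omega

/-- Only `G`, the non-logarithmic factor, contributes the power `√l`; `F` is merely bounded on `(0,
L]`. The factor 4 counts the terms in the second Leibniz expansion. -/
theorem norm_pairing_le (B : L2 →L[ℂ] L2) {F G : ℕ → ℝ → L2} {N N' L : ℝ} (hN : 0 ≤ N)
    (hF : IsL2Symbol F N 1 L) (hG : IsL2Symbol G N' 0 L) {k : ℕ} (hk : k < 3) {l : ℝ}
    (hl : 0 < l) (hlL : l ≤ L) :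
    ‖pairing B F G k l‖ ≤ 4 * ‖B‖ * (1 + √L) * (N * N') * √l := by
  have hs : √l ≤ √L := Real.sqrt_le_sqrt hlL
  have hs0 := Real.sqrt_nonneg l
  have hi : ∀ {a b : ℕ}, a < 3 → b < 3 → ‖(inner ℂ (F a l) (B (G b l)) : ℂ)‖ ≤
      ‖B‖ * (1 + √L) * (N * N') * √l := by
    intro a b ha hb
    have h1 := hF.bound a ha l hl hlL
    have h2 := hG.bound b hb l hl hlL
    rw [zero_add] at h2
    have h3 : ‖F a l‖ ≤ N * (1 + √L) := h1.trans (by gcongr)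
    calc _ ≤ ‖F a l‖ * ‖B (G b l)‖ := norm_inner_le_norm _ _
      _ ≤ ‖F a l‖ * (‖B‖ * ‖G b l‖) := by gcongr; exact B.le_opNorm _
      _ ≤ (N * (1 + √L)) * (‖B‖ * (N' * √l)) := by gcongr
      _ = _ := by ring
  have h0 : 0 ≤ ‖B‖ * (1 + √L) * (N * N') * √l := (norm_nonneg _).trans (hi (a := 0) (b := 0)
    (by norm_num) (by norm_num))
  match k with
  | 0 =>
    have := hi (a := 0) (b := 0) (by norm_num) (by norm_num)
    rw [pairing]; linarith
  | 1 =>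
    have h1 := hi (a := 0) (b := 1) (by norm_num) (by norm_num)
    have h2 := hi (a := 1) (b := 0) (by norm_num) (by norm_num)
    rw [pairing]
    refine (norm_add_le _ _).trans ?_
    linarith
  | k + 2 =>
    have h1 := hi (a := 0) (b := 2) (by norm_num) (by norm_num)
    have h2 := hi (a := 2) (b := 0) (by norm_num) (by norm_num)
    have h3 := hi (a := 1) (b := 1) (by norm_num) (by norm_num)
    rw [pairing]
    refine (norm_add_le _ _).trans ((add_le_add (norm_add_le _ _) (norm_add_le _ _)).trans ?_)
    linarith

theorem exists_norm_integral_pairing_le {χ : ℝ → ℝ} (hχ : ContDiff ℝ ∞ χ) {L : ℝ} (hL : 0 < L)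
    (hχL : ∀ l, L ≤ l → χ l = 0) (hχL' : deriv χ L = 0) (B : L2 →L[ℂ] L2) :
    ∃ K, 0 ≤ K ∧ ∀ (F G : ℕ → ℝ → L2) (N N' : ℝ), 0 ≤ N → 0 ≤ N' → IsL2Symbol F N 1 L →
      IsL2Symbol G N' 0 L → ∀ ρ : ℝ,
      IntegrableOn (fun l : ℝ => Complex.exp (Complex.I * ρ * l) *
        (inner ℂ (F 0 l) (B (G 0 l)) * l * χ l)) (Set.Ioi 0) ∧
      ‖∫ l in Set.Ioi (0 : ℝ), Complex.exp (Complex.I * ρ * l) *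
        (inner ℂ (F 0 l) (B (G 0 l)) * l * χ l)‖ * (1 + ρ ^ 2) ≤ K * (N * N') := by
  obtain ⟨K, hK, h⟩ := exists_norm_integral_symbol_le hχ hL hχL hχL'
  refine ⟨K * (4 * ‖B‖ * (1 + √L)), by positivity, fun F G N N' hN hN' hF hG ρ => ?_⟩
  have := h (pairing B F G) (4 * ‖B‖ * (1 + √L) * (N * N')) (by positivity)
    (fun k hk l hl => hasDerivAt_pairing B hF hG hk hl)
    (fun k hk l hl hlL => norm_pairing_le B hN hF hG hk hl hlL) ρ
  exact ⟨this.1, this.2.trans (le_of_eq (by ring))⟩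

/-! ### The integral kernel of the low energy operator -/

/-- The radial profile of the complex conjugate of the kernel of `R₀⁻`. -/
noncomputable def outProfile (t : ℝ) : ℂ := Complex.I / 4 * besselJ0 t - 1 / 4 * besselY0 t

/-- The radial profile of the kernel of `R₀⁺ - R₀⁻`. -/
noncomputable def inProfile (t : ℝ) : ℂ := Complex.I / 2 * besselJ0 t

/-- The conjugate is taken because this profile will occupy the conjugate-linear slot of the inner
product. -/
theorem freeResMinus_eq (l : ℝ) (x z : Plane) :
    freeResMinus l x z = (starRingEnd ℂ) (outProfile (l * ‖x - z‖)) := by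
  simp only [freeResMinus, hankelMinus, outProfile, map_sub, map_mul, map_div₀, Complex.conj_I,
    Complex.conj_ofReal, map_one, map_ofNat]
  linear_combination (1 / 4 * (besselY0 (l * ‖x - z‖) : ℂ)) * Complex.I_sq

theorem freeResPlus_sub_freeResMinus (l : ℝ) (w y : Plane) :
    freeResPlus l w y - freeResMinus l w y = inProfile (l * ‖w - y‖) := by
  simp only [freeResPlus, hankelPlus, freeResMinus, hankelMinus, inProfile]
  ring

theorem measurable_besselY0 : Measurable besselY0 := by
  rw [funext besselY0_eq]
  have h1 := (expBounded_y0Coeff.continuous_comp).measurable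
  have h2 := continuous_besselJ0.measurable
  fun_prop

theorem measurable_outProfile : Measurable outProfile := by
  have h1 := measurable_besselY0
  have h2 := continuous_besselJ0.measurable
  unfold outProfile
  fun_prop

theorem continuous_inProfile : Continuous inProfile := by
  have h2 := continuous_besselJ0
  unfold inProfile
  fun_prop

theorem exists_norm_outProfile_le : ∃ M, 0 ≤ M ∧ ∀ t, 0 < t → ‖outProfile t‖ ≤ M * (√t)⁻¹ := by
  obtain ⟨M, hM, -, hJ⟩ := besselJ0_bounds
  obtain ⟨M', hM', hY⟩ := besselY0_bounds
  refine ⟨M + M', by positivity, fun t ht => ?_⟩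
  have h1 := (hJ t ht).1
  have h2 := (hY t ht).1
  rw [outProfile]
  refine (norm_sub_le _ _).trans ?_
  simp only [norm_mul, norm_div, Complex.norm_I, Complex.norm_real, Complex.norm_ofNat, norm_one,
    Real.norm_eq_abs]
  have := abs_nonneg (besselJ0 t)
  have := abs_nonneg (besselY0 t)
  linarith

theorem exists_norm_inProfile_le : ∃ M, 0 ≤ M ∧ ∀ t, ‖inProfile t‖ ≤ M := by
  obtain ⟨M, hM, hJ, -⟩ := besselJ0_bounds
  refine ⟨M, hM, fun t => ?_⟩
  have h1 := hJ |t| (abs_nonneg t)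
  rw [besselJ0_eq, sq_abs, ← besselJ0_eq] at h1
  rw [inProfile]
  simp only [norm_mul, norm_div, Complex.norm_I, Complex.norm_real, Complex.norm_ofNat,
    Real.norm_eq_abs]
  have := abs_nonneg (besselJ0 t)
  linarith

theorem exists_isSymbol_outProfile : ∃ (h' : ℝ → ℂ) (M : ℝ), 0 ≤ M ∧
    IsSymbol (amplitude Complex.I outProfile h') M 1 ∧
    IsSymbol (amplitude (-Complex.I) outProfile h') M 1 := by
  obtain ⟨M, hM, -, hJ⟩ := besselJ0_bounds
  obtain ⟨M', hM', hY⟩ := besselY0_bounds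
  set h' : ℝ → ℂ := fun t => Complex.I / 4 * besselJ0' t - 1 / 4 * besselY0' t with hh'
  have hd : ∀ t, 0 < t → HasDerivAt outProfile (h' t) t := fun t ht =>
    ((hasDerivAt_besselJ0 t).ofReal_comp.const_mul _).sub
      ((hasDerivAt_besselY0 ht).ofReal_comp.const_mul _)
  have hd' : ∀ t, 0 < t → HasDerivAt h' (-outProfile t - h' t / t) t := fun t ht => by
    refine (((hasDerivAt_besselJ0' ht).ofReal_comp.const_mul (Complex.I / 4)).sub
      ((hasDerivAt_besselY0' ht).ofReal_comp.const_mul (1 / 4))).congr_deriv ?_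
    simp only [outProfile, hh']
    push_cast
    ring
  have hb : ∀ t, 0 < t → ‖outProfile t‖ ≤ (M + M') * (√t)⁻¹ := fun t ht => by
    have h1 := (hJ t ht).1
    have h2 := (hY t ht).1
    rw [outProfile]
    refine (norm_sub_le _ _).trans ?_
    simp only [norm_mul, norm_div, Complex.norm_I, Complex.norm_real, Complex.norm_ofNat, norm_one,
      Real.norm_eq_abs]
    have := abs_nonneg (besselJ0 t)
    have := abs_nonneg (besselY0 t)
    linarith
  have hb' : ∀ t, 0 < t → ‖h' t‖ ≤ (M + M') * ((√t)⁻¹ + 1 * t⁻¹) := fun t ht => by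
    have h1 := (hJ t ht).2
    have h2 := (hY t ht).2
    rw [hh']
    refine (norm_sub_le _ _).trans ?_
    simp only [norm_mul, norm_div, Complex.norm_I, Complex.norm_real, Complex.norm_ofNat, norm_one,
      Real.norm_eq_abs]
    have := abs_nonneg (besselJ0' t)
    have := abs_nonneg (besselY0' t)
    have : 0 ≤ M * t⁻¹ := by positivity
    linarith
  obtain ⟨M₁, h1, h1'⟩ := isSymbol_amplitude (j := Complex.I) Complex.I_sq hd hd'
    (by positivity) zero_le_one le_rfl hb hb'
  obtain ⟨M₂, h2, h2'⟩ := isSymbol_amplitude (j := -Complex.I) (by rw [neg_sq, Complex.I_sq]) hd hd'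
    (by positivity) zero_le_one le_rfl hb hb'
  exact ⟨h', M₁ + M₂, by positivity, h1'.mono (by linarith) zero_le_one,
    h2'.mono (by linarith) zero_le_one⟩

/-- The `Y₀` parts cancel in `R₀⁺ - R₀⁻`, so there is no logarithm and `κ = 0`; this provides the
factor `√l` of the pairing. -/
theorem exists_isSymbol_inProfile : ∃ (h' : ℝ → ℂ) (M : ℝ), 0 ≤ M ∧
    IsSymbol (amplitude Complex.I inProfile h') M 0 ∧
    IsSymbol (amplitude (-Complex.I) inProfile h') M 0 := by
  obtain ⟨M, hM, -, hJ⟩ := besselJ0_bounds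
  set h' : ℝ → ℂ := fun t => Complex.I / 2 * besselJ0' t with hh'
  have hd : ∀ t, 0 < t → HasDerivAt inProfile (h' t) t := fun t ht =>
    (hasDerivAt_besselJ0 t).ofReal_comp.const_mul _
  have hd' : ∀ t, 0 < t → HasDerivAt h' (-inProfile t - h' t / t) t := fun t ht => by
    refine ((hasDerivAt_besselJ0' ht).ofReal_comp.const_mul (Complex.I / 2)).congr_deriv ?_
    simp only [inProfile, hh']
    push_cast
    ring
  have hb : ∀ t, 0 < t → ‖inProfile t‖ ≤ M * (√t)⁻¹ := fun t ht => by
    have h1 := (hJ t ht).1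
    rw [inProfile]
    simp only [norm_mul, norm_div, Complex.norm_I, Complex.norm_real, Complex.norm_ofNat,
      Real.norm_eq_abs]
    have := abs_nonneg (besselJ0 t)
    linarith
  have hb' : ∀ t, 0 < t → ‖h' t‖ ≤ M * ((√t)⁻¹ + 0 * t⁻¹) := fun t ht => by
    have h1 := (hJ t ht).2
    simp only [hh', norm_mul, norm_div, Complex.norm_I, Complex.norm_real, Complex.norm_ofNat,
      Real.norm_eq_abs]
    have := abs_nonneg (besselJ0' t)
    linarith
  obtain ⟨M₁, h1, h1'⟩ := isSymbol_amplitude (j := Complex.I) Complex.I_sq hd hd'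
    hM le_rfl zero_le_one hb hb'
  obtain ⟨M₂, h2, h2'⟩ := isSymbol_amplitude (j := -Complex.I) (by rw [neg_sq, Complex.I_sq]) hd hd'
    hM le_rfl zero_le_one hb hb'
  exact ⟨h', M₁ + M₂, by positivity, h1'.mono (by linarith) le_rfl,
    h2'.mono (by linarith) le_rfl⟩

/-- The class in `L²` of `z ↦ v(z) h(l|x - z|)`. -/
noncomputable def profileL2 (V : Plane → ℝ) (h : ℝ → ℂ) (x : Plane) (l : ℝ) : L2 :=
  toL2 fun z => (vfun V z : ℂ) * h (l * ‖x - z‖)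

theorem vfun_le_weight {V : Plane → ℝ} {ε C : ℝ}
    (hv : ∀ z, (1 + ‖z‖) ^ 2 * vfun V z ≤ C * weight ε z) (z : Plane) :
    vfun V z ≤ C * weight ε z :=
  le_trans (le_mul_of_one_le_left (vfun_nonneg V z)
    (one_le_pow₀ (by linarith [norm_nonneg z]))) (hv z)

theorem memLp_vfun {V : Plane → ℝ} (hV : Measurable V) {ε C : ℝ} (hε : 0 < ε)
    (hv : ∀ z, (1 + ‖z‖) ^ 2 * vfun V z ≤ C * weight ε z) :
    MemLp (fun z => (vfun V z : ℂ)) 2 (volume : Measure Plane) := by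
  refine (memLp_weight hε).of_le_mul (c := C)
    (Complex.continuous_ofReal.measurable.comp (measurable_vfun hV)).aestronglyMeasurable
    (Eventually.of_forall fun z => ?_)
  rw [Complex.norm_real, Real.norm_of_nonneg (vfun_nonneg V z),
    Real.norm_of_nonneg (weight_pos ε z).le]
  exact vfun_le_weight hv z

/-- Splitting a profile into its two phases, after subtraction of a multiple of `v`. -/
theorem profileL2_eq {V : Plane → ℝ} (hV : Measurable V) {ε C : ℝ} (hε : 0 < ε)
    (hv : ∀ z, (1 + ‖z‖) ^ 2 * vfun V z ≤ C * weight ε z) {h h' : ℝ → ℂ} {M κ : ℝ} (hM : 0 ≤ M)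
    (hκ : 0 ≤ κ) (h1 : IsSymbol (amplitude Complex.I h h') M κ)
    (h2 : IsSymbol (amplitude (-Complex.I) h h') M κ) (x : Plane) {l : ℝ} (hl : 0 < l) :
    profileL2 V h x l = h (l * (1 + ‖x‖)) • toL2 (fun z => (vfun V z : ℂ)) +
      (Complex.exp (Complex.I * (1 + ‖x‖ : ℝ) * l) •
        ampL2 V Complex.I (amplitude Complex.I h h') x 0 l +
      Complex.exp (-Complex.I * (1 + ‖x‖ : ℝ) * l) •
        ampL2 V (-Complex.I) (amplitude (-Complex.I) h h') x 0 l) := by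
  have m0 := memLp_vfun hV hε hv
  have m1 := memLp_vfun_mul_subAmp hV hε hv (Or.inl rfl) hM hκ h1 x hl (k := 0) (by norm_num)
  have m2 := memLp_vfun_mul_subAmp hV hε hv (Or.inr rfl) hM hκ h2 x hl (k := 0) (by norm_num)
  rw [ampL2, ampL2, ← toL2_const_mul m0, ← toL2_const_mul m1, ← toL2_const_mul m2,
    ← toL2_add (m1.const_mul _) (m2.const_mul _), profileL2]
  refine Eq.trans ?_ (toL2_add (m0.const_mul _) ((m1.const_mul _).add (m2.const_mul _)))
  congr 1
  funext z
  have e1 := amplitude_sum h h' (l * ‖x - z‖)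
  have e2 := amplitude_sum h h' (l * (1 + ‖x‖))
  -- The phase splits into a part independent of `z`, kept outside the `L²` class, and one whose
  -- frequency is at most `1 + |z|` in modulus.
  have e3 : ∀ j : ℂ, Complex.exp (j * (1 + ‖x‖ : ℝ) * l) *
      Complex.exp (j * (‖x - z‖ - (1 + ‖x‖ : ℝ)) * l) = Complex.exp (j * (l * ‖x - z‖ : ℝ)) := by
    intro j
    rw [← Complex.exp_add]
    congr 1
    push_cast
    ring
  have e4 : ∀ j : ℂ, Complex.exp (j * (1 + ‖x‖ : ℝ) * l) =
      Complex.exp (j * (l * (1 + ‖x‖) : ℝ)) := by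
    intro j
    congr 1
    push_cast
    ring
  rw [e1, e2]
  simp only [subAmp]
  rw [← e3, ← e3, ← e4, ← e4]
  ring

/-- The integrand, in the spectral parameter, of the kernel of the low energy operator. -/
noncomputable def spectralKernel (V : Plane → ℝ) (B : L2 →L[ℂ] L2) (x y : Plane) (l : ℝ) : ℂ :=
  inner ℂ (profileL2 V outProfile x l) (B (profileL2 V inProfile y l))

/-- The integral kernel of the low energy operator. -/
noncomputable def lowEnergyKernel (V : Plane → ℝ) (B : L2 →L[ℂ] L2) (χ : ℝ → ℝ) (x y : Plane) : ℂ :=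
  1 / ((Real.pi : ℂ) * Complex.I) *
    ∫ l in Set.Ioi (0 : ℝ), spectralKernel V B x y l * (l : ℂ) * (χ l : ℂ)

theorem norm_le_of_phase {I K N a ρ : ℝ} (hI : 0 ≤ I) (h : I * (1 + ρ ^ 2) ≤ K * N) (ha : 0 ≤ a)
    (haρ : a ≤ |ρ|) : I ≤ 2 * K * N * ((1 + a) ^ 2)⁻¹ := by
  rw [← div_eq_mul_inv, le_div_iff₀ (by positivity)]
  have h1 : a ^ 2 ≤ ρ ^ 2 := by rw [← sq_abs ρ]; gcongr
  have h2 : (1 + a) ^ 2 ≤ 2 * (1 + ρ ^ 2) := by nlinarith [sq_nonneg (1 - a)]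
  calc I * (1 + a) ^ 2 ≤ I * (2 * (1 + ρ ^ 2)) := by gcongr
    _ = 2 * (I * (1 + ρ ^ 2)) := by ring
    _ ≤ 2 * (K * N) := by gcongr
    _ = _ := by ring

/-- The two orthogonality conditions on `B` discard the subtracted multiples of `v`. The remaining
four pairings oscillate with frequencies `±X ± Y`, and their amplitudes carry the factor `X^(-1/2)
Y^(-1/2)`. -/
theorem exists_norm_lowEnergyKernel_le {V : Plane → ℝ} (hV : Measurable V) {ε C : ℝ} (hε : 0 < ε)
    (hC : 0 ≤ C) (hv : ∀ z, (1 + ‖z‖) ^ 2 * vfun V z ≤ C * weight ε z) {χ : ℝ → ℝ}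
    (hχ : ContDiff ℝ ∞ χ) {L : ℝ} (hL : 0 < L) (hχL : ∀ l, L ≤ l → χ l = 0)
    (hχL' : deriv χ L = 0) {B : L2 →L[ℂ] L2} (hB : B (toL2 fun z => (vfun V z : ℂ)) = 0)
    (hB' : ∀ g, inner ℂ (toL2 fun z => (vfun V z : ℂ)) (B g) = 0) :
    ∃ K, 0 ≤ K ∧ ∀ x y, ‖lowEnergyKernel V B χ x y‖ ≤ K * radialKernel x y := by
  obtain ⟨p', M, hM, hp1, hp2⟩ := exists_isSymbol_outProfile
  obtain ⟨q', M', hM', hq1, hq2⟩ := exists_isSymbol_inProfile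
  obtain ⟨N₁, hN₁, hF₁⟩ := exists_isL2Symbol_ampL2 hV hε hC hv (Or.inl rfl) hM zero_le_one hp1 hL.le
  obtain ⟨N₂, hN₂, hF₂⟩ := exists_isL2Symbol_ampL2 hV hε hC hv (Or.inr rfl) hM zero_le_one hp2 hL.le
  obtain ⟨N₃, hN₃, hG₁⟩ := exists_isL2Symbol_ampL2 hV hε hC hv (Or.inl rfl) hM' le_rfl hq1 hL.le
  obtain ⟨N₄, hN₄, hG₂⟩ := exists_isL2Symbol_ampL2 hV hε hC hv (Or.inr rfl) hM' le_rfl hq2 hL.le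
  obtain ⟨K, hK, hosc⟩ := exists_norm_integral_pairing_le hχ hL hχL hχL' B
  refine ⟨2 * K * ((N₁ + N₂) * (N₃ + N₄)), by positivity, fun x y => ?_⟩
  set X := 1 + ‖x‖ with hX
  set Y := 1 + ‖y‖ with hY
  set a := |‖x‖ - ‖y‖| with ha
  have hX0 : 0 ≤ (√X)⁻¹ := by positivity
  have hY0 : 0 ≤ (√Y)⁻¹ := by positivity
  have hxn := norm_nonneg x
  have hyn := norm_nonneg y
  -- Each of the four frequencies dominates `||x| - |y||`, so a single decay factor serves for all.
  have ha1 : a ≤ |-X + Y| := by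
    rw [ha, abs_sub_comm]; exact le_of_eq (by congr 1; rw [hX, hY]; ring)
  have ha2 : a ≤ |-X + -Y| := by
    rw [ha, ← neg_add, abs_neg, abs_of_nonneg (by positivity : 0 ≤ X + Y), abs_le]
    constructor <;> linarith
  have ha3 : a ≤ |X + Y| := by
    rwa [← neg_add, abs_neg] at ha2
  have ha4 : a ≤ |X + -Y| := by
    rw [ha]; exact le_of_eq (by congr 1; rw [hX, hY]; ring)
  have o1 := hosc _ _ _ _ (by positivity) (by positivity) (hF₁ x) (hG₁ y) (-X + Y)
  have o2 := hosc _ _ _ _ (by positivity) (by positivity) (hF₁ x) (hG₂ y) (-X + -Y)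
  have o3 := hosc _ _ _ _ (by positivity) (by positivity) (hF₂ x) (hG₁ y) (X + Y)
  have o4 := hosc _ _ _ _ (by positivity) (by positivity) (hF₂ x) (hG₂ y) (X + -Y)
  have hsum : ∫ l in Set.Ioi (0 : ℝ), spectralKernel V B x y l * (l : ℂ) * (χ l : ℂ) = _ :=
    (setIntegral_congr_fun measurableSet_Ioi fun l hl => ?_).trans
      ((integral_add (o1.1.add o2.1) (o3.1.add o4.1)).trans
        (congrArg₂ (· + ·) (integral_add o1.1 o2.1) (integral_add o3.1 o4.1)))
  · rw [lowEnergyKernel, hsum]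
    have b1 := norm_le_of_phase (norm_nonneg _) o1.2 (abs_nonneg _) ha1
    have b2 := norm_le_of_phase (norm_nonneg _) o2.2 (abs_nonneg _) ha2
    have b3 := norm_le_of_phase (norm_nonneg _) o3.2 (abs_nonneg _) ha3
    have b4 := norm_le_of_phase (norm_nonneg _) o4.2 (abs_nonneg _) ha4
    have hπ : ‖(1 : ℂ) / ((Real.pi : ℂ) * Complex.I)‖ ≤ 1 := by
      rw [norm_div, norm_mul, Complex.norm_I, Complex.norm_real, norm_one, mul_one,
        Real.norm_of_nonneg Real.pi_pos.le]
      exact (div_le_one Real.pi_pos).2 (by linarith [Real.pi_gt_three])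
    rw [norm_mul]
    refine (mul_le_of_le_one_left (norm_nonneg _) hπ).trans ?_
    refine (norm_add_le _ _).trans ((add_le_add (norm_add_le _ _) (norm_add_le _ _)).trans ?_)
    refine (add_le_add (add_le_add b1 b2) (add_le_add b3 b4)).trans (le_of_eq ?_)
    rw [radialKernel]
    ring
  · have hl0 : 0 < l := hl
    simp only [Pi.add_apply]
    rw [spectralKernel, profileL2_eq hV hε hv hM zero_le_one hp1 hp2 x hl0,
      profileL2_eq hV hε hv hM' le_rfl hq1 hq2 y hl0]
    -- The terms containing `h(l(1+|x|)) v` disappear here: `hB` removes them on the right and `hB'`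
    -- on the left.
    simp only [map_add, map_smul, hB, smul_zero, zero_add, inner_add_left, inner_add_right,
      inner_smul_left, inner_smul_right, hB', mul_zero]
    have hconj : ∀ (j : ℂ) (r : ℝ), (starRingEnd ℂ) (Complex.exp (j * r * l)) =
        Complex.exp ((starRingEnd ℂ) j * r * l) := fun j r => by
      rw [← Complex.exp_conj, map_mul, map_mul, Complex.conj_ofReal, Complex.conj_ofReal]
    have hexp : ∀ (j k : ℂ) (s : ℝ), j * X + k * Y = Complex.I * s →
        Complex.exp (j * X * l) * Complex.exp (k * Y * l) = Complex.exp (Complex.I * s * l) :=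
      fun j k s h => by rw [← Complex.exp_add, ← add_mul, h]
    rw [hconj, hconj, map_neg, Complex.conj_I, neg_neg,
      ← hexp (-Complex.I) Complex.I (-X + Y) (by push_cast; ring),
      ← hexp (-Complex.I) (-Complex.I) (-X + -Y) (by push_cast; ring),
      ← hexp Complex.I Complex.I (X + Y) (by push_cast; ring),
      ← hexp Complex.I (-Complex.I) (X + -Y) (by push_cast; ring)]
    ring

/-! ### Convergence of the integrals and reduction to the integral kernel -/

theorem measurable_vfun_complex {V : Plane → ℝ} (hV : Measurable V) :
    Measurable fun z => (vfun V z : ℂ) :=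
  Complex.continuous_ofReal.measurable.comp (measurable_vfun hV)

/-- A crude bound without cancellation, sufficient for absolute convergence because the spectral
integral contains the factor `l`. -/
theorem exists_profileL2_out_bound {V : Plane → ℝ} (hV : Measurable V) {ε C : ℝ} (hε : 0 < ε)
    (hC : 0 ≤ C) (hv : ∀ z, (1 + ‖z‖) ^ 2 * vfun V z ≤ C * weight ε z) :
    ∃ A, 0 ≤ A ∧ ∀ x l, 0 < l →
      MemLp (fun z => (vfun V z : ℂ) * outProfile (l * ‖x - z‖)) 2 (volume : Measure Plane) ∧
      ‖profileL2 V outProfile x l‖ ≤ A * (√l)⁻¹ := by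
  obtain ⟨M, hM, hb⟩ := exists_norm_outProfile_le
  obtain ⟨C₁, hC₁, hE⟩ := exists_envelope_bound hε
  refine ⟨M * C * C₁, by positivity, fun x l hl => ?_⟩
  have hle : ∀ᵐ z, ‖(vfun V z : ℂ) * outProfile (l * ‖x - z‖)‖ ≤
      M * C * (√l)⁻¹ * ‖envelope ε x z‖ := by
    filter_upwards [ae_norm_sub_pos x] with z hz
    have h1 := hb _ (mul_pos hl hz)
    rw [Real.sqrt_mul hl.le, mul_inv] at h1
    rw [norm_mul, Complex.norm_real, Real.norm_of_nonneg (vfun_nonneg V z),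
      Real.norm_of_nonneg (envelope_nonneg ε x z), envelope]
    have hw := weight_pos ε z
    have h0 : 0 ≤ (√(1 + ‖x‖))⁻¹ := by positivity
    calc vfun V z * ‖outProfile (l * ‖x - z‖)‖
        ≤ (C * weight ε z) * (M * ((√l)⁻¹ * (√‖x - z‖)⁻¹)) :=
          mul_le_mul (vfun_le_weight hv z) h1 (norm_nonneg _) (by positivity)
      _ = M * C * (√l)⁻¹ * (weight ε z * (√‖x - z‖)⁻¹) := by ring
      _ ≤ _ := by gcongr; linarith
  have hm : Measurable fun z => (vfun V z : ℂ) * outProfile (l * ‖x - z‖) :=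
    (measurable_vfun_complex hV).mul (measurable_outProfile.comp (by fun_prop))
  refine ⟨(hE x).1.of_le_mul hm.aestronglyMeasurable hle, ?_⟩
  refine (norm_toL2_le (by positivity) (hE x).1 hle).trans ?_
  have h1 : (√(1 + ‖x‖))⁻¹ ≤ 1 :=
    inv_le_one_of_one_le₀ (Real.one_le_sqrt.2 (by linarith [norm_nonneg x]))
  calc M * C * (√l)⁻¹ * (eLpNorm (envelope ε x) 2 volume).toReal
      ≤ M * C * (√l)⁻¹ * (C₁ * 1) :=
        mul_le_mul_of_nonneg_left ((hE x).2.trans (by gcongr)) (by positivity)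
    _ = _ := by ring

theorem exists_profileL2_in_bound {V : Plane → ℝ} (hV : Measurable V) {ε C : ℝ} (hε : 0 < ε)
    (hv : ∀ z, (1 + ‖z‖) ^ 2 * vfun V z ≤ C * weight ε z) :
    ∃ A, 0 ≤ A ∧ ∀ x l,
      MemLp (fun z => (vfun V z : ℂ) * inProfile (l * ‖x - z‖)) 2 (volume : Measure Plane) ∧
      ‖profileL2 V inProfile x l‖ ≤ A := by
  obtain ⟨M, hM, hb⟩ := exists_norm_inProfile_le
  have h2 := memLp_vfun hV hε hv
  refine ⟨M * (eLpNorm (fun z => ‖(vfun V z : ℂ)‖) 2 volume).toReal, by positivity, fun x l => ?_⟩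
  have hle : ∀ᵐ z, ‖(vfun V z : ℂ) * inProfile (l * ‖x - z‖)‖ ≤ M * ‖‖(vfun V z : ℂ)‖‖ :=
    Eventually.of_forall fun z => by
      rw [norm_mul, norm_norm, mul_comm]
      exact mul_le_mul_of_nonneg_right (hb _) (norm_nonneg _)
  have hm : Measurable fun z => (vfun V z : ℂ) * inProfile (l * ‖x - z‖) :=
    (measurable_vfun_complex hV).mul (continuous_inProfile.measurable.comp (by fun_prop))
  exact ⟨h2.norm.of_le_mul hm.aestronglyMeasurable hle, norm_toL2_le hM h2.norm hle⟩

theorem exists_stronglyMeasurable_spectralKernel {V : Plane → ℝ} (hV : Measurable V) {ε C : ℝ}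
    (hε : 0 < ε) (hC : 0 ≤ C) (hv : ∀ z, (1 + ‖z‖) ^ 2 * vfun V z ≤ C * weight ε z)
    (B : L2 →L[ℂ] L2) :
    ∃ φ : (Plane × Plane) × ℝ → ℂ, StronglyMeasurable φ ∧
      ∀ x y l, 0 < l → φ ((x, y), l) = spectralKernel V B x y l := by
  obtain ⟨A, hA, hout⟩ := exists_profileL2_out_bound hV hε hC hv
  obtain ⟨A', hA', hin⟩ := exists_profileL2_in_bound hV hε hv
  -- The profile is cut off at `l ≤ 0`, where its bounds fail, so that every member of the family
  -- lies in `L²`.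
  set F : (Plane × Plane) × ℝ → Plane → ℂ := fun p z =>
    (vfun V z : ℂ) * if 0 < p.2 then outProfile (p.2 * ‖p.1.1 - z‖) else 0 with hF
  have hFm : StronglyMeasurable fun p => toL2 (F p) := by
    refine stronglyMeasurable_toL2 ?_ fun p => ?_
    · refine ((measurable_vfun_complex hV).comp measurable_snd).mul
        (Measurable.ite (measurableSet_lt measurable_const (by fun_prop))
          (measurable_outProfile.comp (by fun_prop)) measurable_const)
    · by_cases h : 0 < p.2
      · simpa only [hF, if_pos h] using (hout p.1.1 p.2 h).1
      · simp only [hF, if_neg h, mul_zero]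
        exact MemLp.zero'
  have hGm : StronglyMeasurable fun p : (Plane × Plane) × ℝ => profileL2 V inProfile p.1.2 p.2 := by
    refine stronglyMeasurable_toL2 ?_ fun p => (hin p.1.2 p.2).1
    exact ((measurable_vfun_complex hV).comp measurable_snd).mul
      (continuous_inProfile.measurable.comp (by fun_prop))
  refine ⟨fun p => inner ℂ (toL2 (F p)) (B (profileL2 V inProfile p.1.2 p.2)),
    hFm.inner (B.continuous.comp_stronglyMeasurable hGm), fun x y l hl => ?_⟩
  simp only [hF, if_pos hl]
  rfl

theorem measurable_lowEnergyKernel {V : Plane → ℝ} (hV : Measurable V) {ε C : ℝ}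
    (hε : 0 < ε) (hC : 0 ≤ C) (hv : ∀ z, (1 + ‖z‖) ^ 2 * vfun V z ≤ C * weight ε z)
    (B : L2 →L[ℂ] L2) {χ : ℝ → ℝ} (hχ : Continuous χ) :
    StronglyMeasurable fun p : Plane × Plane => lowEnergyKernel V B χ p.1 p.2 := by
  obtain ⟨φ, hφ, h⟩ := exists_stronglyMeasurable_spectralKernel hV hε hC hv B
  have hc : StronglyMeasurable fun q : (Plane × Plane) × ℝ => φ q * (q.2 : ℂ) * (χ q.2 : ℂ) :=
    (hφ.mul (by fun_prop : Continuous fun q : (Plane × Plane) × ℝ => (q.2 : ℂ)).stronglyMeasurable).mul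
      (by fun_prop : Continuous fun q : (Plane × Plane) × ℝ => (χ q.2 : ℂ)).stronglyMeasurable
  have h2 := (hc.integral_prod_right' (ν := volume.restrict (Set.Ioi (0 : ℝ)))).const_mul
    (1 / ((Real.pi : ℂ) * Complex.I))
  refine (congrArg StronglyMeasurable (funext fun p => ?_)).mp h2
  rw [lowEnergyKernel]
  congr 1
  refine setIntegral_congr_fun measurableSet_Ioi fun l hl => ?_
  simp only [← h p.1 p.2 l hl]

theorem integrable_inProfile_mul {u : Plane → ℂ} (hu : Integrable u) (l : ℝ) (w : Plane) :
    Integrable fun y => inProfile (l * ‖w - y‖) * u y := by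
  obtain ⟨M, hM, hb⟩ := exists_norm_inProfile_le
  refine hu.bdd_mul (c := M) ?_ (Eventually.of_forall fun y => hb _)
  exact (continuous_inProfile.comp (by fun_prop)).aestronglyMeasurable

theorem memLp_vfun_mul_resDiff {V : Plane → ℝ} (hV : Measurable V) {ε C : ℝ} (hε : 0 < ε)
    (hv : ∀ z, (1 + ‖z‖) ^ 2 * vfun V z ≤ C * weight ε z) {u : Plane → ℂ} (hu : Integrable u)
    (l : ℝ) : MemLp (fun w => (vfun V w : ℂ) * resDiff l u w) 2 (volume : Measure Plane) := by
  obtain ⟨M, hM, hb⟩ := exists_norm_inProfile_le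
  have hb' : ∀ w, ‖resDiff l u w‖ ≤ M * ∫ y, ‖u y‖ := fun w => by
    rw [resDiff, ← integral_const_mul]
    refine norm_integral_le_of_norm_le (hu.norm.const_mul M) (Eventually.of_forall fun y => ?_)
    rw [freeResPlus_sub_freeResMinus, norm_mul]
    exact mul_le_mul_of_nonneg_right (hb _) (norm_nonneg _)
  have hm : AEStronglyMeasurable (resDiff l u) volume := by
    have h1 : AEStronglyMeasurable (fun p : Plane × Plane => inProfile (l * ‖p.1 - p.2‖) * u p.2)
        (volume.prod volume) :=
      (continuous_inProfile.comp (by fun_prop)).aestronglyMeasurable.mul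
        hu.aestronglyMeasurable.comp_snd
    have h2 := h1.integral_prod_right'
    simp only [← freeResPlus_sub_freeResMinus] at h2
    exact h2
  refine (memLp_vfun hV hε hv).of_le_mul (c := M * ∫ y, ‖u y‖)
    ((measurable_vfun_complex hV).aestronglyMeasurable.mul hm) (Eventually.of_forall fun w => ?_)
  rw [norm_mul, mul_comm]
  exact mul_le_mul_of_nonneg_right (hb' w) (norm_nonneg _)

theorem freeResMinus_mul_eq (V : Plane → ℝ) (l : ℝ) (x z : Plane) (c : ℂ) :
    freeResMinus l x z * ((vfun V z : ℂ) * c) =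
      c * (starRingEnd ℂ) ((vfun V z : ℂ) * outProfile (l * ‖x - z‖)) := by
  rw [freeResMinus_eq, map_mul, Complex.conj_ofReal]
  ring

/-- `R₀⁻ v B v [R₀⁺ - R₀⁻]` is the integral operator with kernel `spectralKernel`. -/
theorem sandwich_eq {V : Plane → ℝ} (hV : Measurable V) {ε C : ℝ} (hε : 0 < ε) (hC : 0 ≤ C)
    (hv : ∀ z, (1 + ‖z‖) ^ 2 * vfun V z ≤ C * weight ε z) (B : L2 →L[ℂ] L2) {u : Plane → ℂ}
    (hu : Integrable u) {l : ℝ} (hl : 0 < l) (x : Plane) :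
    sandwich V B l u x = ∫ y, spectralKernel V B x y l * u y := by
  obtain ⟨A, hA, hout⟩ := exists_profileL2_out_bound hV hε hC hv
  obtain ⟨A', hA', hin⟩ := exists_profileL2_in_bound hV hε hv
  obtain ⟨M, hM, hb⟩ := exists_norm_inProfile_le
  have h1 : sandwich V B l u x = inner ℂ (profileL2 V outProfile x l)
      (B (toL2 fun w => (vfun V w : ℂ) * resDiff l u w)) := by
    rw [profileL2, inner_toL2_left (hout x l hl).1, sandwich]
    simp only [freeResMinus_mul_eq]
  -- Moving `B` to the left factor leaves a scalar double integral in `w` and `y` against a fixed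
  -- `L²` function; Fubini's theorem applies since `v k̄` and `u` are integrable and the profile is
  -- bounded.
  set k := ContinuousLinearMap.adjoint B (profileL2 V outProfile x l) with hk
  rw [h1, ← ContinuousLinearMap.adjoint_inner_left, ← hk,
    inner_toL2_right (memLp_vfun_mul_resDiff hV hε hv hu l)]
  have hvk : Integrable fun w => (vfun V w : ℂ) * (starRingEnd ℂ) (k w) :=
    integrable_mul_conj (Lp.memLp k) (memLp_vfun hV hε hv)
  have hprod : Integrable (fun p : Plane × Plane => inProfile (l * ‖p.1 - p.2‖) *
      (((vfun V p.1 : ℂ) * (starRingEnd ℂ) (k p.1)) * u p.2)) (volume.prod volume) := by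
    refine (hvk.mul_prod hu).bdd_mul (c := M) ?_ (Eventually.of_forall fun p => hb _)
    exact (continuous_inProfile.comp (by fun_prop)).aestronglyMeasurable
  calc ∫ w, (vfun V w : ℂ) * resDiff l u w * (starRingEnd ℂ) (k w)
      = ∫ w, ∫ y, inProfile (l * ‖w - y‖) * (((vfun V w : ℂ) * (starRingEnd ℂ) (k w)) * u y) := by
        refine integral_congr_ae (Eventually.of_forall fun w => ?_)
        simp only [resDiff, freeResPlus_sub_freeResMinus]
        rw [mul_right_comm, ← integral_const_mul]
        refine integral_congr_ae (Eventually.of_forall fun y => ?_)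
        simp only
        ring
    _ = ∫ y, ∫ w, inProfile (l * ‖w - y‖) * (((vfun V w : ℂ) * (starRingEnd ℂ) (k w)) * u y) :=
        integral_integral_swap hprod
    _ = ∫ y, spectralKernel V B x y l * u y := by
        refine integral_congr_ae (Eventually.of_forall fun y => ?_)
        simp only
        rw [spectralKernel, ← ContinuousLinearMap.adjoint_inner_left, ← hk, profileL2,
          inner_toL2_right (hin y l).1, ← integral_mul_const]
        refine integral_congr_ae (Eventually.of_forall fun w => ?_)
        simp only
        rw [norm_sub_rev]
        ring

theorem integrableOn_sqrt_mul {χ : ℝ → ℝ} (hχ : Continuous χ) {L : ℝ} (hχL : ∀ l, L ≤ l → χ l = 0) :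
    IntegrableOn (fun l => √l * |χ l|) (Set.Ioi 0) := by
  have hc : Continuous fun l => √l * |χ l| := by fun_prop
  have h1 : IntegrableOn (fun l => √l * |χ l|) (Set.Icc 0 L) := hc.continuousOn.integrableOn_Icc
  refine h1.of_forall_sdiff_eq_zero measurableSet_Ioi fun l hl => ?_
  have : L ≤ l := by
    by_contra h
    exact hl.2 ⟨(show (0 : ℝ) < l from hl.1).le, (not_le.1 h).le⟩
  rw [hχL l this, abs_zero, mul_zero]

/-- Absolute convergence of the double integral over the spectral parameter and space. -/
theorem integrable_spectralKernel {V : Plane → ℝ} (hV : Measurable V) {ε C : ℝ} (hε : 0 < ε)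
    (hC : 0 ≤ C) (hv : ∀ z, (1 + ‖z‖) ^ 2 * vfun V z ≤ C * weight ε z) (B : L2 →L[ℂ] L2)
    {χ : ℝ → ℝ} (hχ : Continuous χ) {L : ℝ} (hχL : ∀ l, L ≤ l → χ l = 0) {u : Plane → ℂ}
    (hu : Integrable u) (x : Plane) :
    Integrable (fun p : ℝ × Plane => spectralKernel V B x p.2 p.1 * p.1 * χ p.1 * u p.2)
      ((volume.restrict (Set.Ioi 0)).prod volume) := by
  obtain ⟨A, hA, hout⟩ := exists_profileL2_out_bound hV hε hC hv
  obtain ⟨A', hA', hin⟩ := exists_profileL2_in_bound hV hε hv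
  obtain ⟨φ, hφ, h⟩ := exists_stronglyMeasurable_spectralKernel hV hε hC hv B
  have hpos : ∀ᵐ p : ℝ × Plane ∂((volume.restrict (Set.Ioi 0)).prod volume), 0 < p.1 :=
    Measure.quasiMeasurePreserving_fst.ae (ae_restrict_mem measurableSet_Ioi)
  refine (((integrableOn_sqrt_mul hχ hχL).const_mul (A * ‖B‖ * A')).mul_prod hu.norm).mono' ?_ ?_
  · have hm : StronglyMeasurable fun p : ℝ × Plane => φ ((x, p.2), p.1) * (p.1 : ℂ) * (χ p.1 : ℂ) :=
      ((hφ.comp_measurable (by fun_prop)).mul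
        (by fun_prop : Continuous fun p : ℝ × Plane => (p.1 : ℂ)).stronglyMeasurable).mul
        (by fun_prop : Continuous fun p : ℝ × Plane => (χ p.1 : ℂ)).stronglyMeasurable
    refine (hm.aestronglyMeasurable.mul hu.aestronglyMeasurable.comp_snd).congr ?_
    filter_upwards [hpos] with p hp
    simp only [Pi.mul_apply, h x p.2 p.1 hp]
  · filter_upwards [hpos] with p hp
    rw [norm_mul, norm_mul, norm_mul, Complex.norm_real, Complex.norm_real, Real.norm_eq_abs,
      Real.norm_eq_abs, abs_of_pos hp]
    refine mul_le_mul_of_nonneg_right ?_ (norm_nonneg _)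
    have hs : (√p.1)⁻¹ * p.1 = √p.1 := by
      rw [inv_mul_eq_div, div_eq_iff (Real.sqrt_pos.2 hp).ne', Real.mul_self_sqrt hp.le]
    have hk : ‖spectralKernel V B x p.2 p.1‖ ≤ A * (√p.1)⁻¹ * (‖B‖ * A') := by
      refine (norm_inner_le_norm _ _).trans ?_
      refine mul_le_mul (hout x p.1 hp).2 ?_ (norm_nonneg _) (by positivity)
      exact (B.le_opNorm _).trans (mul_le_mul_of_nonneg_left (hin p.2 p.1).2 (norm_nonneg _))
    calc ‖spectralKernel V B x p.2 p.1‖ * p.1 * |χ p.1|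
        ≤ A * (√p.1)⁻¹ * (‖B‖ * A') * p.1 * |χ p.1| :=
          mul_le_mul_of_nonneg_right (mul_le_mul_of_nonneg_right hk hp.le) (abs_nonneg _)
      _ = A * ‖B‖ * A' * (((√p.1)⁻¹ * p.1) * |χ p.1|) := by ring
      _ = _ := by rw [hs]

theorem sandwich_mul_eq {V : Plane → ℝ} (hV : Measurable V) {ε C : ℝ} (hε : 0 < ε) (hC : 0 ≤ C)
    (hv : ∀ z, (1 + ‖z‖) ^ 2 * vfun V z ≤ C * weight ε z) (B : L2 →L[ℂ] L2) (χ : ℝ → ℝ)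
    {u : Plane → ℂ} (hu : Integrable u) {l : ℝ} (hl : 0 < l) (x : Plane) :
    sandwich V B l u x * (l : ℂ) * (χ l : ℂ) =
      ∫ y, spectralKernel V B x y l * l * χ l * u y := by
  rw [sandwich_eq hV hε hC hv B hu hl, mul_assoc, ← integral_mul_const]
  refine integral_congr_ae (Eventually.of_forall fun y => ?_)
  simp only
  ring

theorem opConverges {V : Plane → ℝ} (hV : Measurable V) {ε C : ℝ} (hε : 0 < ε)
    (hC : 0 ≤ C) (hv : ∀ z, (1 + ‖z‖) ^ 2 * vfun V z ≤ C * weight ε z) (B : L2 →L[ℂ] L2)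
    {χ : ℝ → ℝ} (hχ : Continuous χ) {L : ℝ} (hχL : ∀ l, L ≤ l → χ l = 0) {u : Plane → ℂ}
    (hu : Integrable u) : OpConverges V B χ u := by
  obtain ⟨A, hA, hout⟩ := exists_profileL2_out_bound hV hε hC hv
  refine ⟨fun l hl => ⟨fun w => ?_, memLp_vfun_mul_resDiff hV hε hv hu l, fun x => ?_⟩, fun x => ?_⟩
  · simpa only [freeResPlus_sub_freeResMinus] using integrable_inProfile_mul hu l w
  · simp only [freeResMinus_mul_eq]
    exact integrable_mul_conj (hout x l hl).1 (Lp.memLp _)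
  · refine ((integrable_spectralKernel hV hε hC hv B hχ hχL hu x).integral_prod_left).congr ?_
    filter_upwards [ae_restrict_mem measurableSet_Ioi] with l hl
    exact (sandwich_mul_eq hV hε hC hv B χ hu hl x).symm

theorem lowEnergyOp_eq {V : Plane → ℝ} (hV : Measurable V) {ε C : ℝ} (hε : 0 < ε)
    (hC : 0 ≤ C) (hv : ∀ z, (1 + ‖z‖) ^ 2 * vfun V z ≤ C * weight ε z) (B : L2 →L[ℂ] L2)
    {χ : ℝ → ℝ} (hχ : Continuous χ) {L : ℝ} (hχL : ∀ l, L ≤ l → χ l = 0) {u : Plane → ℂ}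
    (hu : Integrable u) (x : Plane) :
    lowEnergyOp V B χ u x = ∫ y, lowEnergyKernel V B χ x y * u y := by
  have h1 : ∫ l in Set.Ioi (0 : ℝ), sandwich V B l u x * (l : ℂ) * (χ l : ℂ) =
      ∫ l in Set.Ioi (0 : ℝ), ∫ y, spectralKernel V B x y l * l * χ l * u y :=
    setIntegral_congr_fun measurableSet_Ioi fun l hl => sandwich_mul_eq hV hε hC hv B χ hu hl x
  rw [lowEnergyOp, h1, integral_integral_swap (integrable_spectralKernel hV hε hC hv B hχ hχL hu x),
    ← integral_const_mul]
  refine integral_congr_ae (Eventually.of_forall fun y => ?_)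
  simp only [lowEnergyKernel]
  rw [integral_mul_const, mul_assoc]

/-! ### Schur's test -/

section Schur

variable {α : Type*} [MeasurableSpace α] {μ : Measure α}

/-- Hölder's inequality for the measure with density `k`, whose total mass is at most `C`. -/
theorem lintegral_mul_enorm_le {k : α → ℝ≥0∞} (hk : Measurable k) {C : ℝ≥0∞}
    (hkC : ∫⁻ y, k y ∂μ ≤ C) {u : α → ℂ} (hu : AEStronglyMeasurable u μ) {p : ℝ≥0∞} (hp : 1 ≤ p) :
    ∫⁻ y, k y * ‖u y‖ₑ ∂μ ≤ eLpNorm u p (μ.withDensity k) * C ^ (1 - 1 / p.toReal) := by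
  have hac : μ.withDensity k ≪ μ := withDensity_absolutelyContinuous μ k
  have h := eLpNorm_le_eLpNorm_mul_rpow_measure_univ hp (hu.mono_ac hac)
  rw [eLpNorm_one_eq_lintegral_enorm, lintegral_withDensity_eq_lintegral_mul₀' hk.aemeasurable
    ((hu.mono_ac hac).enorm), withDensity_apply _ MeasurableSet.univ, setLIntegral_univ] at h
  refine h.trans ?_
  have h1 : 0 ≤ 1 - 1 / p.toReal := by
    rcases eq_or_ne p ⊤ with rfl | hpt
    · simp
    · have : 1 ≤ p.toReal := by
        rw [← ENNReal.toReal_one]; exact ENNReal.toReal_mono hpt hp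
      rw [sub_nonneg]
      exact (div_le_one (by linarith)).2 this
  rw [ENNReal.toReal_one, div_one]
  gcongr

/-- For finite `p` the row bound gives `C^(p-1)` through Hölder's inequality, and the column bound
gives one more `C` through Tonelli's theorem. For `p = ∞` the row bound suffices. -/
theorem eLpNorm_lintegral_le [SFinite μ] {k : α → α → ℝ≥0∞} (hk : Measurable (Function.uncurry k)) {C : ℝ≥0∞}
    (hC : C ≠ ⊤) (h1 : ∀ x, ∫⁻ y, k x y ∂μ ≤ C) (h2 : ∀ y, ∫⁻ x, k x y ∂μ ≤ C) {u : α → ℂ}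
    (hu : AEStronglyMeasurable u μ) {p : ℝ≥0∞} (hp : 1 ≤ p) :
    eLpNorm (fun x => ∫⁻ y, k x y * ‖u y‖ₑ ∂μ) p μ ≤ C * eLpNorm u p μ := by
  have hkx : ∀ x, Measurable (k x) := fun x => hk.of_uncurry_left
  have hky : ∀ y, Measurable fun x => k x y := fun y => hk.of_uncurry_right
  have hpt := fun x => lintegral_mul_enorm_le (hkx x) (h1 x) hu hp
  rcases eq_or_ne p ⊤ with rfl | hp'
  · rw [eLpNorm_exponent_top, eLpNorm_exponent_top]
    refine eLpNormEssSup_le_of_ae_enorm_bound (Eventually.of_forall fun x => ?_)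
    rw [enorm_eq_self]
    refine (hpt x).trans ?_
    simp only [ENNReal.toReal_top, div_zero, sub_zero, ENNReal.rpow_one, eLpNorm_exponent_top]
    rw [mul_comm]
    gcongr
    exact (withDensity_absolutelyContinuous μ (k x))
  · have hp0 : p ≠ 0 := (zero_lt_one.trans_le hp).ne'
    have hq : 1 ≤ p.toReal := by
      rw [← ENNReal.toReal_one]; exact ENNReal.toReal_mono hp' hp
    set q := p.toReal with hqd
    have hq0 : 0 < q := by linarith
    have hx : ∀ x, (∫⁻ y, k x y * ‖u y‖ₑ ∂μ) ^ q ≤ C ^ (q - 1) * ∫⁻ y, k x y * ‖u y‖ₑ ^ q ∂μ := by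
      intro x
      have hac : μ.withDensity (k x) ≪ μ := withDensity_absolutelyContinuous μ (k x)
      refine (ENNReal.rpow_le_rpow (hpt x) hq0.le).trans (le_of_eq ?_)
      rw [ENNReal.mul_rpow_of_nonneg _ _ hq0.le, ← ENNReal.rpow_mul,
        eLpNorm_eq_lintegral_rpow_enorm_toReal hp0 hp', ← ENNReal.rpow_mul, ← hqd,
        one_div_mul_cancel hq0.ne', ENNReal.rpow_one,
        lintegral_withDensity_eq_lintegral_mul₀' (hkx x).aemeasurable
          ((hu.mono_ac hac).enorm.pow_const q), mul_comm]
      congr 2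
      field_simp
    rw [eLpNorm_eq_lintegral_rpow_enorm_toReal hp0 hp', eLpNorm_eq_lintegral_rpow_enorm_toReal hp0 hp',
      ← hqd]
    have hm : AEMeasurable (Function.uncurry fun x y => k x y * ‖u y‖ₑ ^ q) (μ.prod μ) :=
      hk.aemeasurable.mul (hu.comp_snd.enorm.pow_const q)
    have hfin : ∫⁻ x, ‖∫⁻ y, k x y * ‖u y‖ₑ ∂μ‖ₑ ^ q ∂μ ≤ C ^ q * ∫⁻ y, ‖u y‖ₑ ^ q ∂μ := by
      calc ∫⁻ x, ‖∫⁻ y, k x y * ‖u y‖ₑ ∂μ‖ₑ ^ q ∂μ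
          ≤ ∫⁻ x, C ^ (q - 1) * ∫⁻ y, k x y * ‖u y‖ₑ ^ q ∂μ ∂μ := by
            refine lintegral_mono fun x => ?_
            rw [enorm_eq_self]
            exact hx x
        _ = C ^ (q - 1) * ∫⁻ y, ∫⁻ x, k x y * ‖u y‖ₑ ^ q ∂μ ∂μ := by
            rw [lintegral_const_mul' _ _ (ENNReal.rpow_ne_top_of_nonneg (by linarith) hC),
              lintegral_lintegral_swap hm]
        _ ≤ C ^ (q - 1) * ∫⁻ y, C * ‖u y‖ₑ ^ q ∂μ := by
            gcongr with y
            rw [lintegral_mul_const _ (hky y)]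
            gcongr
            exact h2 y
        _ = C ^ (q - 1) * C * ∫⁻ y, ‖u y‖ₑ ^ q ∂μ := by
            rw [lintegral_const_mul' _ _ hC, mul_assoc]
        _ = _ := by
            congr 1
            nth_rewrite 2 [← ENNReal.rpow_one C]
            rw [← ENNReal.rpow_add_of_nonneg _ _ (by linarith) zero_le_one, sub_add_cancel]
    refine (ENNReal.rpow_le_rpow hfin (by positivity : 0 ≤ 1 / q)).trans (le_of_eq ?_)
    rw [ENNReal.mul_rpow_of_nonneg _ _ (by positivity), ← ENNReal.rpow_mul, mul_one_div_cancel hq0.ne',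
      ENNReal.rpow_one]

/-- **Schur's test**: a kernel whose absolute value has uniformly bounded marginals defines a
bounded operator on `L^p` for every `1 ≤ p ≤ ∞`. -/
theorem exists_continuousLinearMap_of_kernel [SFinite μ] {K : α → α → ℂ}
    (hK : StronglyMeasurable (Function.uncurry K)) {C : ℝ≥0∞} (hC : C ≠ ⊤)
    (h1 : ∀ x, ∫⁻ y, ‖K x y‖ₑ ∂μ ≤ C) (h2 : ∀ y, ∫⁻ x, ‖K x y‖ₑ ∂μ ≤ C) (p : ℝ≥0∞)
    [hp : Fact (1 ≤ p)] :
    ∃ A : Lp ℂ p μ →L[ℂ] Lp ℂ p μ, ∀ (u : α → ℂ) (hu : MemLp u p μ),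
      (A (hu.toLp u) : α → ℂ) =ᵐ[μ] fun x => ∫ y, K x y * u y ∂μ := by
  have hk : Measurable (Function.uncurry fun x y => ‖K x y‖ₑ) := hK.enorm
  have hlin : ∀ {u : α → ℂ}, AEStronglyMeasurable u μ →
      eLpNorm (fun x => ∫⁻ y, ‖K x y‖ₑ * ‖u y‖ₑ ∂μ) p μ ≤ C * eLpNorm u p μ := fun hu =>
    eLpNorm_lintegral_le hk hC h1 h2 hu hp.out
  have hprod : ∀ {u : α → ℂ}, AEStronglyMeasurable u μ →
      AEStronglyMeasurable (fun q : α × α => K q.1 q.2 * u q.2) (μ.prod μ) := fun hu =>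
    hK.aestronglyMeasurable.mul hu.comp_snd
  have hle : ∀ {u : α → ℂ}, MemLp u p μ →
      eLpNorm (fun x => ∫ y, K x y * u y ∂μ) p μ ≤ C * eLpNorm u p μ := fun {u} hu => by
    refine (eLpNorm_mono_enorm fun x => ?_).trans (hlin hu.1)
    rw [enorm_eq_self]
    refine (enorm_integral_le_lintegral_enorm _).trans (le_of_eq ?_)
    simp only [enorm_mul]
  have hmem : ∀ {u : α → ℂ}, MemLp u p μ → MemLp (fun x => ∫ y, K x y * u y ∂μ) p μ := fun {u} hu =>
    ⟨(hprod hu.1).integral_prod_right', (hle hu).trans_lt (ENNReal.mul_lt_top hC.lt_top hu.2)⟩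
  -- A function of finite `L^p` norm is finite almost everywhere; this is what makes the integral
  -- operator additive.
  have hint : ∀ {u : α → ℂ}, MemLp u p μ → ∀ᵐ x ∂μ, Integrable (fun y => K x y * u y) μ :=
    fun {u} hu => by
      have hfin : eLpNorm (fun x => ∫⁻ y, ‖K x y‖ₑ * ‖u y‖ₑ ∂μ) p μ < ⊤ :=
        (hlin hu.1).trans_lt (ENNReal.mul_lt_top hC.lt_top hu.2)
      have hm : AEMeasurable (fun x => ∫⁻ y, ‖K x y‖ₑ * ‖u y‖ₑ ∂μ) μ :=
        (hk.aemeasurable.mul hu.1.comp_snd.enorm).lintegral_prod_right'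
      have hae : ∀ᵐ x ∂μ, ∫⁻ y, ‖K x y‖ₑ * ‖u y‖ₑ ∂μ < ⊤ := by
        rcases eq_or_ne p ⊤ with rfl | hp'
        · rw [eLpNorm_exponent_top] at hfin
          filter_upwards [ae_le_eLpNormEssSup (f := fun x => ∫⁻ y, ‖K x y‖ₑ * ‖u y‖ₑ ∂μ) (μ := μ)]
            with x hx
          rw [enorm_eq_self] at hx
          exact hx.trans_lt hfin
        · have hp0 : p ≠ 0 := (zero_lt_one.trans_le hp.out).ne'
          have hq := ENNReal.toReal_pos hp0 hp'
          have hfin' := lintegral_rpow_enorm_lt_top_of_eLpNorm_lt_top hp0 hp' hfin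
          simp only [enorm_eq_self] at hfin'
          filter_upwards [ae_lt_top' (hm.pow_const _) hfin'.ne] with x hx
          exact (ENNReal.rpow_lt_top_iff_of_pos hq).1 hx
      filter_upwards [hae, (hprod hu.1).prodMk_left] with x hx hxm
      refine ⟨hxm, ?_⟩
      rw [HasFiniteIntegral]
      simpa only [enorm_mul] using hx
  let A₀ : Lp ℂ p μ →ₗ[ℂ] Lp ℂ p μ :=
    { toFun := fun u => (hmem (Lp.memLp u)).toLp _
      map_add' := fun u w => by
        rw [← MemLp.toLp_add]
        refine MemLp.toLp_congr _ _ ?_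
        filter_upwards [hint (Lp.memLp u), hint (Lp.memLp w)] with x hx1 hx2
        rw [Pi.add_apply, ← integral_add hx1 hx2]
        refine integral_congr_ae ?_
        filter_upwards [Lp.coeFn_add u w] with y hy
        rw [hy, Pi.add_apply, mul_add]
      map_smul' := fun c u => by
        rw [RingHom.id_apply, ← MemLp.toLp_const_smul]
        refine MemLp.toLp_congr _ _ (Eventually.of_forall fun x => ?_)
        simp only [Pi.smul_apply, smul_eq_mul]
        rw [← integral_const_mul]
        refine integral_congr_ae ?_
        filter_upwards [Lp.coeFn_smul c u] with y hy
        rw [hy, Pi.smul_apply, smul_eq_mul]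
        ring }
  refine ⟨A₀.mkContinuous C.toReal fun u => ?_, fun u hu => ?_⟩
  · change ‖(hmem (Lp.memLp u)).toLp _‖ ≤ _
    rw [Lp.norm_toLp, Lp.norm_def, ← ENNReal.toReal_mul]
    exact ENNReal.toReal_mono (ENNReal.mul_ne_top hC (Lp.eLpNorm_ne_top u)) (hle (Lp.memLp u))
  · refine ((hmem (Lp.memLp (hu.toLp u))).coeFn_toLp).trans (Eventually.of_forall fun x => ?_)
    refine integral_congr_ae ?_
    filter_upwards [hu.coeFn_toLp] with y hy
    rw [hy]

end Schur

/-! ### The operator `Q D₀ Q` -/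

theorem toL2_vfun_mem_span {V : Plane → ℝ}
    (h : MemLp (fun z => (vfun V z : ℂ)) 2 (volume : Measure Plane)) :
    toL2 (fun z => (vfun V z : ℂ)) ∈
      Submodule.span ℂ {f : L2 | (f : Plane → ℂ) =ᵐ[volume] fun x => (vfun V x : ℂ)} :=
  Submodule.subset_span (coeFn_toL2 h)

theorem QD0Q_toL2_vfun {V : Plane → ℝ} (T : L2 →L[ℂ] L2)
    (h : MemLp (fun z => (vfun V z : ℂ)) 2 (volume : Measure Plane)) :
    QD0Q V T (toL2 fun z => (vfun V z : ℂ)) = 0 := by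
  have h0 : (QL2 V).orthogonalProjectionOnto (toL2 fun z => (vfun V z : ℂ)) = 0 :=
    Submodule.orthogonalProjectionOnto_eq_zero_iff.2
      (Submodule.le_orthogonal_orthogonal _ (toL2_vfun_mem_span h))
  simp only [QD0Q, ContinuousLinearMap.comp_apply, h0, map_zero]

/-- With `QD0Q_toL2_vfun`, this is all that the kernel estimate uses about `Q D₀ Q` beyond
boundedness. -/
theorem inner_toL2_vfun_QD0Q {V : Plane → ℝ} (T : L2 →L[ℂ] L2)
    (h : MemLp (fun z => (vfun V z : ℂ)) 2 (volume : Measure Plane)) (g : L2) :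
    inner ℂ (toL2 fun z => (vfun V z : ℂ)) (QD0Q V T g) = 0 :=
  (Submodule.mem_orthogonal _ _).1 (D0 V T ((QL2 V).orthogonalProjectionOnto g)).2 _
    (toL2_vfun_mem_span h)

end WaveOp2D

/-! ### Assembly: kernel bound, Schur's test and identification of the operator -/

theorem corollary3p3
    (V : Plane → ℝ) (hV : Measurable V)
    (C ε : ℝ) (hε : 0 < ε)
    (hdecay : ∀ x : Plane, vfun V x ≤ C * bracket x ^ (-(3 + ε)))
    (l₁ : ℝ) (hl₁ : 0 < l₁)
    (χ : ℝ → ℝ) (hχ : ContDiff ℝ ∞ χ)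
    (hχ_one : ∀ l : ℝ, 0 < l → l < l₁ → χ l = 1)
    (hχ_zero : ∀ l : ℝ, 2 * l₁ < l → χ l = 0) :
    ∃ T : L2 →L[ℂ] L2, IsUvGv V T ∧ IsUnit (QTQ V T + S1 V T) ∧
      (∀ u : Plane → ℂ, Integrable u volume → OpConverges V (QD0Q V T) χ u) ∧
      ∀ (p : ℝ≥0∞) [Fact (1 ≤ p)],
        ∃ A : Lp ℂ p (volume : Measure Plane) →L[ℂ] Lp ℂ p (volume : Measure Plane),
          ∀ (u : Plane → ℂ) (_ : Integrable u volume) (hu : MemLp u p volume),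
            (A (hu.toLp u) : Plane → ℂ) =ᵐ[volume] lowEnergyOp V (QD0Q V T) χ u := by
  obtain ⟨C', hC', hv⟩ := exists_vfun_le hε hdecay
  obtain ⟨T, hT, hunit⟩ := exists_isUvGv hV hε hC' hv
  have hv2 := memLp_vfun hV hε hv
  -- The endpoint `3 l₁` lies inside the open set where `χ` vanishes, so `χ'` vanishes there too and
  -- the boundary terms drop out.
  have hχ_far : ∀ l, 3 * l₁ ≤ l → χ l = 0 := fun l hl => hχ_zero l (by linarith)
  have hχ_deriv : deriv χ (3 * l₁) = 0 := by
    have h : χ =ᶠ[nhds (3 * l₁)] fun _ => 0 := by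
      filter_upwards [Ioi_mem_nhds (by linarith : 2 * l₁ < 3 * l₁)] with l hl
      exact hχ_zero l hl
    rw [h.deriv_eq, deriv_const]
  refine ⟨T, hT, hunit, fun u hu => opConverges hV hε hC' hv _ hχ.continuous hχ_far hu,
    fun p _ => ?_⟩
  obtain ⟨D, hD, hK⟩ := exists_norm_lowEnergyKernel_le hV hε hC' hv hχ (by positivity) hχ_far
    hχ_deriv (QD0Q_toL2_vfun T hv2) (inner_toL2_vfun_QD0Q T hv2)
  obtain ⟨R, hR, hrad⟩ := exists_integral_radialKernel
  have hmarg : ∀ x, ∫⁻ y, ‖D * radialKernel x y‖ₑ ≤ ENNReal.ofReal (D * R) := fun x => by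
    have h0 : ∀ y, 0 ≤ D * radialKernel x y := fun y => mul_nonneg hD (radialKernel_nonneg x y)
    have hi := (hrad x).1.const_mul D
    simp only [Real.enorm_of_nonneg (h0 _)]
    rw [← ofReal_integral_eq_lintegral_ofReal hi (Filter.Eventually.of_forall h0),
      integral_const_mul]
    exact ENNReal.ofReal_le_ofReal (mul_le_mul_of_nonneg_left (hrad x).2 hD)
  have hle : ∀ x y, ‖lowEnergyKernel V (QD0Q V T) χ x y‖ₑ ≤ ‖D * radialKernel x y‖ₑ := fun x y => by
    rw [enorm_le_iff_norm_le]
    exact (hK x y).trans (le_abs_self _)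
  obtain ⟨A, hA⟩ := exists_continuousLinearMap_of_kernel (μ := (volume : Measure Plane))
    (K := lowEnergyKernel V (QD0Q V T) χ)
    (measurable_lowEnergyKernel hV hε hC' hv (QD0Q V T) hχ.continuous) ENNReal.ofReal_ne_top
    (fun x => (lintegral_mono (hle x)).trans (hmarg x))
    -- The column bound follows from the row bound because the radial kernel is symmetric.
    (fun y => (lintegral_mono fun x => by
      rw [← radialKernel_comm]; exact hle x y).trans (hmarg y)) p
  refine ⟨A, fun u hu1 hup => (hA u hup).trans (Filter.Eventually.of_forall fun x => ?_)⟩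
  exact (lowEnergyOp_eq hV hε hC' hv (QD0Q V T) hχ.continuous hχ_far hu1 x).symm
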